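/- **Setting.** Let $\Bbbk$ be a field with $2\neq 0$ in $\Bbbk$, and let $N=|\mathbf x|$ be the number of punctures. Let $\mathcal C$ be the $\Bbbk$-linear category with objects $T_0,\dots,T_N$, morphism spaces $\mathrm{Hom}(T_i,T_j)=\bigoplus_{\alpha\ge 0}\Bbbk\,a_{ji}s^\alpha$ in degree $0$, and composition $$a_{kj}s^\beta\cdot a_{ji}s^\alpha=a_{ki}s^{\alpha+\beta+\delta(i,j,k)},\qquad \delta(i,j,k)=\begin{cases}0,&(i-j)(j-k)\ge 0,\\ \min(|i-j|,|j-k|),&(i-j)(j-k)<0.\end{cases}$$ Regard $\mathcal C$ as an $A_\infty$-category with $\mu^d=0$ for $d\ne2$. Let $\mathrm{Tw}^b(\mathcal C)$ be the category of bounded twisted complexes over $\mathcal C$, with $\mu^1(f)=(-1)^{|f|}\delta\cdot f-f\cdot\delta$ and $\mu^2(f_2,f_1)=(-1)^{|f_1|}f_2\cdot f_1$, where the dot is the composition without signs. Write $s_i^\alpha=a_{ii}s^\alpha$ and $e_i=s_i^0$. Let $1\le i\le N-1$. The negative braiding functor $\beta_{i^-}\colon\mathcal C\to\mathrm{Tw}^b(\mathcal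 C)$ is the $A_\infty$-functor with the following components. * $\beta_{i^-}T_j=T_j$ for $j\ne i$, and $\beta_{i^-}T_i=\bigl(T_i\xrightarrow{\delta=[a_{i-1,i},\,-a_{i+1,i}]}T_{i-1}\oplus T_{i+1}\bigr)$ in degrees $-1$ and $0$. * $\beta^1_{i^-}(a_{kj}s^\alpha)=a_{kj}s^\alpha$ for $j,k\neq i$; $\beta^1_{i^-}(a_{ij}s^\alpha)=a_{i+\mathrm{sgn}(j-i),j}s^\alpha$ for $j\ne i$; $\beta^1_{i^-}(a_{ki}s^\alpha)$ has the components $a_{k,i-1}s^{\alpha}$, $a_{k,i+1}s^{\alpha+1}$ if $k>i$, and $a_{k,i-1}s^{\alpha+1}$, $a_{k,i+1}s^{\alpha}$ if $k<i$; $\beta^1_{i^-}(s_i^\alpha)$ is $s^\alpha$ on each of the three summands. * $\beta^2_{i^-}(a_{ik}s^\beta,a_{kj}s^\alpha)=\mathrm{sgn}(i-k)\,a_{ij}s^{\alpha+\beta+|i-k|-1}$ into the summand of degree $-1$, if $(i-j)(i-k)<0$; $\beta^2_{i^-}(a_{ik}s^\beta,a_{ki}s^\alpha)=\mathrm{sgn}(i-k)\,a_{i,i+\mathrm{sgn}(i-k)}s^{\alpha+\beta+|i-k|-1}$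 from the summand $T_{i+\mathrm{sgn}(i-k)}$ to the summand of degree $-1$, if $k\ne i$; all other $\beta^2_{i^-}$ vanish, and $\beta^d_{i^-}=0$ for $d\ge3$. Let $\mathrm{id}\colon\mathcal C\to\mathrm{Tw}^b(\mathcal C)$ be the inclusion. A pre-natural transformation $\eta\colon\mathrm{id}\Rightarrow\beta_{i^-}$ of degree $g$ is a family of multilinear maps $\eta^d\colon\mathrm{Hom}(X_{d-1},X_d)\otimes\cdots\otimes\mathrm{Hom}(X_0,X_1)\to\mathrm{Hom}^{g-d}(X_0,\beta_{i^-}X_d)$, $d\ge 0$, for generators $X_0,\dots,X_d$. The differential is the standard one of the $A_\infty$-category of functors: $$\begin{aligned}\mu^1_{\mathrm{Fun}}(\eta)^d(a_d,\dots,a_1)={}&\mu^1(\eta^d(a_d,\dots,a_1))+\sum_{0\le s<d}\mu^2(\beta_{i^-}^{d-s}(a_d,\dots,a_{s+1}),\eta^s(a_s,\dots,a_1))\\&+(-1)^{g-1}\mu^2(\eta^{d-1}(a_d,\dots,a_2),a_1)-\sum_{0\le n\le d-2}(-1)^{-n+g-1}\eta^{d-1}(a_d,\dots,a_{n+2}\cdot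 a_{n+1},\dots,a_1),\end{aligned}$$ where the third term is present for $d\ge1$. Natural transformations are the cocycles, and $H^g\mathrm{Hom}(\mathrm{id},\beta_{i^-})$ is the cohomology. Let $\mathfrak B_{i^-}\subset\Delta$ be the sub-bimodule of the diagonal $\mathcal C$-bimodule spanned by all $a_{kj}s^\alpha$ except $e_i$. For $\vartheta=(\vartheta_j)_{1\le j\le N-1,\,j\ne i}$ put $\vartheta_0=\vartheta_i=\vartheta_N=0$. For a path $T_i\to T_j\to T_k$ (in this formula $i,j,k$ are arbitrary) let $$\mathfrak C(a_{kj}s^\beta,a_{ji}s^\alpha)=\begin{cases}-\beta\vartheta_j-\sum_{t=1}^{j-k}2(\beta+t)\vartheta_{j-t}-(\beta+j-k)\bigl(\vartheta_{k-1}+\sum_{i<v<k}(\vartheta_v+\vartheta_{v-1})\bigr),&i<k\le j,\\ \beta\vartheta_j+\sum_{t=1}^{k-j}2(\beta+t)\vartheta_{j+t}+(\beta+k-j)\bigl(\vartheta_{k+1}+\sum_{k<v<i}(\vartheta_v+\vartheta_{v+1})\bigr),&j\le k<i,\\ -\beta\vartheta_j-\sum_{t=1}^{j-i}2(\beta+t)\vartheta_{j-t}+(\beta+j-i)\vartheta_i,&k\le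 i<j,\\ \beta\vartheta_j+\sum_{t=1}^{i-j}2(\beta+t)\vartheta_{j+t}-(\beta+i-j)\vartheta_i,&j<i\le k,\\ -\beta\sum_{i<v\le j}(\vartheta_v+\vartheta_{v-1}),&i<j<k,\\ \beta\sum_{j\le v<i}(\vartheta_v+\vartheta_{v+1}),&k<j<i,\\ 0,&i=j.\end{cases}$$ **Theorem.** There are degree $2$ natural transformations $\eta_\vartheta\colon\mathrm{id}\Rightarrow\beta_{i^-}$, depending linearly on $\vartheta\in\Bbbk^{N-2}$, such that $\vartheta\mapsto[\eta_\vartheta]$ is an isomorphism from $\Bbbk^{N-2}$ onto $H^2\mathrm{Hom}(\mathrm{id},\beta_{i^-})$; moreover $\mathrm{HH}^2(\mathfrak B_{i^-})\cong\Bbbk^{N-2}$. Their components are as follows. 1. $\eta^d=0$ for $d\notin\{2,3\}$, and $$\eta^2(a_{lk}s^\beta,a_{kj}s^\alpha)=\begin{cases}\mathfrak C(a_{lk}s^\beta,a_{kj}s^\alpha)\,a_{lj}s^{\beta+\alpha+\delta(j,k,l)-1},&l\ne i,\\ \mathfrak C(a_{ik}s^\beta,a_{kj}s^\alpha)\,a_{i+\mathrm{sgn}(j-i),j}s^{\beta+\alpha+\delta(j,k,i)-1},&l=i\ne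 j,\\ \mathfrak C(a_{ik}s^\beta,a_{ki}s^\alpha)\bigl[\tfrac12a_{i-1,i}s^{\beta+\alpha+|i-k|-2},\ \tfrac12a_{i+1,i}s^{\beta+\alpha+|i-k|-2}\bigr],&l=j=i\end{cases}$$ (the coefficient $\mathfrak C$ vanishes whenever the exponent of $s$ is negative). 2. $\eta^3(a_3,a_2,a_1)=0$ unless $a_3$ ends at $T_i$. If $a_3$ ends at $T_i$, then $\eta^3(a_3,a_2,a_1)$ is the unique element of degree $-1$ with $$\delta\cdot\eta^3(a_3,a_2,a_1)=\beta^1_{i^-}(a_3)\cdot\eta^2(a_2,a_1)-\eta^2(a_3,a_2)\cdot a_1+\eta^2(a_3,a_2\cdot a_1)-\eta^2(a_3\cdot a_2,a_1).$$ 3. If $\vartheta\ne0$, then for every $l$ there are composable $a_1,a_2$ and $a_3\in\mathrm{Hom}(T_l,T_i)$ with $\eta_\vartheta^3(a_3,a_2,a_1)\neq0$. -/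

import Mathlib

open Polynomial

noncomputable section

namespace KLRW

/-! ### The category `C` of the generators `T_0, …, T_N`

Every morphism space `Hom(T_i, T_j)` has the basis `a_{ji} s^α` (`α ≥ 0`), all in degree `0`; it is
identified with `k[X]` by `a_{ji} s^α ↔ X ^ α`. Composites are read from right to left. -/

/-- The number `δ(i,j,k)` of dots created when `T_i → T_j` is followed by `T_j → T_k`. -/
def turn (i j k : ℕ) : ℕ :=
  if 0 ≤ ((i : ℤ) - j) * ((j : ℤ) - k) then 0
  else min ((i : ℤ) - j).natAbs ((j : ℤ) - k).natAbs

/-- `a_{kj} s^β · a_{ji} s^α = a_{ki} s^{β + α + δ(i,j,k)}`, extended bilinearly. -/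
def mul {k : Type*} [Field k] (v₀ v₁ v₂ : ℕ) (g f : k[X]) : k[X] :=
  X ^ turn v₀ v₁ v₂ * g * f

/-- The scalar `(-1)^z`. -/
def sign (k : Type*) [Field k] (z : ℤ) : k := ((z.negOnePow : ℤ) : k)

/-! ### Bounded twisted complexes over `C` -/

/-- A possible summand of a twisted complex: the `copy`-th copy of `T_vtx` in degree `deg`. -/
@[ext] structure Slot (N : ℕ) where
  deg : ℤ
  vtx : Fin (N + 1)
  copy : ℕ
deriving DecidableEq

/-- Matrices of morphisms of `C`; the entry `f b a` is a morphism from the summand `a` to the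
summand `b`. -/
abbrev Mat (k : Type*) [Field k] (N : ℕ) := Matrix (Slot N) (Slot N) k[X]

/-- A bounded twisted complex over `C`: a finite set of summands with a differential `δ` of degree
`1` and square zero (as `μ^d = 0` in `C` for `d ≠ 2`, this is the Maurer-Cartan equation). -/
structure Tw (k : Type*) [Field k] (N : ℕ) where
  supp : Finset (Slot N)
  diff : Mat k N
  diff_deg : ∀ b a, diff b a ≠ 0 → b ∈ supp ∧ a ∈ supp ∧ b.deg = a.deg + 1
  diff_sq : ∀ c a, ∑ b ∈ supp, mul a.vtx b.vtx c.vtx (diff c b) (diff b a) = 0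

section
variable {k : Type*} [Field k] {N : ℕ}

/-- `Hom^g(Y, Z)` in twisted complexes. -/
def Tw.hom (Y Z : Tw k N) (g : ℤ) : Submodule k (Mat k N) where
  carrier := {f | ∀ b a, f b a ≠ 0 → b ∈ Z.supp ∧ a ∈ Y.supp ∧ b.deg = a.deg + g}
  add_mem' := by
    intro f f' hf hf' b a h
    by_cases h0 : f b a = 0
    · refine hf' b a fun h1 => h ?_
      rw [Matrix.add_apply, h0, h1, add_zero]
    · exact hf b a h0
  zero_mem' := fun _ _ h => absurd rfl h
  smul_mem' := by
    intro c f hf b a h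
    refine hf b a fun h1 => h ?_
    rw [Matrix.smul_apply, h1, smul_zero]

/-- The composite `f₂ · f₁` without signs, through the middle object `Y`. -/
def Tw.dot (Y : Tw k N) (f₂ f₁ : Mat k N) : Mat k N :=
  fun c a => ∑ b ∈ Y.supp, mul a.vtx b.vtx c.vtx (f₂ c b) (f₁ b a)

/-- `μ¹(f) = (-1)^{|f|} δ · f - f · δ` for `f : Y → Z` of degree `g`. -/
def mu1 (Y Z : Tw k N) (g : ℤ) (f : Mat k N) : Mat k N :=
  sign k g • Z.dot Z.diff f - Y.dot f Y.diff

/-- `μ²(f₂, f₁) = (-1)^{|f₁|} f₂ · f₁` for `f₁` of degree `g₁`, with middle object `Y`. -/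
def mu2 (Y : Tw k N) (g₁ : ℤ) (f₂ f₁ : Mat k N) : Mat k N :=
  sign k g₁ • Y.dot f₂ f₁

end

/-! ### Families of operations on chains of morphisms of `C`

A chain `T_{v 0} → T_{v 1} → ⋯ → T_{v d}` is given by `v : Fin (d+1) → Fin (N+1)` and
`a : Fin d → k[X]`, where `a n : T_{v n} → T_{v (n+1)}`. So `a 0, a 1, …` are the morphisms which
are usually written `a_1, a_2, …`. -/

/-- Families of functions `η^d(a_d, …, a_1)` with values in `M`. -/
abbrev Ops (k : Type*) [Field k] (N : ℕ) (M : Type*) :=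
  ∀ d : ℕ, (Fin (d + 1) → Fin (N + 1)) → (Fin d → k[X]) → M

/-- Multilinearity over `k`. -/
def IsMultilin (k : Type*) [Field k] {M : Type*} [AddCommGroup M] [Module k M] {d : ℕ}
    (f : (Fin d → k[X]) → M) : Prop :=
  ∃ m : MultilinearMap k (fun _ : Fin d => k[X]) M, ⇑m = f

section
variable {k : Type*} [Field k] {N : ℕ}

/-- The first `s` entries of a tuple of length `d`. -/
def low {A : Type*} {d : ℕ} (s : ℕ) (h : s ≤ d) (a : Fin d → A) : Fin s → A :=
  fun n => a (n.castLE h)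

/-- The entries `s, s+1, …` of a tuple of length `d`, where `s + r = d`. -/
def upp {A : Type*} {d : ℕ} (s r : ℕ) (h : s + r ≤ d) (a : Fin d → A) : Fin r → A :=
  fun n => a ⟨s + n, by omega⟩

/-- The vertices of a chain after `a_{n+2}` and `a_{n+1}` have been composed. -/
def dropVtx {d : ℕ} (n : Fin d) (v : Fin (d + 2) → Fin (N + 1)) : Fin (d + 1) → Fin (N + 1) :=
  fun m => v (n.succ.castSucc.succAbove m)

/-- The morphisms of a chain after `a_{n+2}` and `a_{n+1}` have been composed. -/
def mulAt {d : ℕ} (n : Fin d) (v : Fin (d + 2) → Fin (N + 1)) (a : Fin (d + 1) → k[X]) :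
    Fin d → k[X] :=
  fun m =>
    if m < n then a m.castSucc
    else if m = n then
      mul (v n.castSucc.castSucc) (v n.castSucc.succ) (v n.succ.succ) (a n.succ) (a n.castSucc)
    else a m.succ

/-- `∑_n c(n) η^{d-1}(a_d, …, a_{n+3}, a_{n+2} · a_{n+1}, a_n, …, a_1)`. -/
def insertMul {M : Type*} [AddCommGroup M] [Module k M] (c : ℕ → k) (η : Ops k N M) : Ops k N M
  | 0, _, _ => 0
  | d + 1, v, a => ∑ n : Fin d, c n • η d (dropVtx n v) (mulAt n v a)

/-- The object map and the components `F^d` (`d ≥ 1`; the entry for `d = 0` is never used) of an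
`A_∞`-functor from `C` to twisted complexes. -/
structure AFunctor (k : Type*) [Field k] (N : ℕ) where
  obj : Fin (N + 1) → Tw k N
  map : Ops k N (Mat k N)

/-- Pre-natural transformations `F ⇒ G` of degree `g`: multilinear maps `η^d`, `d ≥ 0`, on chains of
length `d`, with values in `Hom^{g-d}(F X_0, G X_d)`. -/
def PreNat (F G : AFunctor k N) (g : ℤ) : Submodule k (Ops k N (Mat k N)) where
  carrier := {η | ∀ d v, IsMultilin k (η d v) ∧
    ∀ a, η d v a ∈ (F.obj (v 0)).hom (G.obj (v (Fin.last d))) (g - d)}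
  add_mem' := by
    intro η η' h h' d v
    obtain ⟨⟨m, hm⟩, h2⟩ := h d v
    obtain ⟨⟨m', hm'⟩, h2'⟩ := h' d v
    refine ⟨⟨m + m', ?_⟩, fun a => Submodule.add_mem _ (h2 a) (h2' a)⟩
    funext a
    change m a + m' a = η d v a + η' d v a
    rw [hm, hm']
  zero_mem' := fun d v => ⟨⟨0, rfl⟩, fun _ => Submodule.zero_mem _⟩
  smul_mem' := by
    intro c η h d v
    obtain ⟨⟨m, hm⟩, h2⟩ := h d v
    refine ⟨⟨c • m, ?_⟩, fun a => Submodule.smul_mem _ c (h2 a)⟩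
    funext a
    change c • m a = c • η d v a
    rw [hm]

/-- The differential `μ¹_{Fun}` on pre-natural transformations of degree `g`, as a formula. Twisted
complexes only have `μ¹` and `μ²`, `C` only has `μ²`, and all morphisms of `C` have degree `0`, so
that `μ¹_{Fun}(η)^d(a_d, …, a_1)` is the sum of
* `μ¹(η^d(a_d, …, a_1))`,
* `μ²(G^{d-s}(a_d, …, a_{s+1}), η^s(a_s, …, a_1))` for `0 ≤ s < d`,
* `(-1)^{(g-1)(-s)} μ²(η^{d-s}(a_d, …, a_{s+1}), F^s(a_s, …, a_1))` for `0 < s ≤ d`,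
* `-(-1)^{-n+g-1} η^{d-1}(a_d, …, a_{n+2} · a_{n+1}, …, a_1)` for `0 ≤ n ≤ d - 2`. -/
def natDiffFun (F G : AFunctor k N) (g : ℤ) (η : Ops k N (Mat k N)) : Ops k N (Mat k N) :=
  fun d v a =>
    mu1 (F.obj (v 0)) (G.obj (v (Fin.last d))) (g - d) (η d v a)
    + ∑ s : Fin d, mu2 (G.obj (v s.castSucc)) (g - s)
        (G.map (d - s) (upp s (d - s + 1) (by omega) v) (upp s (d - s) (by omega) a))
        (η s (low (s + 1) (by omega) v) (low s (by omega) a))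
    + ∑ s : Fin d, sign k ((g - 1) * (-(s + 1))) • mu2 (F.obj (v s.succ)) (1 - (s + 1))
        (η (d - (s + 1)) (upp (s + 1) (d - (s + 1) + 1) (by omega) v)
          (upp (s + 1) (d - (s + 1)) (by omega) a))
        (F.map (s + 1) (low (s + 1 + 1) (by omega) v) (low (s + 1) (by omega) a))
    - insertMul (fun n => sign k (-n + g - 1)) η d v a

lemma mul_add_right' (v₀ v₁ v₂ : ℕ) (g f f' : k[X]) :
    mul v₀ v₁ v₂ g (f + f') = mul v₀ v₁ v₂ g f + mul v₀ v₁ v₂ g f' := mul_add _ _ _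

lemma mul_add_left' (v₀ v₁ v₂ : ℕ) (g g' f : k[X]) :
    mul v₀ v₁ v₂ (g + g') f = mul v₀ v₁ v₂ g f + mul v₀ v₁ v₂ g' f := by
  unfold mul; ring

lemma mul_smul_right' (v₀ v₁ v₂ : ℕ) (c : k) (g f : k[X]) :
    mul v₀ v₁ v₂ g (c • f) = c • mul v₀ v₁ v₂ g f := by
  unfold mul; rw [mul_smul_comm]

lemma mul_smul_left' (v₀ v₁ v₂ : ℕ) (c : k) (g f : k[X]) :
    mul v₀ v₁ v₂ (c • g) f = c • mul v₀ v₁ v₂ g f := by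
  unfold mul; rw [mul_smul_comm, smul_mul_assoc]

lemma dot_add_right (Y : Tw k N) (g f f' : Mat k N) :
    Y.dot g (f + f') = Y.dot g f + Y.dot g f' := by
  funext c a
  simp only [Tw.dot, Matrix.add_apply, mul_add_right', Finset.sum_add_distrib]

lemma dot_add_left (Y : Tw k N) (g g' f : Mat k N) :
    Y.dot (g + g') f = Y.dot g f + Y.dot g' f := by
  funext c a
  simp only [Tw.dot, Matrix.add_apply, mul_add_left', Finset.sum_add_distrib]

lemma dot_smul_right (Y : Tw k N) (c : k) (g f : Mat k N) :
    Y.dot g (c • f) = c • Y.dot g f := by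
  funext b a
  simp only [Tw.dot, Matrix.smul_apply, mul_smul_right', Finset.smul_sum]

lemma dot_smul_left (Y : Tw k N) (c : k) (g f : Mat k N) :
    Y.dot (c • g) f = c • Y.dot g f := by
  funext b a
  simp only [Tw.dot, Matrix.smul_apply, mul_smul_left', Finset.smul_sum]

lemma insertMul_add {M : Type*} [AddCommGroup M] [Module k M] (c : ℕ → k) (η η' : Ops k N M) :
    insertMul c (η + η') = insertMul c η + insertMul c η' := by
  funext d v a
  cases d with
  | zero => simp [insertMul]
  | succ d => simp [insertMul, Finset.sum_add_distrib]

lemma insertMul_smul {M : Type*} [AddCommGroup M] [Module k M] (c : ℕ → k) (r : k)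
    (η : Ops k N M) : insertMul c (r • η) = r • insertMul c η := by
  funext d v a
  cases d with
  | zero => simp [insertMul]
  | succ d => simp [insertMul, Finset.smul_sum, smul_comm r]

/-- The differential `μ¹_{Fun}` in degree `g`, as a linear map. -/
def natDiff (F G : AFunctor k N) (g : ℤ) : Ops k N (Mat k N) →ₗ[k] Ops k N (Mat k N) where
  toFun := natDiffFun F G g
  map_add' := by
    intro η η'
    funext d v a
    simp only [natDiffFun, insertMul_add, Pi.add_apply, mu1, mu2, dot_add_left, dot_add_right,
      smul_add, Finset.sum_add_distrib]
    abel
  map_smul' := by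
    intro c η
    funext d v a
    simp only [natDiffFun, insertMul_smul, Pi.smul_apply, mu1, mu2, dot_smul_left, dot_smul_right,
      smul_comm _ c, RingHom.id_apply, ← Finset.smul_sum, ← smul_sub, ← smul_add]

/-- `A_∞`-natural transformations `F ⇒ G` of degree `g`: the cocycles of degree `g`. -/
def NatTrans (F G : AFunctor k N) (g : ℤ) : Submodule k (Ops k N (Mat k N)) :=
  PreNat F G g ⊓ LinearMap.ker (natDiff F G g)

/-- The coboundaries `μ¹_{Fun}(ζ)` of pre-natural transformations `ζ` of degree `g - 1`, as a
subspace of the natural transformations of degree `g`. -/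
def NatBoundary (F G : AFunctor k N) (g : ℤ) : Submodule k (NatTrans F G g) :=
  ((PreNat F G (g - 1)).map (natDiff F G (g - 1))).comap (NatTrans F G g).subtype

/-- `H^g Hom_{Fun}(F, G)`. -/
abbrev HNat (F G : AFunctor k N) (g : ℤ) := NatTrans F G g ⧸ NatBoundary F G g

/-- The class of a natural transformation in `H^g Hom_{Fun}(F, G)`. -/
def HNat.mk (F G : AFunctor k N) (g : ℤ) : NatTrans F G g →ₗ[k] HNat F G g :=
  (NatBoundary F G g).mkQ

end

/-! ### The identity and the negative braiding functor -/

/-- An index `1 ≤ i ≤ N - 1`; the functor `β_i⁻` exchanges the punctures `x_i` and `x_{i+1}`. -/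
structure Inner (N : ℕ) where
  val : ℕ
  pos : 0 < val
  lt : val < N

namespace Inner
variable {N : ℕ} (i : Inner N)

/-- The vertex `i`. -/
def mid : Fin (N + 1) := ⟨i.val, by have := i.lt; omega⟩
/-- The vertex `i - 1`. -/
def left : Fin (N + 1) := ⟨i.val - 1, by have := i.lt; omega⟩
/-- The vertex `i + 1`. -/
def right : Fin (N + 1) := ⟨i.val + 1, by have := i.lt; omega⟩
/-- The vertex `i + sgn(j - i)`, for `j ≠ i`. -/
def toward (j : Fin (N + 1)) : Fin (N + 1) := if i.mid < j then i.right else i.left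

lemma left_ne_right : i.left ≠ i.right := by
  intro h
  have h1 : i.val - 1 = i.val + 1 := congrArg Fin.val h
  omega

end Inner

/-- The summand `T_v` in degree `p`. -/
def slot {N : ℕ} (p : ℤ) (v : Fin (N + 1)) : Slot N := ⟨p, v, 0⟩

section
variable {k : Type*} [Field k] {N : ℕ}

/-- The matrix with the single entry `f`, from the summand `a` to the summand `b`. -/
def entry (b a : Slot N) (f : k[X]) : Mat k N := Matrix.single b a f

/-- `T_v` as a twisted complex. -/
def gen (v : Fin (N + 1)) : Tw k N where
  supp := {slot 0 v}
  diff := 0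
  diff_deg := fun _ _ h => absurd rfl h
  diff_sq := by intro c a; simp [mul]

/-- The inclusion of `C` into twisted complexes, that is, the identity functor on the generators:
`id^1(a) = a` and `id^d = 0` for `d ≠ 1`. -/
def idF : AFunctor k N where
  obj := gen
  map := fun d => match d with
    | 1 => fun v a => entry (slot 0 (v 1)) (slot 0 (v 0)) (a 0)
    | _ => fun _ _ => 0

/-- The differential `[a_{i-1,i}, -a_{i+1,i}] : T_i → T_{i-1} ⊕ T_{i+1}`. -/
def braidDelta (i : Inner N) : Mat k N :=
  entry (slot 0 i.left) (slot (-1) i.mid) 1 - entry (slot 0 i.right) (slot (-1) i.mid) 1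

lemma braidDelta_ne {i : Inner N} {b a : Slot N} (h : (braidDelta i : Mat k N) b a ≠ 0) :
    (b = slot 0 i.left ∨ b = slot 0 i.right) ∧ a = slot (-1) i.mid := by
  by_contra hc
  apply h
  have h1 : ¬ (slot 0 i.left = b ∧ slot (-1) i.mid = a) := fun ⟨x, y⟩ => hc ⟨Or.inl x.symm, y.symm⟩
  have h2 : ¬ (slot 0 i.right = b ∧ slot (-1) i.mid = a) :=
    fun ⟨x, y⟩ => hc ⟨Or.inr x.symm, y.symm⟩
  simp only [braidDelta, entry, Matrix.sub_apply, Matrix.single, Matrix.of_apply, if_neg h1,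
    if_neg h2, sub_zero]

/-- The twisted complex `β_i⁻ T_i = (T_i → T_{i-1} ⊕ T_{i+1})`, in degrees `-1` and `0`. -/
def braidObj (i : Inner N) : Tw k N where
  supp := {slot (-1) i.mid, slot 0 i.left, slot 0 i.right}
  diff := braidDelta i
  diff_deg := by
    intro b a h
    obtain ⟨hb, rfl⟩ := braidDelta_ne h
    rcases hb with rfl | rfl <;> simp [slot]
  diff_sq := by
    intro c a
    refine Finset.sum_eq_zero fun b _ => ?_
    by_cases h1 : (braidDelta i : Mat k N) c b = 0
    · simp [mul, h1]
    by_cases h2 : (braidDelta i : Mat k N) b a = 0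
    · simp [mul, h2]
    have e1 := (braidDelta_ne h1).2
    have e2 := (braidDelta_ne h2).1
    rw [e1] at e2
    rcases e2 with e2 | e2 <;> simp [slot] at e2

/-- `β_i⁻` on a morphism `a_{kj} f`, where `f` is a polynomial in the dot `s`. -/
def braid1 (i : Inner N) (j l : Fin (N + 1)) (f : k[X]) : Mat k N :=
  if j ≠ i.mid then
    if l ≠ i.mid then entry (slot 0 l) (slot 0 j) f
    else entry (slot 0 (i.toward j)) (slot 0 j) f
  else if i.mid < l then
    entry (slot 0 l) (slot 0 i.left) f + entry (slot 0 l) (slot 0 i.right) (X * f)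
  else if l < i.mid then
    entry (slot 0 l) (slot 0 i.left) (X * f) + entry (slot 0 l) (slot 0 i.right) f
  else
    entry (slot (-1) i.mid) (slot (-1) i.mid) f + entry (slot 0 i.left) (slot 0 i.left) f
      + entry (slot 0 i.right) (slot 0 i.right) f

/-- The second component of `β_i⁻` on `T_j → T_m → T_l` with morphisms `a_{mj} f` and `a_{lm} g`. -/
def braid2 (i : Inner N) (j m l : Fin (N + 1)) (g f : k[X]) : Mat k N :=
  let h : k[X] := ((((i.val : ℤ) - (m : ℕ)).sign : ℤ) : k[X]) *
    (X ^ (((i.val : ℤ) - (m : ℕ)).natAbs - 1) * g * f)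
  if l ≠ i.mid ∨ m = i.mid then 0
  else if j = i.mid then
    if m < i.mid then entry (slot (-1) i.mid) (slot 0 i.right) h
    else entry (slot (-1) i.mid) (slot 0 i.left) h
  else if ((i.val : ℤ) - (j : ℕ)) * ((i.val : ℤ) - (m : ℕ)) < 0 then
    entry (slot (-1) i.mid) (slot 0 j) h
  else 0

/-- The negative braiding functor `β_i⁻` on `C`. -/
def braidF (i : Inner N) : AFunctor k N where
  obj := fun v => if v = i.mid then braidObj i else gen v
  map := fun d => match d with
    | 1 => fun v a => braid1 i (v 0) (v 1) (a 0)
    | 2 => fun v a => braid2 i (v 0) (v 1) (v 2) (a 1) (a 0)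
    | _ => fun _ _ => 0

end

/-! ### The bimodule `𝔅_i⁻` and its Hochschild cohomology -/

section
variable {k : Type*} [Field k] {N : ℕ}

/-- The sub-bimodule `𝔅_i⁻` of the diagonal bimodule `Δ(T_v, T_w) = Hom(T_v, T_w)`: the kernel of
the projection of `Δ` onto the simple bimodule spanned by the class of `e_i`. -/
def bimod (i : Inner N) (v w : Fin (N + 1)) : Submodule k k[X] where
  carrier := {f | v = i.mid → w = i.mid → f.coeff 0 = 0}
  add_mem' := by intro f g hf hg h1 h2; simp [hf h1 h2, hg h1 h2]
  zero_mem' := by intro _ _; simp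
  smul_mem' := by intro c f hf h1 h2; simp [hf h1 h2]

/-- Hochschild cochains of degree `g` of `C` with coefficients in `𝔅_i⁻`. -/
def BimodCochain (k : Type*) [Field k] (i : Inner N) (g : ℕ) : Submodule k (Ops k N k[X]) where
  carrier := {φ | (∀ d, d ≠ g → φ d = 0) ∧ ∀ d v, IsMultilin k (φ d v) ∧
    ∀ a, φ d v a ∈ bimod i (v 0) (v (Fin.last d))}
  add_mem' := by
    rintro η η' ⟨h0, h⟩ ⟨h0', h'⟩
    refine ⟨fun d hd => by simp [h0 d hd, h0' d hd], fun d v => ?_⟩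
    obtain ⟨⟨m, hm⟩, h2⟩ := h d v
    obtain ⟨⟨m', hm'⟩, h2'⟩ := h' d v
    refine ⟨⟨m + m', ?_⟩, fun a => Submodule.add_mem _ (h2 a) (h2' a)⟩
    funext a
    change m a + m' a = η d v a + η' d v a
    rw [hm, hm']
  zero_mem' := ⟨fun _ _ => rfl, fun d v => ⟨⟨0, rfl⟩, fun _ => Submodule.zero_mem _⟩⟩
  smul_mem' := by
    rintro c η ⟨h0, h⟩
    refine ⟨fun d hd => by simp [h0 d hd], fun d v => ?_⟩
    obtain ⟨⟨m, hm⟩, h2⟩ := h d v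
    refine ⟨⟨c • m, ?_⟩, fun a => Submodule.smul_mem _ c (h2 a)⟩
    funext a
    change c • m a = c • η d v a
    rw [hm]

/-- The Hochschild differential: `(dφ)(a_{d+1}, …, a_1)` is
`φ(a_{d+1}, …, a_2) · a_1 + ∑_{r=1}^{d} (-1)^r φ(…, a_{r+1} · a_r, …)
+ (-1)^{d+1} a_{d+1} · φ(a_d, …, a_1)`. -/
def bimodDiffFun (φ : Ops k N k[X]) : Ops k N k[X]
  | 0, _, _ => 0
  | d + 1, v, a =>
    mul (v 0) (v 1) (v (Fin.last (d + 1))) (φ d (Fin.tail v) (Fin.tail a)) (a 0)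
    + insertMul (fun n => (-1) ^ (n + 1)) φ (d + 1) v a
    + (-1 : k) ^ (d + 1) • mul (v 0) (v (Fin.last d).castSucc) (v (Fin.last (d + 1)))
        (a (Fin.last d)) (φ d (Fin.init v) (Fin.init a))

/-- The Hochschild differential as a linear map. -/
def bimodDiff (k : Type*) [Field k] (N : ℕ) : Ops k N k[X] →ₗ[k] Ops k N k[X] where
  toFun := bimodDiffFun
  map_add' := by
    intro φ φ'
    funext d v a
    cases d with
    | zero => simp [bimodDiffFun]
    | succ d =>
      simp only [bimodDiffFun, insertMul_add, Pi.add_apply, mul_add_left', mul_add_right',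
        smul_add]
      abel
  map_smul' := by
    intro c φ
    funext d v a
    cases d with
    | zero => simp [bimodDiffFun]
    | succ d =>
      simp only [bimodDiffFun, insertMul_smul, Pi.smul_apply, mul_smul_left', mul_smul_right',
        smul_comm _ c, RingHom.id_apply, ← smul_add]

/-- Hochschild cocycles of degree `g` with coefficients in `𝔅_i⁻`. -/
def BimodCocycle (k : Type*) [Field k] (i : Inner N) (g : ℕ) : Submodule k (Ops k N k[X]) :=
  BimodCochain k i g ⊓ LinearMap.ker (bimodDiff k N)

/-- The Hochschild cohomology `HH^{g+1}(𝔅_i⁻)`. -/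
abbrev HHBimod (k : Type*) [Field k] (i : Inner N) (g : ℕ) :=
  BimodCocycle k i (g + 1) ⧸
    ((BimodCochain k i g).map (bimodDiff k N)).comap (BimodCocycle k i (g + 1)).subtype

end

/-! ### The natural transformations of degree two -/

section
variable {k : Type*} [Field k] {N : ℕ}

/-- The parameters `(ϑ_j)` with `1 ≤ j ≤ N - 1` and `j ≠ i`. -/
abbrev Param (k : Type*) [Field k] (i : Inner N) := {j : ℕ // 0 < j ∧ j < N ∧ j ≠ i.val} → k

/-- The sequence `ϑ_0, ϑ_1, …, ϑ_N`, where `ϑ_0 = ϑ_i = ϑ_N = 0`. -/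
def Param.ext {i : Inner N} (ϑ : Param k i) (j : ℕ) : k :=
  if h : 0 < j ∧ j < N ∧ j ≠ i.val then ϑ ⟨j, h⟩ else 0

/-- The coefficient `ℭ(a_{lj} s^β, a_{ji} s^α)` of the path `T_i → T_j → T_l`. -/
def coeffC (ϑ : ℕ → k) (β i j l : ℕ) : k :=
  if i < l ∧ l ≤ j then
    -β * ϑ j - ∑ t ∈ Finset.Icc 1 (j - l), 2 * ((β : k) + t) * ϑ (j - t)
      - ((β : k) + (j - l : ℕ)) * (ϑ (l - 1) + ∑ t ∈ Finset.Ioo i l, (ϑ t + ϑ (t - 1)))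
  else if j ≤ l ∧ l < i then
    β * ϑ j + ∑ t ∈ Finset.Icc 1 (l - j), 2 * ((β : k) + t) * ϑ (j + t)
      + ((β : k) + (l - j : ℕ)) * (ϑ (l + 1) + ∑ t ∈ Finset.Ioo l i, (ϑ t + ϑ (t + 1)))
  else if l ≤ i ∧ i < j then
    -β * ϑ j - ∑ t ∈ Finset.Icc 1 (j - i), 2 * ((β : k) + t) * ϑ (j - t)
      + ((β : k) + (j - i : ℕ)) * ϑ i
  else if j < i ∧ i ≤ l then
    β * ϑ j + ∑ t ∈ Finset.Icc 1 (i - j), 2 * ((β : k) + t) * ϑ (j + t)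
      - ((β : k) + (i - j : ℕ)) * ϑ i
  else if i < j ∧ j < l then
    -β * ∑ t ∈ Finset.Ioc i j, (ϑ t + ϑ (t - 1))
  else if l < j ∧ j < i then
    β * ∑ t ∈ Finset.Ico j i, (ϑ t + ϑ (t + 1))
  else 0

/-- The value `η²(a_{lm} s^β, a_{mj} s^α)`. The coefficient vanishes whenever the exponent of `s`
would be negative. -/
def eta2 (i : Inner N) (ϑ : Param k i) (j m l : Fin (N + 1)) (β α : ℕ) : Mat k N :=
  let c : k := coeffC ϑ.ext β j m l
  let e : ℕ := β + α + turn j m l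
  if l ≠ i.mid then entry (slot 0 l) (slot 0 j) (c • X ^ (e - 1))
  else if j ≠ i.mid then entry (slot 0 (i.toward j)) (slot 0 j) (c • X ^ (e - 1))
  else entry (slot 0 i.left) (slot 0 i.mid) ((c / 2) • X ^ (e - 2))
    + entry (slot 0 i.right) (slot 0 i.mid) ((c / 2) • X ^ (e - 2))

/-- `β_i⁻(a_3) · η²(a_2, a_1) - η²(a_3, a_2) · a_1 + η²(a_3, a_2 · a_1) - η²(a_3 · a_2, a_1)`. -/
def homotopyRHS (i : Inner N) (η : Ops k N (Mat k N)) (v : Fin 4 → Fin (N + 1))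
    (a : Fin 3 → k[X]) : Mat k N :=
  ((braidF i).obj (v 2)).dot (braid1 i (v 2) (v 3) (a 2)) (η 2 ![v 0, v 1, v 2] ![a 0, a 1])
  - (gen (v 1)).dot (η 2 ![v 1, v 2, v 3] ![a 1, a 2]) (entry (slot 0 (v 1)) (slot 0 (v 0)) (a 0))
  + η 2 ![v 0, v 2, v 3] ![mul (v 0) (v 1) (v 2) (a 1) (a 0), a 2]
  - η 2 ![v 0, v 1, v 3] ![a 0, mul (v 1) (v 2) (v 3) (a 2) (a 1)]

/-- The description of the components of `η_ϑ`. -/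
structure HasComponents (i : Inner N) (ϑ : Param k i) (η : Ops k N (Mat k N)) : Prop where
  eta_zero : ∀ d, d ≠ 2 → d ≠ 3 → η d = 0
  eta_two : ∀ v α β, η 2 v ![X ^ α, X ^ β] = eta2 i ϑ (v 0) (v 1) (v 2) β α
  eta_three_of_ne : ∀ v a, v 3 ≠ i.mid → η 3 v a = 0
  eta_three : ∀ v a, v 3 = i.mid →
    (braidObj i).dot (braidDelta i) (η 3 v a) = homotopyRHS i η v a

end

end KLRW

end

/-!
The morphisms `[a_{i,i-1}, a_{i,i+1}] : β_i⁻ T_i → T_i` and `id : β_i⁻ T_l → T_l` for `l ≠ i` form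
a strict natural transformation `β_i⁻ ⇒ id`. Composition with it gives exact sequences
`0 → Hom⁻¹(T_p, β_i⁻ T_l) → Hom⁰(T_p, β_i⁻ T_l) → 𝔅_i⁻(p, l) → 0` whose first map is `δ`. Hence a
natural transformation of degree `2` is determined up to boundaries by the Hochschild `2`-cocycle
with values in `𝔅_i⁻` underlying `η²`, and `η³` is the unique solution of the homotopy equation:
`H² Hom(id, β_i⁻)` is `HH²(𝔅_i⁻)`.

The category `C` is generated by the arrows between neighbouring vertices, and the only relation at
an inner vertex `j` equates the two factorizations of the dot `s_j` through `T_{j-1}` and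
`T_{j+1}`. A cocycle is a coboundary precisely when its constant terms on the two factorizations
agree at every inner `j`; at `j = i` they vanish, because its values are in `𝔅_i⁻`.

The cocycle `ℭ` is `s⁻¹` times the coboundary of the rescaling
`a_{qp} s^α ↦ (descentWeight p q + α dotWeight p) a_{qp} s^α`, and its defect at `j` is `-2 ϑ_j`.
If `η³` vanishes on all triples whose last morphism goes from `T_l` to `T_i`, comparing the homotopy
equation for starting points on the two sides of `i` shows that `dotWeight` vanishes at all vertices
other than `i`, which means `ϑ = 0`.
-/

noncomputable section

namespace KLRW

/-! ### The braiding functor -/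

lemma two_mul_turn_add_dist (a b c : ℕ) :
    2 * turn a b c + Nat.dist a c = Nat.dist a b + Nat.dist b c := by
  unfold turn Nat.dist
  split_ifs with h
  · rcases mul_nonneg_iff.1 h with h | h <;> omega
  · rcases mul_neg_iff.1 (not_le.1 h) with h | h <;> omega

lemma turn_eq_iff (a b c n : ℕ) : turn a b c = n ↔
    2 * n + ((a - c) + (c - a)) = (a - b) + (b - a) + ((b - c) + (c - b)) := by
  have h := two_mul_turn_add_dist a b c
  simp only [Nat.dist] at h
  omega

lemma turn_assoc (a b c d : ℕ) : turn a b d + turn b c d = turn a c d + turn a b c := by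
  have h₁ := two_mul_turn_add_dist a b d
  have h₂ := two_mul_turn_add_dist b c d
  have h₃ := two_mul_turn_add_dist a c d
  have h₄ := two_mul_turn_add_dist a b c
  omega

lemma turn_comm (a b c : ℕ) : turn a b c = turn c b a := by
  have h := two_mul_turn_add_dist c b a
  simp only [Nat.dist] at h
  rw [turn_eq_iff]
  omega

@[simp] lemma turn_self_left (a c : ℕ) : turn a a c = 0 := by simp [turn]

@[simp] lemma turn_self_right (a c : ℕ) : turn a c c = 0 := by simp [turn]

namespace Inner
variable {N : ℕ} (i : Inner N)

/-- The neighbour of the vertex `i` on the side opposite to `toward j`. -/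
def away (j : Fin (N + 1)) : Fin (N + 1) := if i.mid < j then i.left else i.right

lemma mid_val : (i.mid : ℕ) = i.val := rfl

lemma toward_away_val (j : Fin (N + 1)) :
    (i.mid : ℕ) < j ∧ (i.toward j : ℕ) = i.mid + 1 ∧ (i.away j : ℕ) + 1 = i.mid ∨
      (j : ℕ) ≤ i.mid ∧ (i.toward j : ℕ) + 1 = i.mid ∧ (i.away j : ℕ) = i.mid + 1 := by
  have hpos : 1 ≤ i.val := i.pos
  by_cases h : i.mid < j
  · refine Or.inl ⟨h, ?_, ?_⟩
    · rw [toward, if_pos h]; rfl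
    · rw [away, if_pos h]; exact Nat.sub_add_cancel hpos
  · refine Or.inr ⟨not_lt.1 h, ?_, ?_⟩
    · rw [toward, if_neg h]; exact Nat.sub_add_cancel hpos
    · rw [away, if_neg h]; rfl

@[simp] lemma toward_ne_away (j : Fin (N + 1)) : i.toward j ≠ i.away j := by
  rw [Ne, Fin.ext_iff]
  have := i.toward_away_val j
  omega

@[simp] lemma away_ne_toward (j : Fin (N + 1)) : i.away j ≠ i.toward j :=
  (i.toward_ne_away j).symm

lemma toward_eq_or (p q : Fin (N + 1)) : i.toward p = i.toward q ∨ i.toward p = i.away q := by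
  rw [Fin.ext_iff, Fin.ext_iff]
  have := i.toward_away_val p
  have := i.toward_away_val q
  omega

variable {i} {p q : Fin (N + 1)}

lemma away_eq_toward_of_eq (h : i.toward p = i.away q) : i.away p = i.toward q := by
  rw [Fin.ext_iff] at *
  have := i.toward_away_val p
  have := i.toward_away_val q
  omega

lemma turn_toward_mid (hp : p ≠ i.mid) : turn p (i.toward p) i.mid = 0 := by
  have := i.toward_away_val p
  rw [Ne, Fin.ext_iff] at hp
  rw [turn_eq_iff]
  omega

lemma turn_away_mid (p : Fin (N + 1)) : turn p (i.away p) i.mid = 1 := by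
  have := i.toward_away_val p
  rw [turn_eq_iff]
  omega

lemma turn_mid_away (p : Fin (N + 1)) : turn p i.mid (i.away p) = 0 := by
  have := i.toward_away_val p
  rw [turn_eq_iff]
  omega

lemma turn_mid_toward (hp : p ≠ i.mid) : turn p i.mid (i.toward p) = 1 := by
  have := i.toward_away_val p
  rw [Ne, Fin.ext_iff] at hp
  rw [turn_eq_iff]
  omega

end Inner

section
variable {k : Type*} [Field k] {N : ℕ}

lemma mul_mul_assoc (a b c d : ℕ) (h g f : k[X]) :
    mul a b d (mul b c d h g) f = mul a c d h (mul a b c g f) := by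
  unfold mul
  calc X ^ turn a b d * (X ^ turn b c d * h * g) * f
      = X ^ (turn a b d + turn b c d) * h * g * f := by rw [pow_add]; ring
    _ = X ^ turn a c d * h * (X ^ turn a b c * g * f) := by rw [turn_assoc, pow_add]; ring

@[simp] lemma mul_zero_right (a b c : ℕ) (g : k[X]) : mul a b c g 0 = 0 := by simp [mul]

@[simp] lemma mul_zero_left (a b c : ℕ) (f : k[X]) : mul a b c 0 f = 0 := by simp [mul]

@[simp] lemma mul_one_left (a c : ℕ) (f : k[X]) : mul a c c 1 f = f := by simp [mul]

@[simp] lemma mul_one_right (a c : ℕ) (g : k[X]) : mul a a c g 1 = g := by simp [mul]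

lemma dot_assoc (Y Z : Tw k N) (h g f : Mat k N) :
    Y.dot (Z.dot h g) f = Z.dot h (Y.dot g f) := by
  funext d a
  calc Y.dot (Z.dot h g) f d a
      = ∑ b ∈ Y.supp, ∑ c ∈ Z.supp,
          mul a.vtx b.vtx d.vtx (mul b.vtx c.vtx d.vtx (h d c) (g c b)) (f b a) := by
        simp only [Tw.dot, mul, Finset.mul_sum, Finset.sum_mul]
    _ = ∑ c ∈ Z.supp, ∑ b ∈ Y.supp,
          mul a.vtx c.vtx d.vtx (h d c) (mul a.vtx b.vtx c.vtx (g c b) (f b a)) := by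
        simp only [mul_mul_assoc]
        exact Finset.sum_comm
    _ = Z.dot h (Y.dot g f) d a := by simp only [Tw.dot, mul, Finset.mul_sum]

/-- The composition through the middle object `Y` as a bilinear map, which gives access to the
lemmas on linear maps. -/
def dotBilin (Y : Tw k N) : Mat k N →ₗ[k] Mat k N →ₗ[k] Mat k N :=
  LinearMap.mk₂ k Y.dot (dot_add_left Y) (dot_smul_left Y) (dot_add_right Y) (dot_smul_right Y)

@[simp] lemma dot_zero_right (Y : Tw k N) (g : Mat k N) : Y.dot g 0 = 0 := map_zero (dotBilin Y g)

@[simp] lemma dot_zero_left (Y : Tw k N) (f : Mat k N) : Y.dot 0 f = 0 :=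
  LinearMap.map_zero₂ (dotBilin Y) f

lemma dot_sub_right (Y : Tw k N) (g f f' : Mat k N) :
    Y.dot g (f - f') = Y.dot g f - Y.dot g f' := map_sub (dotBilin Y g) f f'

lemma dot_sub_left (Y : Tw k N) (g g' f : Mat k N) :
    Y.dot (g - g') f = Y.dot g f - Y.dot g' f := LinearMap.map_sub₂ (dotBilin Y) g g' f

lemma entry_apply (b a b' a' : Slot N) (f : k[X]) :
    (entry b a f : Mat k N) b' a' = if b = b' ∧ a = a' then f else 0 := rfl

@[simp] lemma entry_apply_self (b a : Slot N) (f : k[X]) : (entry b a f : Mat k N) b a = f := by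
  simp [entry_apply]

lemma entry_add (b a : Slot N) (f g : k[X]) :
    (entry b a (f + g) : Mat k N) = entry b a f + entry b a g := Matrix.single_add _ _ _ _

lemma entry_smul (b a : Slot N) (c : k) (f : k[X]) :
    (entry b a (c • f) : Mat k N) = c • entry b a f := (Matrix.smul_single c b a f).symm

lemma entry_neg (b a : Slot N) (f : k[X]) : (entry b a (-f) : Mat k N) = -entry b a f :=
  (Matrix.single_neg _ _ _).symm

@[simp] lemma entry_zero (b a : Slot N) : (entry b a 0 : Mat k N) = 0 := Matrix.single_zero _ _

lemma dot_entry_entry (Y : Tw k N) (c b b' a : Slot N) (g f : k[X]) :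
    Y.dot (entry c b g) (entry b' a f) =
      if b = b' ∧ b ∈ Y.supp then entry c a (mul a.vtx b.vtx c.vtx g f) else 0 := by
  funext c' a'
  simp only [Tw.dot, entry_apply]
  split_ifs with h
  · obtain ⟨rfl, hb⟩ := h
    rw [Finset.sum_eq_single_of_mem b hb fun x _ hx => by simp [hx.symm], entry_apply]
    by_cases hc : c = c' <;> by_cases ha : a = a' <;> simp [hc, ha]
  · refine Finset.sum_eq_zero fun x hx => ?_
    by_cases hb : b = x
    · have hb' : b' ≠ x := fun e => h ⟨hb.trans e.symm, hb ▸ hx⟩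
      simp [hb']
    · simp [hb]

@[simp] lemma slot_vtx (p : ℤ) (v : Fin (N + 1)) : (slot p v).vtx = v := rfl

@[simp] lemma slot_deg (p : ℤ) (v : Fin (N + 1)) : (slot p v).deg = p := rfl

@[simp] lemma slot_inj {p q : ℤ} {v w : Fin (N + 1)} : slot p v = slot q w ↔ p = q ∧ v = w := by
  simp [slot, Slot.ext_iff]

@[simp] lemma gen_supp (v : Fin (N + 1)) : (gen v : Tw k N).supp = {slot 0 v} := rfl

@[simp] lemma gen_diff (v : Fin (N + 1)) : (gen v : Tw k N).diff = 0 := rfl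

@[simp] lemma braidObj_diff (i : Inner N) : (braidObj i : Tw k N).diff = braidDelta i := rfl

lemma hom_ext {Y Z : Tw k N} {g : ℤ} {f f' : Mat k N} (hf : f ∈ Y.hom Z g) (hf' : f' ∈ Y.hom Z g)
    (h : ∀ b ∈ Z.supp, ∀ a ∈ Y.supp, b.deg = a.deg + g → f b a = f' b a) : f = f' := by
  funext b a
  by_contra hne
  obtain h0 | h0 : f b a ≠ 0 ∨ f' b a ≠ 0 := by
    by_contra! h0
    exact hne (h0.1.trans h0.2.symm)
  · obtain ⟨hb, ha, hd⟩ := hf b a h0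
    exact hne (h b hb a ha hd)
  · obtain ⟨hb, ha, hd⟩ := hf' b a h0
    exact hne (h b hb a ha hd)

lemma entry_mem {Y Z : Tw k N} {g : ℤ} {b a : Slot N} (hb : b ∈ Z.supp) (ha : a ∈ Y.supp)
    (h : b.deg = a.deg + g) (f : k[X]) : entry b a f ∈ Y.hom Z g := by
  intro b' a' h'
  obtain ⟨rfl, rfl⟩ := (ite_ne_right_iff.1 h').1
  exact ⟨hb, ha, h⟩

lemma dot_mem {W Y Z : Tw k N} {g g' : ℤ} {f₂ f₁ : Mat k N} (h₂ : f₂ ∈ Y.hom Z g')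
    (h₁ : f₁ ∈ W.hom Y g) : Y.dot f₂ f₁ ∈ W.hom Z (g + g') := by
  intro c a h
  obtain ⟨b, -, hb⟩ := Finset.exists_ne_zero_of_sum_ne_zero h
  obtain ⟨hc, -, hcb⟩ := h₂ c b fun e => hb (by rw [e, mul_zero_left])
  obtain ⟨-, ha, hba⟩ := h₁ b a fun e => hb (by rw [e, mul_zero_right])
  exact ⟨hc, ha, by rw [hcb, hba, add_assoc]⟩

lemma diff_mem (Y : Tw k N) : Y.diff ∈ Y.hom Y 1 := fun b a h => Y.diff_deg b a h

end

section
variable {k : Type*} [Field k] {N : ℕ} (i : Inner N)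

/-- The sign `sgn(i - p)`, with the value `1` for `p = i`. -/
def orient (k : Type*) [Field k] (p : Fin (N + 1)) : k := if i.mid < p then -1 else 1

@[simp] lemma orient_mul_self (p : Fin (N + 1)) : orient i k p * orient i k p = 1 := by
  unfold orient
  split_ifs <;> norm_num

lemma intCast_sign_sub_mul {p : Fin (N + 1)} (hp : p ≠ i.mid) (f : k[X]) :
    (((i.val : ℤ) - (p : ℕ)).sign : k[X]) * f = orient i k p • f := by
  unfold orient
  rcases lt_or_gt_of_ne hp with h | h
  · have hs : ((i.val : ℤ) - (p : ℕ)).sign = 1 :=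
      Int.sign_eq_one_of_pos (sub_pos.2 (Int.ofNat_lt.2 h))
    simp [hs, h.not_gt]
  · have hs : ((i.val : ℤ) - (p : ℕ)).sign = -1 :=
      Int.sign_eq_neg_one_of_neg (sub_neg.2 (Int.ofNat_lt.2 h))
    simp [hs, h]

lemma braidObj_supp (p : Fin (N + 1)) : (braidObj i : Tw k N).supp =
    {slot (-1) i.mid, slot 0 (i.toward p), slot 0 (i.away p)} := by
  unfold Inner.toward Inner.away
  split_ifs
  · exact congrArg (insert _) (Finset.pair_comm _ _)
  · rfl

@[simp] lemma slot_mid_mem_braidObj : slot (-1) i.mid ∈ (braidObj i : Tw k N).supp := by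
  simp [braidObj]

@[simp] lemma slot_toward_mem_braidObj (p : Fin (N + 1)) :
    slot 0 (i.toward p) ∈ (braidObj i : Tw k N).supp := by
  simp [braidObj_supp i p]

@[simp] lemma slot_away_mem_braidObj (p : Fin (N + 1)) :
    slot 0 (i.away p) ∈ (braidObj i : Tw k N).supp := by
  simp [braidObj_supp i p]

lemma braidDelta_eq (p : Fin (N + 1)) : (braidDelta i : Mat k N) = orient i k p •
    (entry (slot 0 (i.toward p)) (slot (-1) i.mid) 1
      - entry (slot 0 (i.away p)) (slot (-1) i.mid) 1) := by
  unfold braidDelta orient Inner.toward Inner.away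
  split_ifs
  · rw [neg_one_smul, neg_sub]
  · rw [one_smul]

@[simp] lemma braidF_obj_mid : (braidF (k := k) i).obj i.mid = braidObj i := by
  simp [braidF]

lemma braidF_obj_of_ne {l : Fin (N + 1)} (hl : l ≠ i.mid) :
    (braidF (k := k) i).obj l = gen l := by
  simp [braidF, hl]

/-- The morphism `[a_{i,i-1}, a_{i,i+1}] : β_i⁻ T_i → T_i`, and the identity of `T_l` for `l ≠ i`:
the components of a natural transformation from `β_i⁻` to the identity functor. -/
def augmentation (k : Type*) [Field k] (l : Fin (N + 1)) : Mat k N :=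
  if l = i.mid then entry (slot 0 i.mid) (slot 0 i.left) 1 + entry (slot 0 i.mid) (slot 0 i.right) 1
  else entry (slot 0 l) (slot 0 l) 1

lemma augmentation_mid (p : Fin (N + 1)) : augmentation i k i.mid =
    entry (slot 0 i.mid) (slot 0 (i.toward p)) 1 + entry (slot 0 i.mid) (slot 0 (i.away p)) 1 := by
  unfold augmentation Inner.toward Inner.away
  split_ifs
  · exact add_comm _ _
  · rfl
  all_goals contradiction

lemma augmentation_of_ne {l : Fin (N + 1)} (hl : l ≠ i.mid) :
    augmentation i k l = entry (slot 0 l) (slot 0 l) 1 := by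
  simp [augmentation, hl]

lemma augmentation_mem (l : Fin (N + 1)) :
    augmentation i k l ∈ ((braidF i).obj l).hom (gen l) 0 := by
  by_cases hl : l = i.mid
  · subst hl
    rw [augmentation_mid i i.mid, braidF_obj_mid]
    exact Submodule.add_mem _ (entry_mem (by simp) (by simp) (by simp) _)
      (entry_mem (by simp) (by simp) (by simp) _)
  · rw [augmentation_of_ne i hl, braidF_obj_of_ne i hl]
    exact entry_mem (by simp) (by simp) (by simp) _

lemma augmentation_dot_diff (l : Fin (N + 1)) :
    ((braidF i).obj l).dot (augmentation i k l) ((braidF i).obj l).diff = 0 := by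
  by_cases hl : l = i.mid
  · subst hl
    have ht : turn i.mid (i.toward i.mid) i.mid = 1 := by
      have := i.toward_away_val i.mid
      rw [turn_eq_iff]
      omega
    simp [augmentation_mid i i.mid, braidDelta_eq i i.mid, dot_entry_entry, dot_add_left,
      dot_sub_right, dot_smul_right, mul, ht, Inner.turn_away_mid]
  · simp [braidF_obj_of_ne i hl]

lemma braid1_from_mid {l : Fin (N + 1)} (hl : l ≠ i.mid) (f : k[X]) : braid1 i i.mid l f =
    entry (slot 0 l) (slot 0 (i.toward l)) (X * f) + entry (slot 0 l) (slot 0 (i.away l)) f := by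
  rcases lt_or_gt_of_ne hl with h | h
  · simp [braid1, Inner.toward, Inner.away, h, h.not_gt]
  · simp [braid1, Inner.toward, Inner.away, h, add_comm]

lemma braid1_to_mid {j : Fin (N + 1)} (hj : j ≠ i.mid) (f : k[X]) :
    braid1 i j i.mid f = entry (slot 0 (i.toward j)) (slot 0 j) f := by
  simp [braid1, hj]

lemma braid1_mid (p : Fin (N + 1)) (f : k[X]) :
    braid1 i i.mid i.mid f = entry (slot (-1) i.mid) (slot (-1) i.mid) f
      + entry (slot 0 (i.toward p)) (slot 0 (i.toward p)) f
      + entry (slot 0 (i.away p)) (slot 0 (i.away p)) f := by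
  unfold Inner.toward Inner.away
  split_ifs
  · simp [braid1, add_right_comm]
  · simp [braid1]

/-- Away from `T_i` the functor `β_i⁻` is composition with the augmentation, so that all its
equations with values in `T_l`, `l ≠ i`, are formal. -/
lemma braid1_of_ne (j : Fin (N + 1)) {l : Fin (N + 1)} (hl : l ≠ i.mid) (f : k[X]) :
    braid1 i j l f = (gen j).dot (entry (slot 0 l) (slot 0 j) f) (augmentation i k j) := by
  by_cases hj : j = i.mid
  · subst hj
    have h₁ : turn (i.toward l) i.mid l = 1 := by rw [turn_comm, Inner.turn_mid_toward hl]
    have h₀ : turn (i.away l) i.mid l = 0 := by rw [turn_comm, Inner.turn_mid_away]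
    simp [braid1_from_mid i hl, augmentation_mid i l, dot_add_right, dot_entry_entry, mul, h₁, h₀]
  · simp [braid1, hj, hl, augmentation_of_ne i hj, dot_entry_entry]

lemma augmentation_dot_braid1 (m l : Fin (N + 1)) (g : k[X]) :
    ((braidF i).obj l).dot (augmentation i k l) (braid1 i m l g) =
      (gen m).dot (entry (slot 0 l) (slot 0 m) g) (augmentation i k m) := by
  by_cases hl : l = i.mid
  · subst hl
    by_cases hm : m = i.mid
    · subst hm
      simp [braid1_mid i i.mid, augmentation_mid i i.mid, dot_entry_entry, dot_add_left,
        dot_add_right, mul]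
    · simp [braid1_to_mid i hm, augmentation_mid i m, augmentation_of_ne i hm, dot_entry_entry,
        dot_add_left, mul, Inner.turn_toward_mid hm]
  · rw [braid1_of_ne i m hl, ← dot_assoc, braidF_obj_of_ne i hl, augmentation_of_ne i hl,
      dot_entry_entry]
    simp

lemma braid1_mem (p q : Fin (N + 1)) (f : k[X]) :
    braid1 i p q f ∈ ((braidF i).obj p).hom ((braidF i).obj q) 0 := by
  by_cases hq : q = i.mid
  · subst hq
    rw [braidF_obj_mid]
    by_cases hp : p = i.mid
    · subst hp
      rw [braid1_mid i i.mid, braidF_obj_mid]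
      exact Submodule.add_mem _ (Submodule.add_mem _ (entry_mem (by simp) (by simp) (by simp) _)
        (entry_mem (by simp) (by simp) (by simp) _)) (entry_mem (by simp) (by simp) (by simp) _)
    · rw [braid1_to_mid i hp, braidF_obj_of_ne i hp]
      exact entry_mem (by simp) (by simp) (by simp) _
  · rw [braid1_of_ne i p hq, braidF_obj_of_ne i hq]
    exact dot_mem (g' := 0) (entry_mem (by simp) (by simp) (by simp) _) (augmentation_mem i p)

lemma diff_dot_braid1 (m l : Fin (N + 1)) (g : k[X]) :
    ((braidF i).obj l).dot ((braidF i).obj l).diff (braid1 i m l g) =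
      ((braidF i).obj m).dot (braid1 i m l g) ((braidF i).obj m).diff := by
  by_cases hl : l = i.mid
  · subst hl
    by_cases hm : m = i.mid
    · subst hm
      simp [braid1_mid i i.mid, braidDelta_eq i i.mid, dot_entry_entry, dot_add_left,
        dot_sub_right, dot_sub_left, dot_add_right, dot_smul_left, dot_smul_right, mul]
    · simp [braid1_to_mid i hm, braidDelta_eq i m, dot_entry_entry, dot_sub_left, dot_smul_left,
        braidF_obj_of_ne i hm]
  · rw [braid1_of_ne i m hl, dot_assoc, augmentation_dot_diff, braidF_obj_of_ne i hl]
    simp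

lemma braid1_add (j l : Fin (N + 1)) (f g : k[X]) :
    braid1 i j l (f + g) = braid1 i j l f + braid1 i j l g := by
  unfold braid1
  split_ifs <;> simp only [entry_add, mul_add] <;> abel

lemma braid1_smul (j l : Fin (N + 1)) (c : k) (f : k[X]) :
    braid1 i j l (c • f) = c • braid1 i j l f := by
  unfold braid1
  split_ifs <;> simp only [entry_smul, mul_smul_comm, smul_add]

lemma braid1_dot_of_ne (p q : Fin (N + 1)) {r : Fin (N + 1)} (hr : r ≠ i.mid) (g f : k[X]) :
    ((braidF i).obj q).dot (braid1 i q r g) (braid1 i p q f) = braid1 i p r (mul p q r g f) := by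
  rw [braid1_of_ne i q hr, braid1_of_ne i p hr, dot_assoc, augmentation_dot_braid1, ← dot_assoc,
    dot_entry_entry]
  simp

lemma braid1_mid_dot (p : Fin (N + 1)) (g f : k[X]) :
    (braidObj i).dot (braid1 i i.mid i.mid g) (braid1 i p i.mid f) =
      braid1 i p i.mid (mul p i.mid i.mid g f) := by
  by_cases hp : p = i.mid
  · subst hp
    simp [braid1_mid i i.mid, dot_entry_entry, dot_add_left, dot_add_right, mul]
  · simp [braid1_mid i p, braid1_to_mid i hp, dot_entry_entry, dot_add_left, mul]

lemma braid2_of_ne {j m l : Fin (N + 1)} (h : l ≠ i.mid ∨ m = i.mid) (g f : k[X]) :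
    braid2 i j m l g f = 0 := by
  simp only [braid2]
  rw [if_pos h]

lemma natAbs_val_sub (q : Fin (N + 1)) :
    ((i.val : ℤ) - (q : ℕ)).natAbs = Nat.dist i.mid q := by
  rw [i.mid_val, Nat.dist]
  omega

lemma braid2_from_mid {q : Fin (N + 1)} (hq : q ≠ i.mid) (g f : k[X]) :
    braid2 i i.mid q i.mid g f = orient i k q • entry (slot (-1) i.mid) (slot 0 (i.away q))
      (X ^ (Nat.dist i.mid q - 1) * g * f) := by
  simp only [braid2, intCast_sign_sub_mul i hq, natAbs_val_sub, ← entry_smul, Inner.away]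
  rcases lt_or_gt_of_ne hq with h | h
  · simp [hq, h, h.not_gt]
  · simp [hq, h, h.not_gt]

lemma braid2_of_opposite {p q : Fin (N + 1)} (hp : p ≠ i.mid) (hq : q ≠ i.mid)
    (h : i.toward p = i.away q) (g f : k[X]) :
    braid2 i p q i.mid g f = orient i k q • entry (slot (-1) i.mid) (slot 0 p)
      (X ^ (Nat.dist i.mid q - 1) * g * f) := by
  have hneg : ((i.val : ℤ) - (p : ℕ)) * ((i.val : ℤ) - (q : ℕ)) < 0 := by
    have := i.toward_away_val p
    have := i.toward_away_val q
    have := i.mid_val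
    rw [Ne, Fin.ext_iff] at hp hq
    rw [Fin.ext_iff] at h
    rw [mul_neg_iff]
    omega
  simp only [braid2, intCast_sign_sub_mul i hq, natAbs_val_sub, ← entry_smul]
  simp [hp, hq, hneg]

lemma braid2_of_same_side {p q : Fin (N + 1)} (hp : p ≠ i.mid) (h : i.toward p = i.toward q)
    (g f : k[X]) : braid2 i p q i.mid g f = 0 := by
  have hpos : 0 ≤ ((i.val : ℤ) - (p : ℕ)) * ((i.val : ℤ) - (q : ℕ)) := by
    have := i.toward_away_val p
    have := i.toward_away_val q
    have := i.mid_val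
    rw [Ne, Fin.ext_iff] at hp
    rw [Fin.ext_iff] at h
    rw [mul_nonneg_iff]
    omega
  simp [braid2, hp, hpos.not_gt]

lemma braid2_mem (p q r : Fin (N + 1)) (g f : k[X]) :
    braid2 i p q r g f ∈ ((braidF i).obj p).hom ((braidF i).obj r) (-1) := by
  by_cases h : r ≠ i.mid ∨ q = i.mid
  · rw [braid2_of_ne i h]
    exact Submodule.zero_mem _
  obtain ⟨rfl, hq⟩ : r = i.mid ∧ q ≠ i.mid := by simpa using h
  by_cases hp : p = i.mid
  · subst hp
    rw [braid2_from_mid i hq, braidF_obj_mid]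
    exact Submodule.smul_mem _ _ (entry_mem (by simp) (by simp) (by simp) _)
  rw [braidF_obj_mid, braidF_obj_of_ne i hp]
  rcases i.toward_eq_or p q with hpq | hpq
  · rw [braid2_of_same_side i hp hpq]
    exact Submodule.zero_mem _
  · rw [braid2_of_opposite i hp hq hpq]
    exact Submodule.smul_mem _ _ (entry_mem (by simp) (by simp) (by simp) _)

lemma braid2_coherence_from_mid {q : Fin (N + 1)} (hq : q ≠ i.mid) (g f : k[X]) :
    (braidObj i).dot (braidDelta i) (braid2 i i.mid q i.mid g f)
      + (braidObj i).dot (braid2 i i.mid q i.mid g f) (braidDelta i) =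
    (gen q).dot (braid1 i q i.mid g) (braid1 i i.mid q f)
      - braid1 i i.mid i.mid (mul i.mid q i.mid g f) := by
  obtain ⟨d, hd, htt, hat, hmm⟩ : ∃ d, Nat.dist i.mid q - 1 = d ∧
      turn (i.toward q) q (i.toward q) = d ∧ turn (i.away q) q (i.toward q) = d ∧
      turn i.mid q i.mid = d + 1 := by
    have := i.toward_away_val q
    rw [Ne, Fin.ext_iff] at hq
    refine ⟨_, rfl, ?_⟩
    simp only [turn_eq_iff, Nat.dist]
    omega
  obtain ⟨ham, hma, hama⟩ : turn (i.away q) i.mid (i.toward q) = 0 ∧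
      turn i.mid (i.away q) i.mid = 1 ∧ turn (i.away q) i.mid (i.away q) = 1 := by
    have := i.toward_away_val q
    simp only [turn_eq_iff]
    omega
  rw [braid2_from_mid i hq, braidDelta_eq i q, braid1_to_mid i hq, braid1_from_mid i hq,
    braid1_mid i q, hd]
  simp [dot_entry_entry, dot_sub_left, dot_sub_right, dot_add_right, dot_smul_left,
    dot_smul_right, mul, htt, hat, hmm, ham, hma, hama, smul_smul, pow_succ]
  ring_nf
  abel

lemma braid2_coherence_to_mid {p q : Fin (N + 1)} (hp : p ≠ i.mid) (hq : q ≠ i.mid)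
    (g f : k[X]) :
    (braidObj i).dot (braidDelta i) (braid2 i p q i.mid g f) =
      (gen q).dot (braid1 i q i.mid g) (braid1 i p q f) - braid1 i p i.mid (mul p q i.mid g f) := by
  have hpq : braid1 i p q f = entry (slot 0 q) (slot 0 p) f := by simp [braid1, hp, hq]
  rw [braid1_to_mid i hq, braid1_to_mid i hp, hpq]
  rcases i.toward_eq_or p q with h | h
  · have ht : turn p q (i.toward p) = turn p q i.mid := by
      have := i.toward_away_val p
      have := i.toward_away_val q
      have := (turn_eq_iff p q i.mid _).1 rfl
      rw [Ne, Fin.ext_iff] at hp hq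
      rw [Fin.ext_iff] at h
      rw [turn_eq_iff]
      omega
    simp [braid2_of_same_side i hp h, dot_entry_entry, mul, ← h, ht]
  · obtain ⟨d, hd, hqt, hqm⟩ : ∃ d, Nat.dist i.mid q - 1 = d ∧
        turn p q (i.toward q) = d ∧ turn p q i.mid = d + 1 := by
      have := i.toward_away_val p
      have := i.toward_away_val q
      rw [Ne, Fin.ext_iff] at hp hq
      rw [Fin.ext_iff] at h
      refine ⟨_, rfl, ?_⟩
      simp only [turn_eq_iff, Nat.dist]
      omega
    have hmt : turn p i.mid (i.toward q) = 0 := by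
      rw [← Inner.away_eq_toward_of_eq h, Inner.turn_mid_away]
    have hma : turn p i.mid (i.away q) = 1 := by rw [← h, Inner.turn_mid_toward hp]
    rw [braid2_of_opposite i hp hq h, braidDelta_eq i q, hd, h]
    simp [dot_entry_entry, dot_sub_left, dot_smul_left, dot_smul_right, mul, hqt, hqm, hmt, hma,
      smul_smul, pow_succ]
    ring_nf

/-- The `A_∞`-functor equation of `β_i⁻` on two morphisms. -/
lemma braid2_coherence (p q r : Fin (N + 1)) (g f : k[X]) :
    ((braidF i).obj r).dot ((braidF i).obj r).diff (braid2 i p q r g f)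
      + ((braidF i).obj p).dot (braid2 i p q r g f) ((braidF i).obj p).diff =
    ((braidF i).obj q).dot (braid1 i q r g) (braid1 i p q f) - braid1 i p r (mul p q r g f) := by
  by_cases hr : r = i.mid
  swap
  · simp [braid1_dot_of_ne i p q hr, braid2_of_ne i (Or.inl hr)]
  subst hr
  by_cases hq : q = i.mid
  · subst hq
    simp [braid2_of_ne, braid1_mid_dot]
  rw [braidF_obj_mid, braidF_obj_of_ne i hq]
  by_cases hp : p = i.mid
  · subst hp
    simpa using braid2_coherence_from_mid i hq g f
  · simpa [braidF_obj_of_ne i hp] using braid2_coherence_to_mid i hp hq g f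

end

/-! ### Morphisms into the braided objects -/

namespace Inner
variable {N : ℕ} (i : Inner N)

lemma turn_toward_mid_add_turn_mid_toward (p : Fin (N + 1)) :
    turn p (i.toward p) i.mid + turn p i.mid (i.toward p) = 1 := by
  have h₁ := (turn_eq_iff p (i.toward p) i.mid _).1 rfl
  have h₂ := (turn_eq_iff p i.mid (i.toward p) _).1 rfl
  have := i.toward_away_val p
  omega

end Inner

section
variable {k : Type*} [Field k] {N : ℕ} {i : Inner N} {p l : Fin (N + 1)} {M : Mat k N}

/-- The morphisms `T_p → β_i⁻ T_l` of degree `g`. -/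
abbrev BraidHom (k : Type*) [Field k] (i : Inner N) (p l : Fin (N + 1)) (g : ℤ) :
    Submodule k (Mat k N) := (gen p).hom ((braidF i).obj l) g

lemma eq_zero_of_degree {g : ℤ} (hM : M ∈ BraidHom k i p l g) (h0 : g ≠ 0)
    (h1 : l = i.mid → g ≠ -1) : M = 0 := by
  refine hom_ext hM (Submodule.zero_mem _) fun b hb a ha hd => ?_
  obtain rfl : a = slot 0 p := by simpa using ha
  exfalso
  by_cases hl : l = i.mid
  · subst hl
    simp only [braidF_obj_mid, braidObj_supp i p, Finset.mem_insert, Finset.mem_singleton] at hb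
    rcases hb with rfl | rfl | rfl
    · exact h1 rfl (by simpa using hd.symm)
    · exact h0 (by simpa using hd.symm)
    · exact h0 (by simpa using hd.symm)
  · simp only [braidF_obj_of_ne i hl, gen_supp, Finset.mem_singleton] at hb
    subst hb
    exact h0 (by simpa using hd.symm)

lemma eq_entry_of_mem_hom_gen {v : Fin (N + 1)} (hM : M ∈ (gen p).hom (gen v) 0) :
    M = entry (slot 0 v) (slot 0 p) (M (slot 0 v) (slot 0 p)) := by
  refine hom_ext hM (entry_mem (by simp) (by simp) (by simp) _) fun b hb a ha _ => ?_
  obtain rfl : a = slot 0 p := by simpa using ha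
  obtain rfl : b = slot 0 v := by simpa using hb
  simp

lemma eq_add_entry_of_mem (hM : M ∈ BraidHom k i p i.mid 0) :
    M = entry (slot 0 (i.toward p)) (slot 0 p) (M (slot 0 (i.toward p)) (slot 0 p))
      + entry (slot 0 (i.away p)) (slot 0 p) (M (slot 0 (i.away p)) (slot 0 p)) := by
  refine hom_ext hM (Submodule.add_mem _ (entry_mem (by simp) (by simp) (by simp) _)
    (entry_mem (by simp) (by simp) (by simp) _)) fun b hb a ha hd => ?_
  obtain rfl : a = slot 0 p := by simpa using ha
  simp only [braidF_obj_mid, braidObj_supp i p, Finset.mem_insert, Finset.mem_singleton] at hb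
  rcases hb with rfl | rfl | rfl
  · simp at hd
  · simp [entry_apply]
  · simp [entry_apply]

lemma eq_entry_of_mem_neg_one (hM : M ∈ BraidHom k i p i.mid (-1)) :
    M = entry (slot (-1) i.mid) (slot 0 p) (M (slot (-1) i.mid) (slot 0 p)) := by
  refine hom_ext hM (entry_mem (by simp) (by simp) (by simp) _) fun b hb a ha hd => ?_
  obtain rfl : a = slot 0 p := by simpa using ha
  simp only [braidF_obj_mid, braidObj_supp i p, Finset.mem_insert, Finset.mem_singleton] at hb
  rcases hb with rfl | rfl | rfl
  · simp
  · simp at hd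
  · simp at hd

/-- Composition with the augmentation, as a map from the morphisms `T_p → β_i⁻ T_l` of degree `0`
to the diagonal bimodule; its image is `𝔅_i⁻(p, l)` and its kernel is the image of `δ`. -/
def proj (i : Inner N) (p l : Fin (N + 1)) : Mat k N →ₗ[k] k[X] where
  toFun M := ((braidF i).obj l).dot (augmentation i k l) M (slot 0 l) (slot 0 p)
  map_add' M M' := by rw [dot_add_right, Matrix.add_apply]
  map_smul' c M := by rw [dot_smul_right, Matrix.smul_apply, RingHom.id_apply]

lemma proj_apply (i : Inner N) (p l : Fin (N + 1)) (M : Mat k N) :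
    proj i p l M = ((braidF i).obj l).dot (augmentation i k l) M (slot 0 l) (slot 0 p) := rfl

lemma augmentation_dot_eq (hM : M ∈ BraidHom k i p l 0) :
    ((braidF i).obj l).dot (augmentation i k l) M = entry (slot 0 l) (slot 0 p) (proj i p l M) :=
  eq_entry_of_mem_hom_gen (dot_mem (g' := 0) (augmentation_mem i l) hM)

lemma proj_braid1 {q : Fin (N + 1)} (r : Fin (N + 1)) (g : k[X]) (hM : M ∈ BraidHom k i p q 0) :
    proj i p r (((braidF i).obj q).dot (braid1 i q r g) M) = mul p q r g (proj i p q M) := by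
  rw [proj_apply, ← dot_assoc, augmentation_dot_braid1, dot_assoc, augmentation_dot_eq hM,
    dot_entry_entry]
  simp

lemma proj_dot_entry (p : Fin (N + 1)) {q r : Fin (N + 1)} (f : k[X])
    (hM : M ∈ BraidHom k i q r 0) :
    proj i p r ((gen q).dot M (entry (slot 0 q) (slot 0 p) f)) = mul p q r (proj i q r M) f := by
  rw [proj_apply, ← dot_assoc, augmentation_dot_eq hM, dot_entry_entry]
  simp

lemma proj_diff_dot (i : Inner N) (p l : Fin (N + 1)) (M : Mat k N) :
    proj i p l (((braidF i).obj l).dot ((braidF i).obj l).diff M) = 0 := by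
  rw [proj_apply, ← dot_assoc, augmentation_dot_diff, dot_zero_left, Matrix.zero_apply]

lemma proj_entry_of_ne (p : Fin (N + 1)) (hl : l ≠ i.mid) (f : k[X]) :
    proj i p l (entry (slot 0 l) (slot 0 p) f) = f := by
  simp [proj_apply, augmentation_of_ne i hl, braidF_obj_of_ne i hl, dot_entry_entry]

lemma proj_entry_toward (i : Inner N) (p q : Fin (N + 1)) (f : k[X]) :
    proj i p i.mid (entry (slot 0 (i.toward q)) (slot 0 p) f) =
      X ^ turn p (i.toward q) i.mid * f := by
  simp [proj_apply, augmentation_mid i q, dot_add_left, dot_entry_entry, mul]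

lemma proj_entry_away (i : Inner N) (p q : Fin (N + 1)) (f : k[X]) :
    proj i p i.mid (entry (slot 0 (i.away q)) (slot 0 p) f) =
      X ^ turn p (i.away q) i.mid * f := by
  simp [proj_apply, augmentation_mid i q, dot_add_left, dot_entry_entry, mul]

lemma proj_mid_eq (hM : M ∈ BraidHom k i p i.mid 0) : proj i p i.mid M =
    X ^ turn p (i.toward p) i.mid *
      (M (slot 0 (i.toward p)) (slot 0 p)
        + X ^ turn p i.mid (i.toward p) * M (slot 0 (i.away p)) (slot 0 p)) := by
  conv_lhs => rw [eq_add_entry_of_mem hM]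
  rw [map_add, proj_entry_toward, proj_entry_away, Inner.turn_away_mid, mul_add, ← mul_assoc,
    ← pow_add, Inner.turn_toward_mid_add_turn_mid_toward]

lemma proj_mem_bimod (hM : M ∈ BraidHom k i p l 0) : proj i p l M ∈ bimod (k := k) i p l := by
  rintro rfl rfl
  have h := i.turn_toward_mid_add_turn_mid_toward i.mid
  rw [turn_self_left, add_zero] at h
  rw [proj_mid_eq hM, h, pow_one, coeff_X_mul_zero]

/-- A linear right inverse of `proj` on `𝔅_i⁻`. -/
def projSection (k : Type*) [Field k] (i : Inner N) (p l : Fin (N + 1)) : k[X] →ₗ[k] Mat k N where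
  toFun f :=
    if l ≠ i.mid then entry (slot 0 l) (slot 0 p) f
    else entry (slot 0 (i.toward p)) (slot 0 p) (if p = i.mid then divX f else f)
  map_add' f g := by
    split_ifs <;> simp only [entry_add, divX_add]
  map_smul' c f := by
    split_ifs <;>
      simp only [smul_eq_C_mul, divX_C_mul, RingHom.id_apply] <;>
      simp only [← smul_eq_C_mul, entry_smul]

lemma projSection_mem (i : Inner N) (p l : Fin (N + 1)) (f : k[X]) :
    projSection k i p l f ∈ BraidHom k i p l 0 := by
  unfold projSection BraidHom
  by_cases hl : l = i.mid
  · subst hl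
    simp only [LinearMap.coe_mk, AddHom.coe_mk, ne_eq, not_true_eq_false, if_false, braidF_obj_mid]
    exact entry_mem (by simp) (by simp) (by simp) _
  · simp only [LinearMap.coe_mk, AddHom.coe_mk, ne_eq, hl, not_false_eq_true, if_true,
      braidF_obj_of_ne i hl]
    exact entry_mem (by simp) (by simp) (by simp) _

lemma proj_projSection (i : Inner N) (p l : Fin (N + 1)) {f : k[X]}
    (hf : f ∈ bimod (k := k) i p l) : proj i p l (projSection k i p l f) = f := by
  by_cases hl : l = i.mid
  · subst hl
    by_cases hp : p = i.mid
    · subst hp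
      have h := i.turn_toward_mid_add_turn_mid_toward i.mid
      rw [turn_self_left, add_zero] at h
      have hf0 : C (f.coeff 0) = 0 := by rw [hf rfl rfl, C_0]
      simpa [projSection, proj_entry_toward, h, hf0] using X_mul_divX_add f
    · simp [projSection, hp, proj_entry_toward, Inner.turn_toward_mid hp]
  · simp [projSection, hl, proj_entry_of_ne]

lemma delta_dot_entry (i : Inner N) (p : Fin (N + 1)) (f : k[X]) :
    (braidObj i).dot (braidDelta i) (entry (slot (-1) i.mid) (slot 0 p) f) = orient i k p •
      (entry (slot 0 (i.toward p)) (slot 0 p) (X ^ turn p i.mid (i.toward p) * f)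
        - entry (slot 0 (i.away p)) (slot 0 p) f) := by
  simp [braidDelta_eq i p, dot_smul_left, dot_sub_left, dot_entry_entry, mul, Inner.turn_mid_away]

/-- A linear inverse of `δ` on the kernel of `proj`. -/
def deltaInv (k : Type*) [Field k] (i : Inner N) (p l : Fin (N + 1)) :
    Mat k N →ₗ[k] Mat k N where
  toFun M := if l ≠ i.mid then 0 else
    -orient i k p • entry (slot (-1) i.mid) (slot 0 p) (M (slot 0 (i.away p)) (slot 0 p))
  map_add' M M' := by
    split_ifs <;> simp only [Matrix.add_apply, entry_add, smul_add, add_zero]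
  map_smul' c M := by
    split_ifs <;>
      simp only [Matrix.smul_apply, entry_smul, RingHom.id_apply, smul_zero, smul_comm c]

lemma deltaInv_of_ne (p : Fin (N + 1)) (hl : l ≠ i.mid) (M : Mat k N) :
    deltaInv k i p l M = 0 := by
  simp [deltaInv, hl]

lemma deltaInv_mid (i : Inner N) (p : Fin (N + 1)) (M : Mat k N) :
    deltaInv k i p i.mid M = -orient i k p •
      entry (slot (-1) i.mid) (slot 0 p) (M (slot 0 (i.away p)) (slot 0 p)) := by
  simp [deltaInv]

lemma deltaInv_mem (i : Inner N) (p l : Fin (N + 1)) (M : Mat k N) :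
    deltaInv k i p l M ∈ BraidHom k i p l (-1) := by
  by_cases hl : l = i.mid
  · subst hl
    rw [deltaInv_mid, BraidHom, braidF_obj_mid]
    exact Submodule.smul_mem _ _ (entry_mem (by simp) (by simp) (by simp) _)
  · rw [deltaInv_of_ne p hl]
    exact Submodule.zero_mem _

lemma diff_dot_deltaInv (hM : M ∈ BraidHom k i p l 0) (h : proj i p l M = 0) :
    ((braidF i).obj l).dot ((braidF i).obj l).diff (deltaInv k i p l M) = M := by
  by_cases hl : l = i.mid
  · subst hl
    rw [proj_mid_eq hM] at h
    have htoward := eq_neg_of_add_eq_zero_left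
      ((mul_eq_zero.1 h).resolve_left (pow_ne_zero _ X_ne_zero))
    conv_rhs => rw [eq_add_entry_of_mem hM, htoward]
    rw [deltaInv_mid, braidF_obj_mid, braidObj_diff, dot_smul_right, delta_dot_entry, smul_smul,
      neg_mul, orient_mul_self, neg_one_smul, neg_sub, sub_eq_neg_add]
    rw [entry_neg, add_comm]
  · have hM' := hM
    rw [BraidHom, braidF_obj_of_ne i hl] at hM'
    have hM₀ := eq_entry_of_mem_hom_gen hM'
    rw [hM₀, proj_entry_of_ne p hl] at h
    rw [h, entry_zero] at hM₀
    rw [hM₀, map_zero, dot_zero_right]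

lemma eq_zero_of_diff_dot_eq_zero (hM : M ∈ BraidHom k i p l (-1))
    (h : ((braidF i).obj l).dot ((braidF i).obj l).diff M = 0) : M = 0 := by
  by_cases hl : l = i.mid
  · subst hl
    rw [eq_entry_of_mem_neg_one hM] at h ⊢
    rw [braidF_obj_mid, braidObj_diff, delta_dot_entry] at h
    have hneg := congrArg (orient i k p • ·) h
    simp only [smul_smul, orient_mul_self, one_smul, smul_zero] at hneg
    have haway := congrFun (congrFun hneg (slot 0 (i.away p))) (slot 0 p)
    have hf : M (slot (-1) i.mid) (slot 0 p) = 0 := by simpa [entry_apply] using haway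
    rw [hf, entry_zero]
  · exact eq_zero_of_degree hM (by decide) fun e => absurd e hl

lemma diff_dot_eq_zero (hM : M ∈ BraidHom k i p l 0) :
    ((braidF i).obj l).dot ((braidF i).obj l).diff M = 0 :=
  eq_zero_of_degree (dot_mem (diff_mem _) hM) (by decide) fun _ => by decide

end

/-! ### The differential of pre-natural transformations -/

section
variable {k : Type*} [Field k] {N : ℕ}

lemma sign_of_even {z : ℤ} (h : Even z) : sign k z = 1 := by simp [sign, Int.negOnePow_even z h]

lemma sign_of_odd {z : ℤ} (h : Odd z) : sign k z = -1 := by simp [sign, Int.negOnePow_odd z h]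

@[simp] lemma sign_neg (z : ℤ) : sign k (-z) = sign k z := by rw [sign, sign, Int.negOnePow_neg]

@[simp] lemma sign_zero : sign k 0 = 1 := sign_of_even (by decide)
@[simp] lemma sign_one : sign k 1 = -1 := sign_of_odd (by decide)
@[simp] lemma sign_two : sign k 2 = 1 := sign_of_even (by decide)

lemma sign_sub_one (z : ℤ) : sign k (z - 1) = -sign k z := by
  rw [sign, sign, Int.negOnePow_sub, Int.negOnePow_one]; simp

lemma sign_neg_nat_add_sub_one (n : ℕ) (z : ℤ) :
    sign k (-n + z - 1) = -sign k z * (-1) ^ n := by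
  rw [sign_sub_one, sign, sign, Int.negOnePow_add, Int.negOnePow_neg, Int.negOnePow_def]
  simp [mul_comm]

lemma mem_hom_of_eq {Y Z : Tw k N} {g g' : ℤ} (h : g = g') {f : Mat k N} (hf : f ∈ Y.hom Z g) :
    f ∈ Y.hom Z g' := h ▸ hf

/-- The degree condition on the components of an `A_∞`-functor: `F^r` lands in degree `1 - r`. -/
def AFunctor.IsGraded (F : AFunctor k N) : Prop :=
  ∀ (r : ℕ) (v : Fin (r + 1) → Fin (N + 1)) (a : Fin r → k[X]), r ≠ 0 →
    F.map r v a ∈ (F.obj (v 0)).hom (F.obj (v (Fin.last r))) (1 - r)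

lemma braidF_isGraded (i : Inner N) : (braidF (k := k) i).IsGraded
  | 0, _, _, h => absurd rfl h
  | 1, _, _, _ => braid1_mem i _ _ _
  | 2, _, _, _ => braid2_mem i _ _ _ _ _
  | _ + 3, _, _, _ => Submodule.zero_mem _

lemma idF_isGraded : (idF (k := k) (N := N)).IsGraded
  | 0, _, _, h => absurd rfl h
  | 1, v, a, _ => entry_mem (b := slot 0 (v 1)) (a := slot 0 (v 0)) (by simp [idF])
      (by simp [idF]) (by simp) (a 0)
  | _ + 2, _, _, _ => Submodule.zero_mem _

lemma upp_last {A : Type*} {d s r : ℕ} (h : s + (r + 1) ≤ d + 1) (hr : s + r = d)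
    (v : Fin (d + 1) → A) : upp s (r + 1) h v (Fin.last r) = v (Fin.last d) :=
  congrArg v (Fin.ext hr)

lemma upp_one {A : Type*} {r : ℕ} (h : 1 + r ≤ r + 1) (v : Fin (r + 1) → A) :
    upp 1 r h v = Fin.tail v :=
  funext fun n => congrArg v (Fin.ext (add_comm 1 (n : ℕ)))

lemma mu1_gen (Z : Tw k N) (v : Fin (N + 1)) (g : ℤ) (f : Mat k N) :
    mu1 (gen v) Z g f = sign k g • Z.dot Z.diff f := by
  rw [mu1, gen_diff, dot_zero_right, sub_zero]

lemma mu1_mem {Y Z : Tw k N} {g : ℤ} {f : Mat k N} (hf : f ∈ Y.hom Z g) :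
    mu1 Y Z g f ∈ Y.hom Z (g + 1) :=
  Submodule.sub_mem _ (Submodule.smul_mem _ _ (dot_mem (diff_mem Z) hf))
    (mem_hom_of_eq (add_comm 1 g) (dot_mem hf (diff_mem Y)))

lemma insertMul_mem {M : Type*} [AddCommGroup M] [Module k M] (c : ℕ → k) {η : Ops k N M}
    {d : ℕ} {S : Fin (N + 1) → Fin (N + 1) → Submodule k M}
    (h : ∀ v a, η d v a ∈ S (v 0) (v (Fin.last d))) (v : Fin (d + 2) → Fin (N + 1))
    (a : Fin (d + 1) → k[X]) : insertMul c η (d + 1) v a ∈ S (v 0) (v (Fin.last (d + 1))) := by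
  refine Submodule.sum_mem _ fun n _ => Submodule.smul_mem _ _ ?_
  have hlast : n.succ.castSucc.succAbove (Fin.last d) = Fin.last (d + 1) :=
    Fin.succAbove_ne_last_last (Fin.castSucc_lt_last _).ne
  simpa only [dropVtx, hlast, Fin.succAbove_ne_zero_zero (Fin.castSucc_ne_zero_iff.2
    (Fin.succ_ne_zero n))] using h (dropVtx n v) (mulAt n v a)

lemma natDiff_mem_hom {F G : AFunctor k N} (hF : F.IsGraded) (hG : G.IsGraded) {g : ℤ}
    {η : Ops k N (Mat k N)}
    (h : ∀ (d : ℕ) v a, η d v a ∈ (F.obj (v 0)).hom (G.obj (v (Fin.last d))) (g - d)) (d : ℕ)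
    (v : Fin (d + 1) → Fin (N + 1)) (a : Fin d → k[X]) :
    natDiff F G g η d v a ∈ (F.obj (v 0)).hom (G.obj (v (Fin.last d))) (g + 1 - d) := by
  refine Submodule.sub_mem _ (Submodule.add_mem _ (Submodule.add_mem _
    (mem_hom_of_eq (by ring) (mu1_mem (h d v a)))
    (Submodule.sum_mem _ fun s _ => Submodule.smul_mem _ _ ?_))
    (Submodule.sum_mem _ fun s _ => Submodule.smul_mem _ _ (Submodule.smul_mem _ _ ?_))) ?_
  · have hmap := hG (d - s) (upp s (d - s + 1) (by omega) v) (upp s (d - s) (by omega) a)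
      (by omega)
    rw [upp_last _ (by omega)] at hmap
    exact mem_hom_of_eq (by omega) (dot_mem hmap (h s (low _ _ v) (low _ _ a)))
  · have hη := h (d - (s + 1)) (upp (s + 1) (d - (s + 1) + 1) (by omega) v)
      (upp (s + 1) (d - (s + 1)) (by omega) a)
    rw [upp_last _ (by omega)] at hη
    exact mem_hom_of_eq (by omega) (dot_mem hη (hF (s + 1) (low _ _ v) (low _ _ a) (by omega)))
  · match d, v, a with
    | 0, _, _ => exact Submodule.zero_mem _
    | d + 1, v, a =>
      exact mem_hom_of_eq (by push_cast; ring) (insertMul_mem _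
        (S := fun p q => (F.obj p).hom (G.obj q) (g - d)) (h d) v a)

lemma braidF_map_one (i : Inner N) {r : ℕ} (hr : r = 1) (v : Fin (r + 1) → Fin (N + 1))
    (a : Fin r → k[X]) : (braidF i).map r v a =
      braid1 i (v 0) (v (Fin.last r)) (a ⟨0, by omega⟩) := by
  subst hr; rfl

lemma braidF_map_two (i : Inner N) {r : ℕ} (hr : r = 2) (v : Fin (r + 1) → Fin (N + 1))
    (a : Fin r → k[X]) : (braidF i).map r v a =
      braid2 i (v 0) (v ⟨1, by omega⟩) (v (Fin.last r)) (a ⟨1, by omega⟩) (a ⟨0, by omega⟩) := by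
  subst hr; rfl

lemma braidF_map_of_two_lt (i : Inner N) {r : ℕ} (hr : 2 < r) : (braidF (k := k) i).map r = 0 := by
  match r, hr with
  | r + 3, _ => rfl

lemma sum_mu2_braidF (i : Inner N) (g : ℤ) (η : Ops k N (Mat k N)) (d : ℕ)
    (v : Fin (d + 3) → Fin (N + 1)) (a : Fin (d + 2) → k[X]) :
    ∑ s : Fin (d + 2), mu2 ((braidF i).obj (v s.castSucc)) (g - s)
        ((braidF i).map (d + 2 - s) (upp s (d + 2 - s + 1) (by omega) v)
          (upp s (d + 2 - s) (by omega) a))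
        (η s (low (s + 1) (by omega) v) (low s (by omega) a)) =
      sign k (g - d) • ((braidF i).obj (v (Fin.last d).castSucc.castSucc)).dot
          (braid2 i (v (Fin.last d).castSucc.castSucc) (v (Fin.last (d + 1)).castSucc)
            (v (Fin.last _)) (a (Fin.last _)) (a (Fin.last d).castSucc))
          (η d (Fin.init (Fin.init v)) (Fin.init (Fin.init a)))
      + sign k (g - (d + 1)) • ((braidF i).obj (v (Fin.last (d + 1)).castSucc)).dot
          (braid1 i (v (Fin.last (d + 1)).castSucc) (v (Fin.last _)) (a (Fin.last _)))
          (η (d + 1) (Fin.init v) (Fin.init a)) := by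
  have hone := braidF_map_one i (r := d + 2 - (d + 1)) (by omega)
    (upp (d + 1) (d + 2 - (d + 1) + 1) (by omega) v) (upp (d + 1) (d + 2 - (d + 1)) (by omega) a)
  have htwo := braidF_map_two i (r := d + 2 - d) (by omega)
    (upp d (d + 2 - d + 1) (by omega) v) (upp d (d + 2 - d) (by omega) a)
  rw [upp_last _ (by omega)] at hone htwo
  have hlow (s : Fin d) : (braidF (k := k) i).map (d + 2 - s) = 0 :=
    braidF_map_of_two_lt i (by omega)
  rw [Fin.sum_univ_castSucc, Fin.sum_univ_castSucc]
  simp only [Fin.val_castSucc, Fin.val_last, hone, htwo, hlow, mu2, Pi.zero_apply, dot_zero_left,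
    smul_zero, Finset.sum_const_zero, zero_add, Nat.cast_add, Nat.cast_one]
  rfl

lemma sum_mu2_idF (g : ℤ) (η : Ops k N (Mat k N)) (d : ℕ)
    (v : Fin (d + 2) → Fin (N + 1)) (a : Fin (d + 1) → k[X]) :
    ∑ s : Fin (d + 1), sign k ((g - 1) * (-(s + 1))) • mu2 (idF.obj (v s.succ)) (1 - (s + 1))
        (η (d + 1 - (s + 1)) (upp (s + 1) (d + 1 - (s + 1) + 1) (by omega) v)
          (upp (s + 1) (d + 1 - (s + 1)) (by omega) a))
        (idF.map (s + 1) (low (s + 1 + 1) (by omega) v) (low (s + 1) (by omega) a)) =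
      sign k (g - 1) • (gen (v 1)).dot (η d (Fin.tail v) (Fin.tail a))
        (entry (slot 0 (v 1)) (slot 0 (v 0)) (a 0)) := by
  have hmap (s : Fin d) : (idF (k := k) (N := N)).map ((s : ℕ) + 1 + 1) = 0 := rfl
  rw [Fin.sum_univ_succ]
  simp only [Fin.val_succ, hmap, mu2, Pi.zero_apply, dot_zero_right, smul_zero,
    Finset.sum_const_zero, add_zero, Fin.val_zero, Nat.cast_zero, zero_add, mul_neg, mul_one,
    sign_neg, sub_self, sign_zero, one_smul]
  change sign k (g - 1) • (gen (v 1)).dot (η d (upp 1 (d + 1) (by omega) v) (upp 1 d (by omega) a))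
    (entry (slot 0 (v 1)) (slot 0 (v 0)) (a 0)) = _
  rw [upp_one, upp_one]

/-- The terms of `μ¹_{Fun}` which survive since `id^d = 0` for `d ≠ 1` and `β_i⁻^d = 0` for
`d ≥ 3`. -/
lemma natDiff_add_two (i : Inner N) (g : ℤ) (η : Ops k N (Mat k N)) (d : ℕ)
    (v : Fin (d + 3) → Fin (N + 1)) (a : Fin (d + 2) → k[X]) :
    natDiff idF (braidF i) g η (d + 2) v a =
      sign k (g - d) • (((braidF i).obj (v (Fin.last _))).dot
          ((braidF i).obj (v (Fin.last _))).diff (η (d + 2) v a)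
        + ((braidF i).obj (v (Fin.last d).castSucc.castSucc)).dot
          (braid2 i (v (Fin.last d).castSucc.castSucc) (v (Fin.last (d + 1)).castSucc)
            (v (Fin.last _)) (a (Fin.last _)) (a (Fin.last d).castSucc))
          (η d (Fin.init (Fin.init v)) (Fin.init (Fin.init a)))
        - ((braidF i).obj (v (Fin.last (d + 1)).castSucc)).dot
          (braid1 i (v (Fin.last (d + 1)).castSucc) (v (Fin.last _)) (a (Fin.last _)))
          (η (d + 1) (Fin.init v) (Fin.init a)))
      - sign k g • ((gen (v 1)).dot (η (d + 1) (Fin.tail v) (Fin.tail a))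
          (entry (slot 0 (v 1)) (slot 0 (v 0)) (a 0))
        - insertMul (fun n => (-1) ^ n) η (d + 2) v a) := by
  have hsign : sign k (g - (d + 1)) = -sign k (g - d) := by rw [← sub_sub, sign_sub_one]
  have hsign' : sign k (g - (d + 2 : ℕ)) = sign k (g - d) := by
    rw [Nat.cast_add, Nat.cast_two, ← one_add_one_eq_two, ← add_assoc, ← sub_sub, sign_sub_one,
      hsign, neg_neg]
  have hinsert : insertMul (fun n => sign k (-n + g - 1)) η (d + 2) v a =
      -sign k g • insertMul (fun n => (-1) ^ n) η (d + 2) v a := by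
    simp only [insertMul, Finset.smul_sum, smul_smul, sign_neg_nat_add_sub_one]
  change natDiffFun _ _ _ _ _ _ _ = _
  rw [natDiffFun, sum_mu2_braidF, sum_mu2_idF (d := d + 1),
    show mu1 (idF.obj (v 0)) _ _ _ = _ from mu1_gen _ _ _ _, hsign, hsign', sign_sub_one, neg_smul,
    neg_smul, hinsert]
  module

lemma insertMul_two {M : Type*} [AddCommGroup M] [Module k M] (c : ℕ → k) (η : Ops k N M)
    (v : Fin 3 → Fin (N + 1)) (a : Fin 2 → k[X]) :
    insertMul c η 2 v a = c 0 • η 1 ![v 0, v 2] ![mul (v 0) (v 1) (v 2) (a 1) (a 0)] := by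
  change ∑ n : Fin 1, _ = _
  rw [Fin.sum_univ_one, ← FinVec.etaExpand_eq (dropVtx _ v), ← FinVec.etaExpand_eq (mulAt _ v a)]
  rfl

lemma insertMul_three {M : Type*} [AddCommGroup M] [Module k M] (c : ℕ → k) (η : Ops k N M)
    (v : Fin 4 → Fin (N + 1)) (a : Fin 3 → k[X]) :
    insertMul c η 3 v a =
      c 0 • η 2 ![v 0, v 2, v 3] ![mul (v 0) (v 1) (v 2) (a 1) (a 0), a 2]
      + c 1 • η 2 ![v 0, v 1, v 3] ![a 0, mul (v 1) (v 2) (v 3) (a 2) (a 1)] := by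
  change ∑ n : Fin 2, _ = _
  rw [Fin.sum_univ_two, ← FinVec.etaExpand_eq (dropVtx 0 v), ← FinVec.etaExpand_eq (mulAt 0 v a),
    ← FinVec.etaExpand_eq (dropVtx 1 v), ← FinVec.etaExpand_eq (mulAt 1 v a)]
  rfl

lemma insertMul_four {M : Type*} [AddCommGroup M] [Module k M] (c : ℕ → k) (η : Ops k N M)
    (v : Fin 5 → Fin (N + 1)) (a : Fin 4 → k[X]) :
    insertMul c η 4 v a =
      c 0 • η 3 ![v 0, v 2, v 3, v 4] ![mul (v 0) (v 1) (v 2) (a 1) (a 0), a 2, a 3]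
      + c 1 • η 3 ![v 0, v 1, v 3, v 4] ![a 0, mul (v 1) (v 2) (v 3) (a 2) (a 1), a 3]
      + c 2 • η 3 ![v 0, v 1, v 2, v 4] ![a 0, a 1, mul (v 2) (v 3) (v 4) (a 3) (a 2)] := by
  change ∑ n : Fin 3, _ = _
  rw [Fin.sum_univ_three, ← FinVec.etaExpand_eq (dropVtx 0 v), ← FinVec.etaExpand_eq (mulAt 0 v a),
    ← FinVec.etaExpand_eq (dropVtx 1 v), ← FinVec.etaExpand_eq (mulAt 1 v a),
    ← FinVec.etaExpand_eq (dropVtx 2 v), ← FinVec.etaExpand_eq (mulAt 2 v a)]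
  rfl

lemma natDiff_one_two (i : Inner N) {ζ : Ops k N (Mat k N)} (h0 : ζ 0 = 0)
    (v : Fin 3 → Fin (N + 1)) (a : Fin 2 → k[X]) :
    natDiff idF (braidF i) 1 ζ 2 v a =
      ((braidF i).obj (v 1)).dot (braid1 i (v 1) (v 2) (a 1)) (ζ 1 ![v 0, v 1] ![a 0])
      - ((braidF i).obj (v 2)).dot ((braidF i).obj (v 2)).diff (ζ 2 v a)
      + (gen (v 1)).dot (ζ 1 ![v 1, v 2] ![a 1]) (entry (slot 0 (v 1)) (slot 0 (v 0)) (a 0))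
      - ζ 1 ![v 0, v 2] ![mul (v 0) (v 1) (v 2) (a 1) (a 0)] := by
  rw [natDiff_add_two, insertMul_two, ← FinVec.etaExpand_eq (Fin.init v),
    ← FinVec.etaExpand_eq (Fin.init a), ← FinVec.etaExpand_eq (Fin.tail v),
    ← FinVec.etaExpand_eq (Fin.tail a), h0]
  simp only [Pi.zero_apply, dot_zero_right, add_zero, Nat.cast_zero, sub_zero, sign_one, neg_smul,
    one_smul, neg_sub, pow_zero]
  rw [sub_sub_eq_add_sub]
  rfl

lemma natDiff_one_three (i : Inner N) {ζ : Ops k N (Mat k N)} (h3 : ζ 3 = 0)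
    (v : Fin 4 → Fin (N + 1)) (a : Fin 3 → k[X]) :
    natDiff idF (braidF i) 1 ζ 3 v a =
      ((braidF i).obj (v 1)).dot (braid2 i (v 1) (v 2) (v 3) (a 2) (a 1)) (ζ 1 ![v 0, v 1] ![a 0])
      - ((braidF i).obj (v 2)).dot (braid1 i (v 2) (v 3) (a 2)) (ζ 2 ![v 0, v 1, v 2] ![a 0, a 1])
      + ((gen (v 1)).dot (ζ 2 ![v 1, v 2, v 3] ![a 1, a 2])
          (entry (slot 0 (v 1)) (slot 0 (v 0)) (a 0))
        - (ζ 2 ![v 0, v 2, v 3] ![mul (v 0) (v 1) (v 2) (a 1) (a 0), a 2]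
          - ζ 2 ![v 0, v 1, v 3] ![a 0, mul (v 1) (v 2) (v 3) (a 2) (a 1)])) := by
  rw [natDiff_add_two, insertMul_three, ← FinVec.etaExpand_eq (Fin.init (Fin.init v)),
    ← FinVec.etaExpand_eq (Fin.init (Fin.init a)), ← FinVec.etaExpand_eq (Fin.init v),
    ← FinVec.etaExpand_eq (Fin.init a), ← FinVec.etaExpand_eq (Fin.tail v),
    ← FinVec.etaExpand_eq (Fin.tail a), h3]
  simp only [Pi.zero_apply, dot_zero_right, Nat.cast_one, sign_one, pow_zero, pow_one,
    neg_smul, one_smul, sub_neg_eq_add, zero_add, sub_self, sign_zero, ← sub_eq_add_neg]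
  rfl

lemma natDiff_two_three (i : Inner N) {η : Ops k N (Mat k N)} (h1 : η 1 = 0)
    (v : Fin 4 → Fin (N + 1)) (a : Fin 3 → k[X]) :
    natDiff idF (braidF i) 2 η 3 v a = homotopyRHS i η v a
      - ((braidF i).obj (v 3)).dot ((braidF i).obj (v 3)).diff (η 3 v a) := by
  have hsign : sign k (2 - (1 : ℕ)) = -1 := sign_of_odd (by decide)
  rw [natDiff_add_two, insertMul_three, ← FinVec.etaExpand_eq (Fin.init v),
    ← FinVec.etaExpand_eq (Fin.init a), ← FinVec.etaExpand_eq (Fin.tail v),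
    ← FinVec.etaExpand_eq (Fin.tail a), h1]
  simp only [Pi.zero_apply, dot_zero_right, add_zero, hsign, neg_smul, one_smul, neg_sub, sign_two,
    pow_zero, pow_one, ← sub_eq_add_neg]
  rw [sub_right_comm, ← sub_add, ← add_sub_assoc]
  rfl

lemma natDiff_two_four (i : Inner N) {η : Ops k N (Mat k N)} (h4 : η 4 = 0)
    (v : Fin 5 → Fin (N + 1)) (a : Fin 4 → k[X]) :
    natDiff idF (braidF i) 2 η 4 v a =
      ((braidF i).obj (v 2)).dot (braid2 i (v 2) (v 3) (v 4) (a 3) (a 2))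
          (η 2 ![v 0, v 1, v 2] ![a 0, a 1])
      - ((braidF i).obj (v 3)).dot (braid1 i (v 3) (v 4) (a 3))
          (η 3 ![v 0, v 1, v 2, v 3] ![a 0, a 1, a 2])
      - ((gen (v 1)).dot (η 3 ![v 1, v 2, v 3, v 4] ![a 1, a 2, a 3])
          (entry (slot 0 (v 1)) (slot 0 (v 0)) (a 0))
        - (η 3 ![v 0, v 2, v 3, v 4] ![mul (v 0) (v 1) (v 2) (a 1) (a 0), a 2, a 3]
          - η 3 ![v 0, v 1, v 3, v 4] ![a 0, mul (v 1) (v 2) (v 3) (a 2) (a 1), a 3]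
          + η 3 ![v 0, v 1, v 2, v 4] ![a 0, a 1, mul (v 2) (v 3) (v 4) (a 3) (a 2)])) := by
  rw [natDiff_add_two, insertMul_four, ← FinVec.etaExpand_eq (Fin.init v),
    ← FinVec.etaExpand_eq (Fin.init a), ← FinVec.etaExpand_eq (Fin.init (FinVec.etaExpand _)),
    ← FinVec.etaExpand_eq (Fin.init (FinVec.etaExpand (Fin.init a))),
    ← FinVec.etaExpand_eq (Fin.tail v), ← FinVec.etaExpand_eq (Fin.tail a), h4]
  simp only [Pi.zero_apply, dot_zero_right, one_smul, sign_two, zero_add, sub_self, sign_zero,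
    Nat.cast_ofNat, pow_zero, pow_one, neg_one_sq, neg_smul, ← sub_eq_add_neg]
  rfl

lemma preNat_mem_hom {i : Inner N} {g g' : ℤ} {η : Ops k N (Mat k N)}
    (h : η ∈ PreNat idF (braidF i) g) (d : ℕ) (v : Fin (d + 1) → Fin (N + 1)) (a : Fin d → k[X])
    (hg : g - d = g' := by norm_num) : η d v a ∈ BraidHom k i (v 0) (v (Fin.last d)) g' :=
  mem_hom_of_eq hg ((h d v).2 a)

lemma preNat_eq_zero {i : Inner N} {g : ℤ} {η : Ops k N (Mat k N)}
    (h : η ∈ PreNat idF (braidF i) g) (d : ℕ) (h0 : (d : ℤ) ≠ g) (h1 : (d : ℤ) ≠ g + 1) :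
    η d = 0 := by
  funext v a
  exact eq_zero_of_degree (preNat_mem_hom h d v a rfl) (by omega) fun _ => by omega

lemma natDiff_mem_braidHom {i : Inner N} {g g' : ℤ} {η : Ops k N (Mat k N)}
    (h : η ∈ PreNat idF (braidF i) g) (d : ℕ) (v : Fin (d + 1) → Fin (N + 1)) (a : Fin d → k[X])
    (hg : g + 1 - d = g' := by norm_num) :
    natDiff idF (braidF i) g η d v a ∈ BraidHom k i (v 0) (v (Fin.last d)) g' :=
  mem_hom_of_eq hg (natDiff_mem_hom idF_isGraded (braidF_isGraded i) (fun d v => (h d v).2) d v a)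

lemma natDiff_eq_zero {i : Inner N} {g : ℤ} {η : Ops k N (Mat k N)}
    (h : η ∈ PreNat idF (braidF i) g) (d : ℕ) (h0 : (d : ℤ) ≠ g + 1) (h1 : (d : ℤ) ≠ g + 2) :
    natDiff idF (braidF i) g η d = 0 := by
  funext v a
  exact eq_zero_of_degree (natDiff_mem_braidHom h d v a rfl) (by omega) fun _ => by omega

lemma natDiff_two_four_eq_zero {i : Inner N} {η : Ops k N (Mat k N)}
    (h : η ∈ PreNat idF (braidF i) 2)
    (hδ : ∀ v a, ((braidF i).obj (v 3)).dot ((braidF i).obj (v 3)).diff (η 3 v a) =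
      homotopyRHS i η v a) : natDiff idF (braidF i) 2 η 4 = 0 := by
  funext v a
  refine eq_zero_of_diff_dot_eq_zero (natDiff_mem_braidHom h 4 v a) ?_
  have hcons := fun p q r s f₀ f₁ f₂ => hδ ![p, q, r, s] ![f₀, f₁, f₂]
  have hclosed : ((braidF i).obj (v 2)).dot ((braidF i).obj (v 2)).diff
      (η 2 ![v 0, v 1, v 2] ![a 0, a 1]) = 0 := diff_dot_eq_zero (preNat_mem_hom h 2 _ _)
  have hbraid2 := eq_sub_of_add_eq (braid2_coherence i (v 2) (v 3) (v 4) (a 3) (a 2))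
  simp only [homotopyRHS, Matrix.cons_val] at hcons
  change ((braidF i).obj (v 4)).dot ((braidF i).obj (v 4)).diff _ = 0
  rw [natDiff_two_four i (preNat_eq_zero h 4 (by decide) (by decide))]
  simp only [dot_sub_right, dot_add_right]
  rw [← dot_assoc _ _ _ (braid2 i _ _ _ _ _), hbraid2, ← dot_assoc _ _ _ (braid1 i _ _ _),
    diff_dot_braid1, dot_assoc _ _ _ _ (η 3 _ _), hcons, ← dot_assoc _ _ _ (η 3 _ _), hcons, hcons,
    hcons, hcons]
  simp only [dot_sub_left, dot_add_left, dot_sub_right, dot_add_right, dot_assoc, hclosed,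
    dot_zero_right, dot_entry_entry, gen_supp, Finset.mem_singleton, and_self, if_true,
    slot_vtx, mul_mul_assoc]
  abel

lemma homotopyRHS_natDiff {i : Inner N} {ζ : Ops k N (Mat k N)}
    (h : ζ ∈ PreNat idF (braidF i) 1) (v : Fin 4 → Fin (N + 1)) (a : Fin 3 → k[X]) :
    homotopyRHS i (natDiff idF (braidF i) 1 ζ) v a =
      ((braidF i).obj (v 3)).dot ((braidF i).obj (v 3)).diff
        (natDiff idF (braidF i) 1 ζ 3 v a) := by
  have hclosed : ((braidF i).obj (v 1)).dot ((braidF i).obj (v 1)).diff (ζ 1 ![v 0, v 1] ![a 0]) =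
      0 := diff_dot_eq_zero (preNat_mem_hom h 1 _ _)
  have hbraid2 := eq_sub_of_add_eq (braid2_coherence i (v 1) (v 2) (v 3) (a 2) (a 1))
  rw [natDiff_one_three i (preNat_eq_zero h 3 (by decide) (by decide))]
  simp only [dot_sub_right, dot_add_right]
  rw [← dot_assoc _ _ _ (braid2 i _ _ _ _ _), hbraid2, ← dot_assoc _ _ _ (braid1 i _ _ _),
    diff_dot_braid1]
  simp only [homotopyRHS, natDiff_one_two i (preNat_eq_zero h 0 (by decide) (by decide)),
    Matrix.cons_val, dot_sub_left, dot_add_left, dot_sub_right, dot_add_right, dot_assoc, hclosed,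
    dot_zero_right, dot_entry_entry, gen_supp, Finset.mem_singleton, and_self, if_true,
    slot_vtx, mul_mul_assoc]
  abel

end

/-! ### Comparison with Hochschild cochains -/

section
variable {k : Type*} [Field k] {N : ℕ} {M M' : Type*} [AddCommGroup M] [Module k M]
  [AddCommGroup M'] [Module k M'] {d : ℕ}

lemma isMultilin_iff {f : (Fin d → k[X]) → M} :
    IsMultilin k f ↔ ∀ a n, IsLinearMap k fun x => f (Function.update a n x) := by
  constructor
  · rintro ⟨m, rfl⟩ a n
    exact (m.toLinearMap a n).isLinear
  · refine fun h => ⟨MultilinearMap.mk' f (fun a n x y => ?_) fun a n c x => ?_, rfl⟩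
    · exact (h a n).map_add x y
    · exact (h a n).map_smul c x

lemma isMultilin_zero : IsMultilin k (0 : (Fin d → k[X]) → M) := ⟨0, rfl⟩

lemma IsMultilin.sub {f g : (Fin d → k[X]) → M} (hf : IsMultilin k f) (hg : IsMultilin k g) :
    IsMultilin k (f - g) := by
  obtain ⟨m, rfl⟩ := hf
  obtain ⟨m', rfl⟩ := hg
  exact ⟨m - m', rfl⟩

lemma IsMultilin.linearMap_comp {f : (Fin d → k[X]) → M} (hf : IsMultilin k f) (L : M →ₗ[k] M') :
    IsMultilin k (fun a => L (f a)) := by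
  obtain ⟨m, rfl⟩ := hf
  exact ⟨L.compMultilinearMap m, rfl⟩

lemma IsMultilin.isLinearMap_singleton {f : (Fin 1 → k[X]) → M} (h : IsMultilin k f) :
    IsLinearMap k fun x => f ![x] := by
  convert isMultilin_iff.1 h ![0] 0 using 3 with x
  exact FinVec.etaExpand_eq (Function.update ![0] 0 x)

lemma IsMultilin.isLinearMap_fst {f : (Fin 2 → k[X]) → M} (h : IsMultilin k f) (y : k[X]) :
    IsLinearMap k fun x => f ![x, y] := by
  convert isMultilin_iff.1 h ![0, y] 0 using 3 with x
  exact FinVec.etaExpand_eq (Function.update ![0, y] 0 x)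

lemma IsMultilin.isLinearMap_snd {f : (Fin 2 → k[X]) → M} (h : IsMultilin k f) (x : k[X]) :
    IsLinearMap k fun y => f ![x, y] := by
  convert isMultilin_iff.1 h ![x, 0] 1 using 3 with y
  exact FinVec.etaExpand_eq (Function.update ![x, 0] 1 y)

end

section
variable {k : Type*} [Field k] {N : ℕ}

/-- The Hochschild cochain of degree `g` underlying a pre-natural transformation. -/
def underlying (i : Inner N) (g : ℕ) : Ops k N (Mat k N) →ₗ[k] Ops k N k[X] where
  toFun η d v a := if d = g then proj i (v 0) (v (Fin.last d)) (η d v a) else 0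
  map_add' η η' := by
    funext d v a
    simp only [Pi.add_apply, map_add]
    split_ifs <;> simp
  map_smul' c η := by
    funext d v a
    simp only [Pi.smul_apply, map_smul, RingHom.id_apply]
    split_ifs <;> simp

lemma underlying_apply (i : Inner N) (g : ℕ) (η : Ops k N (Mat k N))
    (v : Fin (g + 1) → Fin (N + 1)) (a : Fin g → k[X]) :
    underlying i g η g v a = proj i (v 0) (v (Fin.last g)) (η g v a) := if_pos rfl

lemma underlying_of_ne (i : Inner N) {g d : ℕ} (h : d ≠ g) (η : Ops k N (Mat k N)) :
    underlying i g η d = 0 := by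
  funext v a
  exact if_neg h

lemma underlying_mem (i : Inner N) (g : ℕ) {η : Ops k N (Mat k N)}
    (h : η ∈ PreNat idF (braidF i) g) : underlying i g η ∈ BimodCochain k i g := by
  refine ⟨fun d hd => underlying_of_ne i hd η, fun d v => ?_⟩
  by_cases hd : d = g
  · subst hd
    refine ⟨?_, fun a => ?_⟩
    · rw [funext (underlying_apply i d η v)]
      exact (h d v).1.linearMap_comp (proj i (v 0) (v (Fin.last d)))
    · rw [underlying_apply]
      exact proj_mem_bimod (preNat_mem_hom h d v a (sub_self _))
  · rw [underlying_of_ne i hd]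
    exact ⟨isMultilin_zero, fun _ => Submodule.zero_mem _⟩

lemma bimodDiff_two (φ : Ops k N k[X]) (v : Fin 3 → Fin (N + 1)) (a : Fin 2 → k[X]) :
    bimodDiff k N φ 2 v a = mul (v 0) (v 1) (v 2) (φ 1 ![v 1, v 2] ![a 1]) (a 0)
      - φ 1 ![v 0, v 2] ![mul (v 0) (v 1) (v 2) (a 1) (a 0)]
      + mul (v 0) (v 1) (v 2) (a 1) (φ 1 ![v 0, v 1] ![a 0]) := by
  change bimodDiffFun φ 2 v a = _
  rw [bimodDiffFun, insertMul_two, ← FinVec.etaExpand_eq (Fin.init v),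
    ← FinVec.etaExpand_eq (Fin.init a), ← FinVec.etaExpand_eq (Fin.tail v),
    ← FinVec.etaExpand_eq (Fin.tail a), show (-1 : k) ^ (1 + 1) = 1 from neg_one_sq, one_smul,
    zero_add, pow_one, neg_one_smul, ← sub_eq_add_neg]
  rfl

lemma bimodDiff_three (φ : Ops k N k[X]) (v : Fin 4 → Fin (N + 1)) (a : Fin 3 → k[X]) :
    bimodDiff k N φ 3 v a = mul (v 0) (v 1) (v 3) (φ 2 ![v 1, v 2, v 3] ![a 1, a 2]) (a 0)
      - φ 2 ![v 0, v 2, v 3] ![mul (v 0) (v 1) (v 2) (a 1) (a 0), a 2]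
      + φ 2 ![v 0, v 1, v 3] ![a 0, mul (v 1) (v 2) (v 3) (a 2) (a 1)]
      - mul (v 0) (v 2) (v 3) (a 2) (φ 2 ![v 0, v 1, v 2] ![a 0, a 1]) := by
  change bimodDiffFun φ 3 v a = _
  rw [bimodDiffFun, insertMul_three, ← FinVec.etaExpand_eq (Fin.init v),
    ← FinVec.etaExpand_eq (Fin.init a), ← FinVec.etaExpand_eq (Fin.tail v),
    ← FinVec.etaExpand_eq (Fin.tail a), show (-1 : k) ^ (1 + 1) = 1 from neg_one_sq, one_smul,
    show (-1 : k) ^ (2 + 1) = -1 from Odd.neg_one_pow (by decide), zero_add, pow_one,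
    neg_one_smul, neg_one_smul, ← sub_eq_add_neg, sub_eq_add_neg, sub_eq_add_neg, ← add_assoc]
  rfl

lemma bimodDiff_eq_zero {φ : Ops k N k[X]} {g : ℕ} (h : ∀ d, d ≠ g → φ d = 0) {d : ℕ}
    (hd : d ≠ g + 1) : bimodDiff k N φ d = 0 := by
  funext v a
  change bimodDiffFun φ d v a = 0
  cases d with
  | zero => rfl
  | succ d => simp [bimodDiffFun, insertMul, mul, h d (by omega)]

lemma proj_homotopyRHS {i : Inner N} {η : Ops k N (Mat k N)}
    (h : ∀ v a, η 2 v a ∈ BraidHom k i (v 0) (v 2) 0) (v : Fin 4 → Fin (N + 1))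
    (a : Fin 3 → k[X]) :
    proj i (v 0) (v 3) (homotopyRHS i η v a) = -bimodDiff k N (underlying i 2 η) 3 v a := by
  have hproj : ∀ v a, underlying i 2 η 2 v a = proj i (v 0) (v 2) (η 2 v a) :=
    underlying_apply i 2 η
  have h₁ := h ![v 0, v 1, v 2] ![a 0, a 1]
  have h₂ := h ![v 1, v 2, v 3] ![a 1, a 2]
  simp only [Matrix.cons_val] at h₁ h₂
  simp only [bimodDiff_three, hproj, homotopyRHS, map_add, map_sub, proj_braid1 _ _ h₁,
    proj_dot_entry _ _ h₂, Matrix.cons_val]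
  ring

lemma homotopyRHS_mem {i : Inner N} {η : Ops k N (Mat k N)}
    (h : ∀ v a, η 2 v a ∈ BraidHom k i (v 0) (v 2) 0) (v : Fin 4 → Fin (N + 1))
    (a : Fin 3 → k[X]) : homotopyRHS i η v a ∈ BraidHom k i (v 0) (v 3) 0 := by
  have hleft : ((braidF i).obj (v 2)).dot (braid1 i (v 2) (v 3) (a 2))
      (η 2 ![v 0, v 1, v 2] ![a 0, a 1]) ∈ BraidHom k i (v 0) (v 3) 0 :=
    mem_hom_of_eq (add_zero 0) (dot_mem (braid1_mem i _ _ _) (h ![v 0, v 1, v 2] _))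
  have hright : (gen (v 1)).dot (η 2 ![v 1, v 2, v 3] ![a 1, a 2])
      (entry (slot 0 (v 1)) (slot 0 (v 0)) (a 0)) ∈ BraidHom k i (v 0) (v 3) 0 :=
    mem_hom_of_eq (add_zero 0) (dot_mem (h ![v 1, v 2, v 3] _)
      (entry_mem (by simp) (by simp) (by simp) _))
  exact Submodule.sub_mem _ (Submodule.add_mem _ (Submodule.sub_mem _ hleft hright)
    (h ![v 0, v 2, v 3] _)) (h ![v 0, v 1, v 3] _)

lemma underlying_natDiff {i : Inner N} {ζ : Ops k N (Mat k N)}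
    (h : ζ ∈ PreNat idF (braidF i) 1) :
    underlying i 2 (natDiff idF (braidF i) 1 ζ) = bimodDiff k N (underlying i 1 ζ) := by
  funext d v a
  by_cases hd : d = 2
  · subst hd
    have hproj : ∀ v a, underlying i 1 ζ 1 v a = proj i (v 0) (v 1) (ζ 1 v a) :=
      underlying_apply i 1 ζ
    have h₁ : ζ 1 ![v 0, v 1] ![a 0] ∈ BraidHom k i (v 0) (v 1) 0 := preNat_mem_hom h 1 _ _
    have h₂ : ζ 1 ![v 1, v 2] ![a 1] ∈ BraidHom k i (v 1) (v 2) 0 := preNat_mem_hom h 1 _ _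
    rw [underlying_apply, bimodDiff_two, natDiff_one_two i (preNat_eq_zero h 0 (by decide)
      (by decide)), show Fin.last 2 = 2 from rfl]
    simp only [hproj, map_sub, map_add, proj_braid1 _ _ h₁, proj_dot_entry _ _ h₂, proj_diff_dot,
      Matrix.cons_val]
    ring
  · rw [underlying_of_ne i hd, bimodDiff_eq_zero (fun d hd => underlying_of_ne i hd ζ) hd]

lemma homotopyRHS_isMultilin (i : Inner N) {η : Ops k N (Mat k N)}
    (h : ∀ v, IsMultilin k (η 2 v)) (v : Fin 4 → Fin (N + 1)) :
    IsMultilin k (homotopyRHS i η v) := by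
  have fst_add := fun w y => ((h w).isLinearMap_fst y).map_add
  have fst_smul := fun w y => ((h w).isLinearMap_fst y).map_smul
  have snd_add := fun w x => ((h w).isLinearMap_snd x).map_add
  have snd_smul := fun w x => ((h w).isLinearMap_snd x).map_smul
  refine isMultilin_iff.2 fun a n => ⟨fun x y => ?_, fun c x => ?_⟩ <;> fin_cases n
  all_goals
    simp +decide only [homotopyRHS, Function.update, dite_true, dite_false, fst_add, fst_smul,
      snd_add, snd_smul, entry_add, entry_smul, braid1_add, braid1_smul, dot_add_right,
      dot_add_left, dot_smul_right, dot_smul_left, mul_add_left', mul_add_right',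
      mul_smul_left', mul_smul_right', Fin.zero_eta, Fin.mk_one, Fin.reduceFinMk]
    module

lemma natDiff_one_two_isMultilin (i : Inner N) {ζ : Ops k N (Mat k N)} (h0 : ζ 0 = 0)
    (h2 : ζ 2 = 0) (h1 : ∀ v, IsMultilin k (ζ 1 v)) (v : Fin 3 → Fin (N + 1)) :
    IsMultilin k (natDiff idF (braidF i) 1 ζ 2 v) := by
  have one_add := fun w => (h1 w).isLinearMap_singleton.map_add
  have one_smul := fun w => (h1 w).isLinearMap_singleton.map_smul
  refine isMultilin_iff.2 fun a n => ⟨fun x y => ?_, fun c x => ?_⟩ <;> fin_cases n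
  all_goals
    simp +decide only [natDiff_one_two i h0, h2, Pi.zero_apply, dot_zero_right, Function.update,
      dite_true, dite_false, one_add, one_smul, entry_add, entry_smul, braid1_add, braid1_smul,
      dot_add_right, dot_add_left, dot_smul_right, dot_smul_left, mul_add_left', mul_add_right',
      mul_smul_left', mul_smul_right', Fin.zero_eta, Fin.mk_one]
    module

/-- The family with `η²` given by `E`, with `η³` the solution of the homotopy equation, and zero
in all other lengths. -/
def extendOps (i : Inner N) (E : (Fin 3 → Fin (N + 1)) → (Fin 2 → k[X]) → Mat k N) :
    Ops k N (Mat k N) :=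
  fun d => match d with
    | 2 => E
    | 3 => fun v a => deltaInv k i (v 0) (v 3)
        (homotopyRHS i (fun d => match d with | 2 => E | _ => 0) v a)
    | _ => 0

lemma extendOps_three (i : Inner N) (E : (Fin 3 → Fin (N + 1)) → (Fin 2 → k[X]) → Mat k N)
    (v : Fin 4 → Fin (N + 1)) (a : Fin 3 → k[X]) : extendOps i E 3 v a =
      deltaInv k i (v 0) (v 3) (homotopyRHS i (extendOps i E) v a) := rfl

lemma extendOps_of_ne (i : Inner N) (E : (Fin 3 → Fin (N + 1)) → (Fin 2 → k[X]) → Mat k N)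
    (d : ℕ) (h2 : d ≠ 2) (h3 : d ≠ 3) : extendOps i E d = 0 := by
  match d with
  | 0 | 1 => rfl
  | 2 => exact absurd rfl h2
  | 3 => exact absurd rfl h3
  | d + 4 => rfl

lemma extendOps_mem_preNat (i : Inner N)
    {E : (Fin 3 → Fin (N + 1)) → (Fin 2 → k[X]) → Mat k N} (hl : ∀ v, IsMultilin k (E v))
    (hm : ∀ v a, E v a ∈ BraidHom k i (v 0) (v 2) 0) :
    extendOps i E ∈ PreNat idF (braidF i) 2
  | 2, v => ⟨hl v, fun a => mem_hom_of_eq (by norm_num) (hm v a)⟩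
  | 3, v => ⟨(homotopyRHS_isMultilin i (η := extendOps i E) hl v).linearMap_comp _,
      fun _ => mem_hom_of_eq (by norm_num) (deltaInv_mem i (v 0) (v 3) _)⟩
  | 0, _ | 1, _ | _ + 4, _ => ⟨isMultilin_zero, fun _ => Submodule.zero_mem _⟩

lemma diff_dot_extendOps_three (i : Inner N)
    {E : (Fin 3 → Fin (N + 1)) → (Fin 2 → k[X]) → Mat k N}
    (hm : ∀ v a, E v a ∈ BraidHom k i (v 0) (v 2) 0)
    (hc : bimodDiff k N (underlying i 2 (extendOps i E)) 3 = 0) (v : Fin 4 → Fin (N + 1))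
    (a : Fin 3 → k[X]) :
    ((braidF i).obj (v 3)).dot ((braidF i).obj (v 3)).diff (extendOps i E 3 v a) =
      homotopyRHS i (extendOps i E) v a := by
  rw [extendOps_three]
  refine diff_dot_deltaInv (homotopyRHS_mem (η := extendOps i E) hm v a) ?_
  rw [proj_homotopyRHS (η := extendOps i E) hm, hc, Pi.zero_apply, Pi.zero_apply, neg_zero]

lemma extendOps_mem_natTrans (i : Inner N)
    {E : (Fin 3 → Fin (N + 1)) → (Fin 2 → k[X]) → Mat k N} (hl : ∀ v, IsMultilin k (E v))
    (hm : ∀ v a, E v a ∈ BraidHom k i (v 0) (v 2) 0)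
    (hc : bimodDiff k N (underlying i 2 (extendOps i E)) 3 = 0) :
    extendOps i E ∈ NatTrans idF (braidF i) 2 := by
  have hpre := extendOps_mem_preNat i hl hm
  have hδ := diff_dot_extendOps_three i hm hc
  refine ⟨hpre, LinearMap.mem_ker.2 (funext fun d => ?_)⟩
  by_cases h3 : d = 3
  · subst h3
    funext v a
    rw [natDiff_two_three i rfl, hδ, sub_self]
    rfl
  by_cases h4 : d = 4
  · subst h4
    exact natDiff_two_four_eq_zero hpre hδ
  · exact natDiff_eq_zero hpre d (by omega) (by omega)

lemma diff_dot_natTrans_three {i : Inner N} {η : Ops k N (Mat k N)}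
    (h : η ∈ NatTrans idF (braidF i) 2) (v : Fin 4 → Fin (N + 1)) (a : Fin 3 → k[X]) :
    ((braidF i).obj (v 3)).dot ((braidF i).obj (v 3)).diff (η 3 v a) = homotopyRHS i η v a := by
  have hthree := natDiff_two_three i (preNat_eq_zero h.1 1 (by decide) (by decide)) v a
  rw [LinearMap.mem_ker.1 h.2] at hthree
  exact (sub_eq_zero.1 hthree.symm).symm

/-- Since `δ` is injective on `Hom^{-1}`, a natural transformation of degree two is determined by
its component `η²`. -/
lemma eq_natDiff_of_two {i : Inner N} {η ζ : Ops k N (Mat k N)}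
    (h : η ∈ NatTrans idF (braidF i) 2) (hζ : ζ ∈ PreNat idF (braidF i) 1)
    (h2 : natDiff idF (braidF i) 1 ζ 2 = η 2) : natDiff idF (braidF i) 1 ζ = η := by
  funext d
  by_cases d2 : d = 2
  · subst d2; exact h2
  by_cases d3 : d = 3
  · subst d3
    funext v a
    rw [← sub_eq_zero]
    refine eq_zero_of_diff_dot_eq_zero (Submodule.sub_mem _ (natDiff_mem_braidHom hζ 3 v a)
      (preNat_mem_hom h.1 3 v a)) ?_
    change ((braidF i).obj (v 3)).dot ((braidF i).obj (v 3)).diff _ = 0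
    rw [dot_sub_right, diff_dot_natTrans_three h, ← homotopyRHS_natDiff hζ, sub_eq_zero]
    simp only [homotopyRHS, h2]
  · rw [natDiff_eq_zero hζ d (by omega) (by omega), preNat_eq_zero h.1 d (by omega) (by omega)]

/-- The pre-natural transformation of degree one with `ζ¹` the lift of a Hochschild `1`-cochain
and `ζ² = 0`. -/
def liftFst (i : Inner N) (ψ : Ops k N k[X]) : Ops k N (Mat k N) :=
  fun d => match d with
    | 1 => fun v a => projSection k i (v 0) (v 1) (ψ 1 v a)
    | _ => 0

/-- The correction of `liftFst` by the `ζ²` which makes its differential agree with `η` in length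
two. -/
def liftOps (i : Inner N) (ψ : Ops k N k[X]) (η : Ops k N (Mat k N)) : Ops k N (Mat k N) :=
  fun d => match d with
    | 1 => liftFst i ψ 1
    | 2 => fun v a => deltaInv k i (v 0) (v 2)
        (natDiff idF (braidF i) 1 (liftFst i ψ) 2 v a - η 2 v a)
    | _ => 0

lemma natDiff_liftOps_two (i : Inner N) (ψ : Ops k N k[X]) (η : Ops k N (Mat k N))
    (v : Fin 3 → Fin (N + 1)) (a : Fin 2 → k[X]) :
    natDiff idF (braidF i) 1 (liftOps i ψ η) 2 v a =
      natDiff idF (braidF i) 1 (liftFst i ψ) 2 v a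
        - ((braidF i).obj (v 2)).dot ((braidF i).obj (v 2)).diff (deltaInv k i (v 0) (v 2)
          (natDiff idF (braidF i) 1 (liftFst i ψ) 2 v a - η 2 v a)) := by
  rw [natDiff_one_two i (ζ := liftOps i ψ η) rfl, show liftOps i ψ η 1 = liftFst i ψ 1 from rfl,
    show liftOps i ψ η 2 v a = deltaInv k i _ _ _ from rfl,
    natDiff_one_two i (ζ := liftFst i ψ) rfl, show liftFst i ψ 2 = 0 from rfl, Pi.zero_apply,
    Pi.zero_apply, dot_zero_right]
  abel

lemma liftFst_mem (i : Inner N) {ψ : Ops k N k[X]} (hψ : ψ ∈ BimodCochain k i 1) :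
    liftFst i ψ ∈ PreNat idF (braidF i) 1
  | 1, v => ⟨((hψ.2 1 v).1).linearMap_comp (projSection k i (v 0) (v 1)),
      fun _ => mem_hom_of_eq (by norm_num) (projSection_mem i (v 0) (v 1) _)⟩
  | 0, _ | _ + 2, _ => ⟨isMultilin_zero, fun _ => Submodule.zero_mem _⟩

lemma underlying_liftFst (i : Inner N) {ψ : Ops k N k[X]} (hψ : ψ ∈ BimodCochain k i 1) :
    underlying i 1 (liftFst i ψ) = ψ := by
  funext d v a
  by_cases hd : d = 1
  · subst hd
    rw [underlying_apply]
    exact proj_projSection i (v 0) (v 1) ((hψ.2 1 v).2 a)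
  · rw [underlying_of_ne i hd, hψ.1 d hd]

lemma liftOps_mem (i : Inner N) {ψ : Ops k N k[X]} (hψ : ψ ∈ BimodCochain k i 1)
    {η : Ops k N (Mat k N)} (h : η ∈ PreNat idF (braidF i) 2) :
    liftOps i ψ η ∈ PreNat idF (braidF i) 1
  | 1, v => liftFst_mem i hψ 1 v
  | 2, v => ⟨((natDiff_one_two_isMultilin i rfl rfl (fun v => (liftFst_mem i hψ 1 v).1) v).sub
      (h 2 v).1).linearMap_comp (deltaInv k i (v 0) (v 2)),
      fun _ => mem_hom_of_eq (by norm_num) (deltaInv_mem i (v 0) (v 2) _)⟩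
  | 0, _ | _ + 3, _ => ⟨isMultilin_zero, fun _ => Submodule.zero_mem _⟩

lemma exists_natDiff_eq {i : Inner N} {η : Ops k N (Mat k N)}
    (h : η ∈ NatTrans idF (braidF i) 2) {ψ : Ops k N k[X]} (hψ : ψ ∈ BimodCochain k i 1)
    (hη : underlying i 2 η = bimodDiff k N ψ) :
    ∃ ζ ∈ PreNat idF (braidF i) 1, natDiff idF (braidF i) 1 ζ = η := by
  have hfst := liftFst_mem i hψ
  refine ⟨_, liftOps_mem i hψ h.1, eq_natDiff_of_two h (liftOps_mem i hψ h.1) ?_⟩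
  funext v a
  have hmem : natDiff idF (braidF i) 1 (liftFst i ψ) 2 v a - η 2 v a ∈
      BraidHom k i (v 0) (v 2) 0 :=
    Submodule.sub_mem _ (natDiff_mem_braidHom hfst 2 v a) (preNat_mem_hom h.1 2 v a)
  have hproj : proj i (v 0) (v 2)
      (natDiff idF (braidF i) 1 (liftFst i ψ) 2 v a - η 2 v a) = 0 := by
    have hunderlying := congrFun₃ (underlying_natDiff hfst) 2 v a
    rw [underlying_liftFst i hψ, ← hη, underlying_apply, underlying_apply] at hunderlying
    rw [map_sub, sub_eq_zero]
    exact hunderlying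
  rw [natDiff_liftOps_two, diff_dot_deltaInv hmem hproj, sub_sub_cancel]

end

/-! ### The cocycles with coefficients `ℭ` -/

section
variable {R : Type*} [CommRing R]

/-- The weight `2 (ϑ_0 + ⋯ + ϑ_j)` of the step from `j + 1` down to `j`. -/
def stepWeight (ϑ : ℕ → R) (j : ℕ) : R := 2 * ∑ v ∈ Finset.range (j + 1), ϑ v

/-- The total weight of the steps of the monotone path from `p` to `q`, where only descending
steps have a weight. -/
def descentWeight (ϑ : ℕ → R) (p q : ℕ) : R := ∑ v ∈ Finset.Ico q p, stepWeight ϑ v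

/-- The weight `2 (ϑ_0 + ⋯ + ϑ_{j-1}) + ϑ_j` of the dot on a morphism out of `T_j`. -/
def dotWeight (ϑ : ℕ → R) (j : ℕ) : R := 2 * ∑ v ∈ Finset.range j, ϑ v + ϑ j

variable (ϑ : ℕ → R)

lemma descentWeight_of_le {p q : ℕ} (h : p ≤ q) : descentWeight ϑ p q = 0 := by
  rw [descentWeight, Finset.Ico_eq_empty_of_le h, Finset.sum_empty]

lemma descentWeight_of_ge {p q : ℕ} (h : q ≤ p) : descentWeight ϑ p q =
    ∑ v ∈ Finset.range p, stepWeight ϑ v - ∑ v ∈ Finset.range q, stepWeight ϑ v :=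
  Finset.sum_Ico_eq_sub _ h

lemma descentWeight_add {p q r : ℕ} (h : p ≤ q ∧ q ≤ r ∨ r ≤ q ∧ q ≤ p) :
    descentWeight ϑ p q + descentWeight ϑ q r = descentWeight ϑ p r := by
  rcases h with ⟨hpq, hqr⟩ | ⟨hrq, hqp⟩
  · rw [descentWeight_of_le ϑ hpq, descentWeight_of_le ϑ hqr,
      descentWeight_of_le ϑ (hpq.trans hqr), zero_add]
  · rw [add_comm]
    exact Finset.sum_Ico_consecutive _ hrq hqp

lemma dotWeight_succ (j : ℕ) : dotWeight ϑ (j + 1) = dotWeight ϑ j + (ϑ (j + 1) + ϑ j) := by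
  rw [dotWeight, dotWeight, Finset.sum_range_succ]
  ring

lemma sum_Ioc_add_pred {p q : ℕ} (h : p ≤ q) :
    ∑ v ∈ Finset.Ioc p q, (ϑ v + ϑ (v - 1)) = dotWeight ϑ q - dotWeight ϑ p := by
  induction q, h using Nat.le_induction with
  | base => simp
  | succ q h ih =>
    rw [← Finset.insert_Ioc_right_eq_Ioc_add_one (by omega), Finset.sum_insert (by simp), ih,
      dotWeight_succ, Nat.add_sub_cancel]
    ring

lemma sum_Ico_add_succ {p q : ℕ} (h : p ≤ q) :
    ∑ v ∈ Finset.Ico p q, (ϑ v + ϑ (v + 1)) = dotWeight ϑ q - dotWeight ϑ p := by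
  induction q, h using Nat.le_induction with
  | base => simp
  | succ q h ih => rw [Finset.sum_Ico_succ_top h, ih, dotWeight_succ]; ring

lemma sum_Icc_two_mul_add_mul_sub (β : R) (r n : ℕ) :
    ∑ x ∈ Finset.Icc 1 n, 2 * (β + x) * ϑ (r + n - x) =
      2 * β * (∑ v ∈ Finset.range (r + n), ϑ v - ∑ v ∈ Finset.range r, ϑ v)
      + descentWeight ϑ (r + n) r - 2 * n * ∑ v ∈ Finset.range r, ϑ v := by
  induction n generalizing r with
  | zero => simp [descentWeight]
  | succ n ih =>
    rw [Finset.sum_Icc_succ_top (by omega), ← Nat.succ_add_eq_add_succ, Nat.succ_eq_add_one, ih,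
      show r + 1 + n - (n + 1) = r by omega, descentWeight_of_ge ϑ (by omega),
      descentWeight_of_ge ϑ (by omega)]
    simp only [Finset.sum_range_succ _ r, stepWeight]
    push_cast
    ring

lemma sum_Icc_two_mul_add_mul_add (β : R) (q n : ℕ) :
    ∑ x ∈ Finset.Icc 1 n, 2 * (β + x) * ϑ (q + x) =
      2 * β * (∑ v ∈ Finset.range (q + n + 1), ϑ v - ∑ v ∈ Finset.range (q + 1), ϑ v)
      - descentWeight ϑ (q + n) q + 2 * n * ∑ v ∈ Finset.range (q + n + 1), ϑ v := by
  induction n with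
  | zero => simp [descentWeight]
  | succ n ih =>
    rw [Finset.sum_Icc_succ_top (by omega), ih, descentWeight_of_ge ϑ (by omega),
      descentWeight_of_ge ϑ (by omega)]
    simp only [← add_assoc, Finset.sum_range_succ _ (q + n), Finset.sum_range_succ _ (q + n + 1),
      stepWeight]
    push_cast
    ring

end

section
variable {k : Type*} [Field k] (ϑ : ℕ → k)

lemma coeffC_of_lt_of_le (β : ℕ) {p q r : ℕ} (hpr : p < r) (hrq : r ≤ q) :
    coeffC ϑ β p q r =
      (q - r : ℕ) * dotWeight ϑ p - descentWeight ϑ q r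
        + β * (dotWeight ϑ p - dotWeight ϑ q) := by
  obtain ⟨n, rfl⟩ := Nat.exists_eq_add_of_le hrq
  obtain ⟨m, rfl⟩ : ∃ m, r = m + 1 := ⟨r - 1, by omega⟩
  rw [coeffC, if_pos ⟨hpr, hrq⟩, Nat.add_sub_cancel_left, Nat.add_sub_cancel,
    sum_Icc_two_mul_add_mul_sub, Finset.Ioo_add_one_right_eq_Ioc, sum_Ioc_add_pred ϑ (by omega)]
  simp only [dotWeight, Finset.sum_range_succ _ m]
  ring

lemma coeffC_of_le_of_lt (β : ℕ) {p q r : ℕ} (hqr : q ≤ r) (hrp : r < p) :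
    coeffC ϑ β p q r =
      (r - q : ℕ) * dotWeight ϑ p + descentWeight ϑ p r - descentWeight ϑ p q
        + β * (dotWeight ϑ p - dotWeight ϑ q) := by
  obtain ⟨n, rfl⟩ := Nat.exists_eq_add_of_le hqr
  rw [coeffC, if_neg (by omega), if_pos ⟨hqr, hrp⟩, Nat.add_sub_cancel_left,
    sum_Icc_two_mul_add_mul_add, ← Finset.Ico_add_one_left_eq_Ioo, sum_Ico_add_succ ϑ (by omega),
    ← descentWeight_add ϑ (p := p) (Or.inr ⟨hqr, hrp.le⟩)]
  simp only [dotWeight, Finset.sum_range_succ _ q]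
  ring

lemma coeffC_of_le_source_of_lt (β : ℕ) {p q r : ℕ} (hrp : r ≤ p) (hpq : p < q) :
    coeffC ϑ β p q r =
      (q - p : ℕ) * dotWeight ϑ p + descentWeight ϑ p r - descentWeight ϑ q r
        + β * (dotWeight ϑ p - dotWeight ϑ q) := by
  obtain ⟨n, rfl⟩ := Nat.exists_eq_add_of_le hpq.le
  rw [coeffC, if_neg (by omega), if_neg (by omega), if_pos ⟨hrp, hpq⟩, Nat.add_sub_cancel_left,
    sum_Icc_two_mul_add_mul_sub, ← descentWeight_add ϑ (p := p + n) (Or.inr ⟨hrp, hpq.le⟩)]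
  simp only [dotWeight]
  ring

lemma coeffC_of_lt_source_of_le (β : ℕ) {p q r : ℕ} (hqp : q < p) (hpr : p ≤ r) :
    coeffC ϑ β p q r =
      (p - q : ℕ) * dotWeight ϑ p - descentWeight ϑ p q
        + β * (dotWeight ϑ p - dotWeight ϑ q) := by
  obtain ⟨n, rfl⟩ := Nat.exists_eq_add_of_le hqp.le
  rw [coeffC, if_neg (by omega), if_neg (by omega), if_neg (by omega), if_pos ⟨hqp, hpr⟩,
    Nat.add_sub_cancel_left, sum_Icc_two_mul_add_mul_add]
  simp only [dotWeight, Finset.sum_range_succ _ q, Finset.sum_range_succ _ (q + n)]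
  ring

lemma coeffC_of_between (β : ℕ) {p q r : ℕ} (h : p < q ∧ q < r ∨ r < q ∧ q < p) :
    coeffC ϑ β p q r = β * (dotWeight ϑ p - dotWeight ϑ q) := by
  rw [coeffC, if_neg (by omega), if_neg (by omega), if_neg (by omega), if_neg (by omega)]
  rcases h with h | h
  · rw [if_pos h, sum_Ioc_add_pred ϑ h.1.le]
    ring
  · rw [if_neg (by omega), if_pos h, sum_Ico_add_succ ϑ h.2.le]

lemma coeffC_eq (β p q r : ℕ) :
    coeffC ϑ β p q r = descentWeight ϑ p r - descentWeight ϑ q r - descentWeight ϑ p q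
      + turn p q r * dotWeight ϑ p + β * (dotWeight ϑ p - dotWeight ϑ q) := by
  have hturn (n : ℕ) := (turn_eq_iff p q r n).2
  by_cases hbetween : p < q ∧ q < r ∨ r < q ∧ q < p
  · rw [coeffC_of_between ϑ β hbetween, ← descentWeight_add ϑ (q := q) (by omega),
      hturn 0 (by omega)]
    push_cast
    ring
  rcases lt_trichotomy p q with hpq | rfl | hqp
  · rcases lt_or_ge p r with hpr | hrp
    · rw [coeffC_of_lt_of_le ϑ β hpr (by omega), hturn (q - r) (by omega),
        descentWeight_of_le ϑ hpr.le, descentWeight_of_le ϑ hpq.le]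
      ring
    · rw [coeffC_of_le_source_of_lt ϑ β hrp hpq, hturn (q - p) (by omega),
        descentWeight_of_le ϑ hpq.le]
      ring
  · have hzero : coeffC ϑ β p p r = 0 := by
      unfold coeffC
      split_ifs <;> first | omega | rfl
    rw [hzero, descentWeight_of_le ϑ le_rfl, hturn 0 (by omega)]
    push_cast
    ring
  · rcases lt_or_ge r p with hrp | hpr
    · rw [coeffC_of_le_of_lt ϑ β (by omega) hrp, hturn (r - q) (by omega),
        descentWeight_of_le ϑ (p := q) (by omega)]
      ring
    · rw [coeffC_of_lt_source_of_le ϑ β hqp hpr, hturn (p - q) (by omega),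
        descentWeight_of_le ϑ hpr, descentWeight_of_le ϑ (hqp.le.trans hpr)]
      ring

/-- The `1`-cochain `a_{qp} s^α ↦ (descentWeight ϑ p q + α dotWeight ϑ p) a_{qp} s^α`, a first-order
change of the basis of `Hom(T_p, T_q)`. -/
def gauge (p q : ℕ) : k[X] →ₗ[k] k[X] :=
  descentWeight ϑ p q • LinearMap.id + dotWeight ϑ p • (LinearMap.mulLeft k X ∘ₗ derivative)

lemma gauge_apply (p q : ℕ) (f : k[X]) :
    gauge ϑ p q f = C (descentWeight ϑ p q) * f + C (dotWeight ϑ p) * (X * derivative f) := by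
  simp [gauge, smul_eq_C_mul]

/-- The Hochschild coboundary of `gauge`, up to sign. -/
def gaugeDefect (p q r : ℕ) (g f : k[X]) : k[X] :=
  gauge ϑ p r (mul p q r g f) - mul p q r (gauge ϑ q r g) f - mul p q r g (gauge ϑ p q f)

lemma X_mul_derivative_X_pow (n : ℕ) :
    X * derivative (X ^ n : k[X]) = C (n : k) * X ^ n := by
  cases n with
  | zero => simp
  | succ n =>
    rw [derivative_X_pow, Nat.add_sub_cancel, pow_succ']
    ring

lemma gaugeDefect_eq (p q r : ℕ) (g f : k[X]) : gaugeDefect ϑ p q r g f =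
    X ^ turn p q r * f *
      (C (descentWeight ϑ p r - descentWeight ϑ q r - descentWeight ϑ p q
        + turn p q r * dotWeight ϑ p) * g
      + C (dotWeight ϑ p - dotWeight ϑ q) * (X * derivative g)) := by
  simp only [gaugeDefect, gauge_apply, mul, derivative_mul, mul_add, add_mul, map_sub, map_add,
    map_mul]
  linear_combination (C (dotWeight ϑ p) * g * f) * X_mul_derivative_X_pow (k := k) (turn p q r)

lemma gaugeDefect_X_pow (p q r α β : ℕ) : gaugeDefect ϑ p q r (X ^ β) (X ^ α) =
    C (coeffC ϑ β p q r) * X ^ (β + α + turn p q r) := by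
  rw [gaugeDefect_eq, coeffC_eq, X_mul_derivative_X_pow, pow_add, pow_add]
  simp only [map_add, map_mul, map_sub]
  ring

lemma X_mul_divX {f : k[X]} (h : f.coeff 0 = 0) : X * divX f = f := by
  simpa only [h, C_0, add_zero, mul_comm] using divX_mul_X_add f

lemma coeff_zero_gaugeDefect (p q r : ℕ) (g f : k[X]) :
    (gaugeDefect ϑ p q r g f).coeff 0 = 0 := by
  rw [gaugeDefect_eq]
  rcases Nat.eq_zero_or_pos (turn p q r) with h | h
  · have hmono : p ≤ q ∧ q ≤ r ∨ r ≤ q ∧ q ≤ p := by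
      have := (turn_eq_iff p q r 0).1 h
      omega
    rw [← descentWeight_add ϑ hmono, h]
    simp
  · rw [mul_coeff_zero, mul_coeff_zero, coeff_X_pow, if_neg h.ne, zero_mul, zero_mul]

/-- The Hochschild `2`-cocycle
`(a_{rq} s^β, a_{qp} s^α) ↦ ℭ(a_{rq} s^β, a_{qp} s^α) a_{rp} s^{α + β + δ(p,q,r) - 1}`. It is
the coboundary of the gauge transformation `gauge ϑ / X`, which has a pole. -/
def gaugeCocycle (p q r : ℕ) (g f : k[X]) : k[X] := divX (gaugeDefect ϑ p q r g f)

lemma X_mul_gaugeCocycle (p q r : ℕ) (g f : k[X]) :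
    X * gaugeCocycle ϑ p q r g f = gaugeDefect ϑ p q r g f :=
  X_mul_divX (coeff_zero_gaugeDefect ϑ p q r g f)

lemma mul_sub_right (p q r : ℕ) (g f f' : k[X]) :
    mul p q r g (f - f') = mul p q r g f - mul p q r g f' :=
  mul_sub _ _ _

lemma mul_sub_left (p q r : ℕ) (g g' f : k[X]) :
    mul p q r (g - g') f = mul p q r g f - mul p q r g' f := by
  unfold mul
  ring

lemma mul_X_mul_right (p q r : ℕ) (g f : k[X]) : mul p q r g (X * f) = X * mul p q r g f :=
  mul_left_comm _ _ _

lemma mul_X_mul_left (p q r : ℕ) (g f : k[X]) : mul p q r (X * g) f = X * mul p q r g f := by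
  unfold mul
  ring

lemma gaugeCocycle_coboundary_eq_zero (p q r s : ℕ) (h g f : k[X]) :
    mul p q s (gaugeCocycle ϑ q r s h g) f - gaugeCocycle ϑ p r s h (mul p q r g f)
      + gaugeCocycle ϑ p q s (mul q r s h g) f - mul p r s h (gaugeCocycle ϑ p q r g f) = 0 := by
  refine mul_left_cancel₀ (X_ne_zero (R := k)) ?_
  rw [mul_sub, mul_add, mul_sub, ← mul_X_mul_left, ← mul_X_mul_right, X_mul_gaugeCocycle,
    X_mul_gaugeCocycle, X_mul_gaugeCocycle, X_mul_gaugeCocycle]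
  simp only [gaugeDefect, mul_sub_left, mul_sub_right, mul_mul_assoc, mul_zero]
  ring

lemma gaugeCocycle_X_pow (p q r α β : ℕ) : gaugeCocycle ϑ p q r (X ^ β) (X ^ α) =
    coeffC ϑ β p q r • X ^ (β + α + turn p q r - 1) := by
  have hcoeff := coeff_zero_gaugeDefect ϑ p q r (X ^ β) (X ^ α)
  rw [gaugeDefect_X_pow, coeff_C_mul, coeff_X_pow] at hcoeff
  rw [gaugeCocycle, gaugeDefect_X_pow, smul_eq_C_mul, divX_C_mul, divX_X_pow]
  split_ifs at hcoeff ⊢ with hexp <;> simp_all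

end

section
variable {k : Type*} [Field k]

lemma gauge_add (ϑ ϑ' : ℕ → k) (p q : ℕ) : gauge (ϑ + ϑ') p q = gauge ϑ p q + gauge ϑ' p q := by
  simp only [gauge, descentWeight, stepWeight, dotWeight, Pi.add_apply, Finset.sum_add_distrib,
    mul_add, add_smul]
  module

lemma gauge_smul (c : k) (ϑ : ℕ → k) (p q : ℕ) : gauge (c • ϑ) p q = c • gauge ϑ p q := by
  simp only [gauge, descentWeight, stepWeight, dotWeight, Pi.smul_apply, smul_eq_mul,
    ← Finset.mul_sum]
  module

lemma gaugeCocycle_eq_iff {ϑ : ℕ → k} {p q r : ℕ} {g f h : k[X]} :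
    gaugeCocycle ϑ p q r g f = h ↔ gaugeDefect ϑ p q r g f = X * h := by
  rw [← X_mul_gaugeCocycle]
  exact (mul_right_inj' X_ne_zero).symm

lemma gaugeCocycle_add (ϑ ϑ' : ℕ → k) (p q r : ℕ) (g f : k[X]) :
    gaugeCocycle (ϑ + ϑ') p q r g f = gaugeCocycle ϑ p q r g f + gaugeCocycle ϑ' p q r g f := by
  rw [gaugeCocycle_eq_iff, mul_add, X_mul_gaugeCocycle, X_mul_gaugeCocycle]
  simp only [gaugeDefect, gauge_add, LinearMap.add_apply, mul_add_left', mul_add_right']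
  ring

lemma gaugeCocycle_smul (c : k) (ϑ : ℕ → k) (p q r : ℕ) (g f : k[X]) :
    gaugeCocycle (c • ϑ) p q r g f = c • gaugeCocycle ϑ p q r g f := by
  rw [gaugeCocycle_eq_iff, mul_smul_comm, X_mul_gaugeCocycle]
  simp only [gaugeDefect, gauge_smul, LinearMap.smul_apply, mul_smul_left', mul_smul_right',
    smul_sub]

lemma gaugeCocycle_isLinearMap_left (ϑ : ℕ → k) (p q r : ℕ) (f : k[X]) :
    IsLinearMap k fun g => gaugeCocycle ϑ p q r g f where
  map_add g g' := by
    rw [gaugeCocycle_eq_iff, mul_add, X_mul_gaugeCocycle, X_mul_gaugeCocycle]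
    simp only [gaugeDefect, map_add, mul_add_left']
    ring
  map_smul c g := by
    rw [gaugeCocycle_eq_iff, mul_smul_comm, X_mul_gaugeCocycle]
    simp only [gaugeDefect, map_smul, mul_smul_left', smul_sub]

lemma gaugeCocycle_isLinearMap_right (ϑ : ℕ → k) (p q r : ℕ) (g : k[X]) :
    IsLinearMap k fun f => gaugeCocycle ϑ p q r g f where
  map_add f f' := by
    rw [gaugeCocycle_eq_iff, mul_add, X_mul_gaugeCocycle, X_mul_gaugeCocycle]
    simp only [gaugeDefect, map_add, mul_add_right']
    ring
  map_smul c f := by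
    rw [gaugeCocycle_eq_iff, mul_smul_comm, X_mul_gaugeCocycle]
    simp only [gaugeDefect, map_smul, mul_smul_right', smul_sub]

lemma descentWeight_loop_eq {ϑ : ℕ → k} {p q : ℕ} (hp : ϑ p = 0) (h : turn p q p ≤ 1) :
    descentWeight ϑ p p - descentWeight ϑ q p - descentWeight ϑ p q
      + turn p q p * dotWeight ϑ p = 0 := by
  have hturn := (turn_eq_iff p q p _).1 rfl
  obtain rfl | hq | hq : q = p ∨ q = p + 1 ∨ p = q + 1 := by omega
  · simp [descentWeight]
  · subst hq
    have h1 : turn p (p + 1) p = 1 := by omega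
    simp [h1, descentWeight, stepWeight, dotWeight, Finset.sum_range_succ, hp]
  · subst hq
    have h1 : turn (q + 1) q (q + 1) = 1 := by omega
    simp [h1, descentWeight, stepWeight, dotWeight, hp]

lemma coeff_zero_gaugeCocycle {ϑ : ℕ → k} {p : ℕ} (hp : ϑ p = 0) (q : ℕ) (g f : k[X]) :
    (gaugeCocycle ϑ p q p g f).coeff 0 = 0 := by
  rcases Nat.lt_or_ge 1 (turn p q p) with h | h
  · obtain ⟨n, hn⟩ := Nat.exists_eq_add_of_le h
    rw [gaugeCocycle, coeff_divX, gaugeDefect_eq, hn, mul_assoc, coeff_X_pow_mul',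
      if_neg (by omega)]
  · rw [gaugeCocycle, coeff_divX, gaugeDefect_eq, descentWeight_loop_eq hp h]
    rcases Nat.eq_zero_or_pos (turn p q p) with h0 | h0
    · obtain rfl : q = p := by
        have := (turn_eq_iff p q p 0).1 h0
        omega
      simp
    · rw [Nat.le_antisymm h h0, C_0, zero_mul, zero_add, pow_one, mul_assoc, coeff_X_mul]
      simp only [mul_coeff_zero, coeff_X_zero, zero_mul, mul_zero]

end

/-! ### Hochschild cocycles without relation defects -/

section
variable {N p r s : ℕ}

/-- The vertices `r` and `s` are joined by an arrow. -/
def Adjacent (r s : ℕ) : Prop := s = r + 1 ∨ r = s + 1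

lemma Adjacent.symm (h : Adjacent r s) : Adjacent s r := Or.symm h

lemma exists_adjacent (hN : 0 < N) (hr : r ≤ N) : ∃ s ≤ N, Adjacent s r := by
  rcases Nat.eq_zero_or_pos r with rfl | hpos
  · exact ⟨1, hN, Or.inr rfl⟩
  · exact ⟨r - 1, by omega, Or.inl (by omega)⟩

lemma exists_adjacent_dist_eq {n : ℕ} (hp : p ≤ N) (hr : r ≤ N) (h : Nat.dist p r = n + 1) :
    ∃ s ≤ N, Adjacent s r ∧ Nat.dist p s = n := by
  simp only [Nat.dist] at h ⊢
  rcases lt_or_ge p r with hpr | hrp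
  · exact ⟨r - 1, by omega, Or.inl (by omega), by omega⟩
  · exact ⟨r + 1, by omega, Or.inr rfl, by omega⟩

lemma Adjacent.turn_self (h : Adjacent r s) : turn r s r = 1 := by
  rw [turn_eq_iff]
  rcases h with h | h <;> omega

lemma Adjacent.turn_add_turn (h : Adjacent r s) (p : ℕ) : turn p r s + turn p s r = 1 := by
  have hrs := (turn_eq_iff p r s _).1 rfl
  have hsr := (turn_eq_iff p s r _).1 rfl
  rcases h with h | h <;> omega

lemma Adjacent.turn_of_dist_eq (h : Adjacent r s) (hd : Nat.dist p s = Nat.dist p r + 1) :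
    turn p r s = 0 := by
  simp only [Nat.dist] at hd
  rw [turn_eq_iff]
  rcases h with h | h <;> omega

lemma Adjacent.dist_eq_or (h : Adjacent r s) (p : ℕ) :
    Nat.dist p s = Nat.dist p r + 1 ∨ Nat.dist p r = Nat.dist p s + 1 := by
  simp only [Nat.dist]
  rcases h with h | h <;> omega

end

section
variable {k : Type*} [Field k]

/-- Hochschild `2`-cocycles of the full subcategory of `C` on the objects `0, …, N`, in terms of
bilinear maps `B p q r g f`, where `f : p → q` and `g : q → r`. -/
structure IsCocycle (N : ℕ) (B : ℕ → ℕ → ℕ → k[X] → k[X] → k[X]) : Prop where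
  linear_fst : ∀ p q r g, IsLinearMap k (fun f => B p q r g f)
  linear_snd : ∀ p q r f, IsLinearMap k (fun g => B p q r g f)
  cocycle : ∀ p q r s, p ≤ N → q ≤ N → r ≤ N → s ≤ N → ∀ h g f,
    mul p q s (B q r s h g) f - B p r s h (mul p q r g f)
      + B p q s (mul q r s h g) f - mul p r s h (B p q r g f) = 0

lemma eq_zero_of_X_pow {M : Type*} [AddCommGroup M] [Module k M] {L : k[X] → M}
    (hL : IsLinearMap k L) (h : ∀ n, L (X ^ n) = 0) (f : k[X]) : L f = 0 := by
  induction f using Polynomial.induction_on' with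
  | add f g hf hg => rw [hL.map_add, hf, hg, add_zero]
  | monomial n a => rw [← C_mul_X_pow_eq_monomial, ← smul_eq_C_mul, hL.map_smul, h, smul_zero]

namespace IsCocycle
variable {N : ℕ} {B : ℕ → ℕ → ℕ → k[X] → k[X] → k[X]}

lemma comp_eq_zero (hB : IsCocycle N B) {q r s : ℕ} (hq : q ≤ N) (hr : r ≤ N) (hs : s ≤ N)
    {h g : k[X]} (hg : ∀ p ≤ N, ∀ f, B p q r g f = 0) (hh : ∀ p ≤ N, ∀ f, B p r s h f = 0) :
    ∀ p ≤ N, ∀ f, B p q s (mul q r s h g) f = 0 := by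
  intro p hp f
  have := hB.cocycle p q r s hp hq hr hs h g f
  rwa [hh p hp, hh q hq, hg p hp, mul_zero_left, mul_zero_right, sub_zero, sub_zero,
    zero_add] at this

lemma X_pow_eq_zero_of_loops (hB : IsCocycle N B)
    (harrow : ∀ r s, r ≤ N → s ≤ N → Adjacent r s → ∀ p ≤ N, ∀ f, B p r s 1 f = 0) {β : ℕ}
    (hloop : ∀ q ≤ N, ∀ p ≤ N, ∀ f, B p q q (X ^ β) f = 0) {q r : ℕ} (hq : q ≤ N) (hr : r ≤ N) :
    ∀ p ≤ N, ∀ f, B p q r (X ^ β) f = 0 := by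
  induction hn : Nat.dist q r generalizing r with
  | zero =>
    obtain rfl := Nat.eq_of_dist_eq_zero hn
    exact hloop q hq
  | succ n ih =>
    obtain ⟨s, hs, hadj, hdist⟩ := exists_adjacent_dist_eq hq hr hn
    have hcomp := hB.comp_eq_zero hq hs hr (ih hs hdist) (harrow s r hs hr hadj)
    simpa only [mul, hadj.turn_of_dist_eq (hn.trans (by rw [hdist])), pow_zero, one_mul] using hcomp

lemma X_pow_eq_zero (hN : 0 < N) (hB : IsCocycle N B) (hone : ∀ p ≤ N, B p p p 1 1 = 0)
    (harrow : ∀ r s, r ≤ N → s ≤ N → Adjacent r s → ∀ p ≤ N, ∀ f, B p r s 1 f = 0) (β : ℕ)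
    {q r : ℕ} (hq : q ≤ N) (hr : r ≤ N) : ∀ p ≤ N, ∀ f, B p q r (X ^ β) f = 0 := by
  induction β generalizing q r with
  | zero =>
    refine hB.X_pow_eq_zero_of_loops harrow (fun q hq p hp f => ?_) hq hr
    have := hB.cocycle p q q q hp hq hq hq 1 1 f
    simpa [hone q hq] using this
  | succ β ih =>
    refine hB.X_pow_eq_zero_of_loops harrow (fun q hq => ?_) hq hr
    obtain ⟨s, hs, hadj⟩ := exists_adjacent hN hq
    have hcomp := hB.comp_eq_zero hq hs hq (ih hq hs) (harrow s q hs hq hadj)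
    simpa only [mul, hadj.symm.turn_self, pow_one, mul_one, ← pow_succ'] using hcomp

lemma eq_zero_of_arrows (hN : 0 < N) (hB : IsCocycle N B) (hone : ∀ p ≤ N, B p p p 1 1 = 0)
    (harrow : ∀ r s, r ≤ N → s ≤ N → Adjacent r s → ∀ p ≤ N, ∀ f, B p r s 1 f = 0)
    {p q r : ℕ} (hp : p ≤ N) (hq : q ≤ N) (hr : r ≤ N) (g f : k[X]) : B p q r g f = 0 :=
  eq_zero_of_X_pow (hB.linear_snd p q r f)
    (fun β => hB.X_pow_eq_zero hN hone harrow β hq hr p hp f) g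

end IsCocycle

/-- The Hochschild coboundary of a `1`-cochain. -/
def coboundary (ζ : ℕ → ℕ → k[X] →ₗ[k] k[X]) (p q r : ℕ) (g f : k[X]) : k[X] :=
  mul p q r (ζ q r g) f - ζ p r (mul p q r g f) + mul p q r g (ζ p q f)

lemma IsCocycle.sub_coboundary {N : ℕ} {B : ℕ → ℕ → ℕ → k[X] → k[X] → k[X]}
    (hB : IsCocycle N B) (ζ : ℕ → ℕ → k[X] →ₗ[k] k[X]) :
    IsCocycle N (fun p q r g f => B p q r g f - coboundary ζ p q r g f) := by
  refine ⟨fun p q r g => ⟨fun x y => ?_, fun c x => ?_⟩,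
    fun p q r f => ⟨fun x y => ?_, fun c x => ?_⟩, fun p q r s hp hq hr hs h g f => ?_⟩
  · simp only [(hB.linear_fst p q r g).map_add, coboundary, mul_add_right', map_add]
    ring
  · simp only [(hB.linear_fst p q r g).map_smul, coboundary, mul_smul_right', map_smul]
    module
  · simp only [(hB.linear_snd p q r f).map_add, coboundary, mul_add_left', map_add]
    ring
  · simp only [(hB.linear_snd p q r f).map_smul, coboundary, mul_smul_left', map_smul]
    module
  · simp only [coboundary, mul_sub_left, mul_sub_right, mul_add_left', mul_add_right',
      mul_mul_assoc]
    linear_combination hB.cocycle p q r s hp hq hr hs h g f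

/-- The constant term of a `2`-cochain on the relation
`a_{r,r+1} · a_{r+1,r} = a_{r,r-1} · a_{r-1,r}`. -/
def relationDefect (B : ℕ → ℕ → ℕ → k[X] → k[X] → k[X]) (r : ℕ) : k :=
  (B r (r + 1) r 1 1 - B r (r - 1) r 1 1).coeff 0

section
variable (N : ℕ) (B : ℕ → ℕ → ℕ → k[X] → k[X] → k[X])

/-- The value of the trivializing cochain on the arrow `a_{r+1,r}`, chosen such that the values
on both sides of the relation at `r` agree; the arrows `a_{r,r+1}` have value `0`. -/
def raisingValue : ℕ → k[X]
  | 0 => 0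
  | r + 1 => raisingValue r + divX (B (r + 1) (r + 2) (r + 1) 1 1 - B (r + 1) r (r + 1) 1 1)

/-- The value of the trivializing cochain on the arrow `a_{sr}`. -/
def arrowValue (r s : ℕ) : k[X] := if s = r + 1 then raisingValue B r else 0

/-- The value on `a_{sr} · w` forced by the value `m` on `w = a_{rp} s^α`, for an arrow `a_{sr}`. -/
def arrowExtension (p r s : ℕ) (m : k[X]) (α : ℕ) : k[X] :=
  X ^ turn p r s * (m + arrowValue B r s * X ^ α) - B p r s 1 (X ^ α)

/-- The value on the dot `s_r`, read off from a factorization into two arrows. -/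
def dotValue (r : ℕ) : k[X] :=
  if r < N then X * raisingValue B r - B r (r + 1) r 1 1
  else X * raisingValue B (r - 1) - B r (r - 1) r 1 1

/-- The value on `s_r · w` forced by the value `m` on `w = a_{rp} s^α`. -/
def dotExtension (p r : ℕ) (m : k[X]) (α : ℕ) : k[X] :=
  X * m + dotValue N B r * X ^ α - B p r r X (X ^ α)

/-- The values on the endomorphisms `s_p^α`. -/
def endoValue (p : ℕ) : ℕ → k[X]
  | 0 => B p p p 1 1
  | α + 1 => dotExtension N B p p (endoValue p α) α

/-- The neighbour of `r` in the direction of `p`. -/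
def closer (p r : ℕ) : ℕ := if p < r then r - 1 else r + 1

/-- The values on `a_{rp} s^α`, by recursion on the distance of `p` and `r`. -/
def pathValue (p : ℕ) : ℕ → ℕ → ℕ → k[X]
  | 0, _, α => endoValue N B p α
  | n + 1, r, α => arrowExtension B p (closer p r) r (pathValue p n (closer p r) α) α

/-- The value of the trivializing cochain on `a_{rp} s^α`. -/
def monomialValue (p r α : ℕ) : k[X] := pathValue N B p (Nat.dist p r) r α

/-- The trivializing `1`-cochain of a `2`-cocycle without relation defects. -/
def primitive (p r : ℕ) : k[X] →ₗ[k] k[X] :=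
  (Polynomial.basisMonomials k).constr k (monomialValue N B p r)

end

section
variable {N p r s : ℕ} {B : ℕ → ℕ → ℕ → k[X] → k[X] → k[X]}

lemma closer_eq (h : Adjacent r s) (hd : Nat.dist p s = Nat.dist p r + 1) : closer p s = r := by
  simp only [Nat.dist] at hd
  unfold closer
  rcases h with h | h <;> split_ifs <;> omega

lemma monomialValue_self (p α : ℕ) : monomialValue N B p p α = endoValue N B p α := by
  rw [monomialValue, Nat.dist_self, pathValue]

lemma monomialValue_of_dist_eq (h : Adjacent r s) (hd : Nat.dist p s = Nat.dist p r + 1) (α : ℕ) :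
    monomialValue N B p s α = arrowExtension B p r s (monomialValue N B p r α) α := by
  rw [monomialValue, monomialValue, hd, pathValue, closer_eq h hd]

lemma primitive_X_pow (p r α : ℕ) : primitive N B p r (X ^ α) = monomialValue N B p r α := by
  rw [X_pow_eq_monomial, ← congrFun (coe_basisMonomials k) α, primitive, Module.Basis.constr_basis]

lemma primitive_one (p r : ℕ) : primitive N B p r 1 = monomialValue N B p r 0 := by
  rw [← primitive_X_pow, pow_zero]

lemma X_mul_arrowValue_add (hrel : ∀ r, 0 < r → r < N → relationDefect B r = 0)
    (hr : r ≤ N) (hs : s ≤ N) (h : Adjacent r s) :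
    X * (arrowValue B r s + arrowValue B s r) = dotValue N B r + B r s r 1 1 := by
  unfold arrowValue dotValue
  rcases h with rfl | rfl
  · rw [if_pos rfl, if_neg (by omega), if_pos (by omega), add_zero, sub_add_cancel]
  · rw [if_neg (by omega), if_pos rfl, zero_add, Nat.add_sub_cancel]
    split_ifs with hlt
    · have hdiv := X_mul_divX (hrel (s + 1) (by omega) hlt)
      rw [Nat.add_sub_cancel] at hdiv
      rw [raisingValue, mul_add, hdiv]
      ring
    · rw [sub_add_cancel]

lemma mul_one_X_pow (p r s α : ℕ) : mul p r s (1 : k[X]) (X ^ α) = X ^ (α + turn p r s) := by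
  rw [mul, _root_.mul_one, pow_add, mul_comm]

lemma arrowExtension_arrowExtension (hB : IsCocycle N B)
    (hrel : ∀ r, 0 < r → r < N → relationDefect B r = 0) (hp : p ≤ N) (hr : r ≤ N) (hs : s ≤ N)
    (h : Adjacent r s) (m : k[X]) (α : ℕ) :
    arrowExtension B p s r (arrowExtension B p r s m α) (α + turn p r s) =
      dotExtension N B p r m α := by
  have hcocycle := hB.cocycle p r s r hp hr hs hr 1 1 (X ^ α)
  have hturn : X ^ turn p s r * X ^ turn p r s = (X : k[X]) := by
    rw [← pow_add, add_comm, h.turn_add_turn, pow_one]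
  rw [mul_one_X_pow] at hcocycle
  simp only [mul, h.turn_self, _root_.mul_one, pow_one, turn_self_right, pow_zero,
    one_mul] at hcocycle
  rw [arrowExtension, arrowExtension, dotExtension, ← sub_eq_of_eq_add
    (X_mul_arrowValue_add hrel hr hs h), pow_add]
  rw [pow_add] at hcocycle
  linear_combination hcocycle + (m + (arrowValue B r s + arrowValue B s r) * X ^ α) * hturn

lemma monomialValue_succ (hB : IsCocycle N B)
    (hrel : ∀ r, 0 < r → r < N → relationDefect B r = 0) (hp : p ≤ N) (hr : r ≤ N) (α : ℕ) :
    monomialValue N B p r (α + 1) = dotExtension N B p r (monomialValue N B p r α) α := by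
  induction hn : Nat.dist p r generalizing r α with
  | zero =>
    obtain rfl := Nat.eq_of_dist_eq_zero hn
    rw [monomialValue_self, monomialValue_self, endoValue]
  | succ n ih =>
    obtain ⟨s, hs, hadj, rfl⟩ := exists_adjacent_dist_eq hp hr hn
    have hturn : turn p s r = 0 := hadj.turn_of_dist_eq hn
    have hturn' : turn p r s = 1 := by have := hadj.turn_add_turn p; omega
    have hloop_s := arrowExtension_arrowExtension hB hrel hp hs hr hadj (monomialValue N B p s α) α
    have hloop_r := arrowExtension_arrowExtension hB hrel hp hr hs hadj.symm
      (monomialValue N B p r α) α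
    rw [hturn, add_zero, ← monomialValue_of_dist_eq hadj hn, ← ih hs α rfl] at hloop_s
    rwa [hturn', hloop_s, ← monomialValue_of_dist_eq hadj hn] at hloop_r

lemma monomialValue_add_turn (hB : IsCocycle N B)
    (hrel : ∀ r, 0 < r → r < N → relationDefect B r = 0) (hp : p ≤ N) (hr : r ≤ N) (hs : s ≤ N)
    (h : Adjacent r s) (α : ℕ) :
    monomialValue N B p s (α + turn p r s) =
      arrowExtension B p r s (monomialValue N B p r α) α := by
  rcases h.dist_eq_or p with hd | hd
  · rw [h.turn_of_dist_eq hd, add_zero, monomialValue_of_dist_eq h hd]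
  · have hturn : turn p s r = 0 := h.symm.turn_of_dist_eq hd
    have hturn' : turn p r s = 1 := by have := h.turn_add_turn p; omega
    have hloop := arrowExtension_arrowExtension hB hrel hp hs hr h.symm (monomialValue N B p s α) α
    rw [hturn, add_zero, ← monomialValue_of_dist_eq h.symm hd] at hloop
    rw [hturn', hloop, monomialValue_succ hB hrel hp hs]

lemma monomialValue_zero_of_adjacent (hB : IsCocycle N B)
    (hrel : ∀ r, 0 < r → r < N → relationDefect B r = 0) (hr : r ≤ N) (hs : s ≤ N)
    (h : Adjacent r s) : monomialValue N B r s 0 = arrowValue B r s := by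
  have harrow := monomialValue_add_turn hB hrel hr hr hs h 0
  have hunit := hB.cocycle r r r s hr hr hr hs 1 1 1
  simp only [turn_self_left, mul_one_right, sub_add_cancel, add_zero, arrowExtension, pow_zero,
    one_mul, _root_.mul_one, monomialValue_self, endoValue] at harrow hunit
  rw [mul, turn_self_left, pow_zero, one_mul, one_mul] at hunit
  rw [harrow]
  linear_combination -hunit

theorem IsCocycle.eq_coboundary_primitive (hN : 0 < N) (hB : IsCocycle N B)
    (hrel : ∀ r, 0 < r → r < N → relationDefect B r = 0) {q : ℕ} (hp : p ≤ N) (hq : q ≤ N)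
    (hr : r ≤ N) (g f : k[X]) : B p q r g f = coboundary (primitive N B) p q r g f := by
  have hsub := hB.sub_coboundary (primitive N B)
  refine sub_eq_zero.1 (hsub.eq_zero_of_arrows hN (fun p _ => ?_)
    (fun r s hr hs h p hp f => ?_) hp hq hr g f)
  · simp [coboundary, primitive_one, monomialValue_self, endoValue]
  · refine eq_zero_of_X_pow (hsub.linear_fst p r s 1) (fun α => ?_) f
    rw [coboundary, mul_one_X_pow, primitive_one, monomialValue_zero_of_adjacent hB hrel hr hs h,
      primitive_X_pow, primitive_X_pow, monomialValue_add_turn hB hrel hp hr hs h, arrowExtension,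
      mul, mul]
    ring

end
end

/-! ### Hochschild cohomology of `𝔅_i⁻` -/

section
variable {k : Type*} [Field k]

lemma Adjacent.mul_self {r s : ℕ} (h : Adjacent r s) (g f : k[X]) :
    mul r s r g f = X * (g * f) := by
  rw [mul, h.turn_self, pow_one, mul_assoc]

/-- A coboundary with values in `𝔅_i⁻` is the coboundary of a cochain with values in `𝔅_i⁻`. -/
lemma coeff_zero_eq_zero_of_coboundary {ζ : ℕ → ℕ → k[X] →ₗ[k] k[X]} {r s : ℕ}
    (h : Adjacent r s) (hself : (coboundary ζ r r r 1 1).coeff 0 = 0)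
    (hloop : ∀ f, (coboundary ζ r s r 1 f).coeff 0 = 0) (f : k[X]) :
    (ζ r r f).coeff 0 = 0 := by
  have hone : (ζ r r 1).coeff 0 = 0 := by simpa [coboundary] using hself
  have hX (f : k[X]) : (ζ r r (X * f)).coeff 0 = 0 := by
    simpa [coboundary, h.mul_self] using hloop f
  rw [← X_mul_divX_add f, map_add, coeff_add, hX, zero_add, ← _root_.mul_one (C _),
    ← smul_eq_C_mul, map_smul, coeff_smul, hone, smul_zero]

end

section
variable {k : Type*} [Field k] {N : ℕ}

lemma val_ofNat_of_le {p : ℕ} (h : p ≤ N) : (Fin.ofNat (N + 1) p : ℕ) = p := by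
  rw [Fin.val_ofNat, Nat.mod_eq_of_lt (by omega)]

lemma ofNat_val (v : Fin (N + 1)) : Fin.ofNat (N + 1) (v : ℕ) = v :=
  Fin.ext (val_ofNat_of_le (by omega))

/-- The length two part of a Hochschild cochain in the form used in `IsCocycle`; only its values at
`p, q, r ≤ N` are meaningful. -/
def curried (φ : Ops k N k[X]) (p q r : ℕ) (g f : k[X]) : k[X] :=
  φ 2 ![Fin.ofNat (N + 1) p, Fin.ofNat (N + 1) q, Fin.ofNat (N + 1) r] ![f, g]

lemma curried_val (φ : Ops k N k[X]) (v : Fin 3 → Fin (N + 1)) (a : Fin 2 → k[X]) :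
    curried φ (v 0) (v 1) (v 2) (a 1) (a 0) = φ 2 v a := by
  rw [curried, ofNat_val, ofNat_val, ofNat_val, ← FinVec.etaExpand_eq v, ← FinVec.etaExpand_eq a]
  rfl

lemma curried_isCocycle {i : Inner N} {φ : Ops k N k[X]} (h : φ ∈ BimodCocycle k i 2) :
    IsCocycle N (curried φ) := by
  refine ⟨fun p q r g => (h.1.2 2 _).1.isLinearMap_fst g,
    fun p q r f => (h.1.2 2 _).1.isLinearMap_snd f, fun p q r s hp hq hr hs c b a => ?_⟩
  have hthree := bimodDiff_three φ ![Fin.ofNat (N + 1) p, Fin.ofNat (N + 1) q,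
    Fin.ofNat (N + 1) r, Fin.ofNat (N + 1) s] ![a, b, c]
  rw [LinearMap.mem_ker.1 h.2] at hthree
  simp only [Matrix.cons_val, val_ofNat_of_le hp, val_ofNat_of_le hq, val_ofNat_of_le hr,
    val_ofNat_of_le hs] at hthree
  exact hthree.symm

/-- The relation defects of a Hochschild cochain at the inner vertices `j ≠ i`; they determine the
class of a `2`-cocycle. -/
def relationClass (i : Inner N) : Ops k N k[X] →ₗ[k] Param k i where
  toFun φ j := relationDefect (curried φ) j
  map_add' φ φ' := by
    funext j
    simp only [relationDefect, curried, Pi.add_apply, coeff_sub, coeff_add]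
    ring
  map_smul' c φ := by
    funext j
    simp only [relationDefect, curried, Pi.smul_apply, coeff_sub, coeff_smul, RingHom.id_apply,
      smul_sub]

lemma relationClass_apply (i : Inner N) (φ : Ops k N k[X])
    (j : {j : ℕ // 0 < j ∧ j < N ∧ j ≠ i.val}) :
    relationClass i φ j = relationDefect (curried φ) j := rfl

lemma coeff_zero_curried_bimodDiff (ψ : Ops k N k[X]) {r s : ℕ} (hr : r ≤ N) (hs : s ≤ N)
    (h : Adjacent r s) : (curried (bimodDiff k N ψ) r s r 1 1).coeff 0 =
      -(ψ 1 ![Fin.ofNat (N + 1) r, Fin.ofNat (N + 1) r] ![X]).coeff 0 := by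
  rw [curried, bimodDiff_two]
  simp only [Matrix.cons_val, val_ofNat_of_le hr, val_ofNat_of_le hs, h.mul_self, coeff_add,
    coeff_sub, mul_coeff_zero, coeff_X_zero, zero_mul, zero_sub, add_zero, _root_.mul_one]

lemma relationClass_bimodDiff (i : Inner N) (ψ : Ops k N k[X]) :
    relationClass i (bimodDiff k N ψ) = 0 := by
  funext ⟨j, h0, hN, _⟩
  rw [relationClass_apply, relationDefect, coeff_sub,
    coeff_zero_curried_bimodDiff ψ hN.le hN (Or.inl rfl),
    coeff_zero_curried_bimodDiff ψ hN.le (by omega) (Or.inr (Nat.sub_add_cancel h0).symm),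
    sub_self, Pi.zero_apply]

/-- The Hochschild `1`-cochain given by a family of linear maps. -/
def cochainOfLinear (N : ℕ) (ζ : ℕ → ℕ → k[X] →ₗ[k] k[X]) : Ops k N k[X] :=
  fun d => match d with
    | 1 => fun v a => ζ (v 0) (v 1) (a 0)
    | _ => 0

lemma bimodDiff_cochainOfLinear_two (ζ : ℕ → ℕ → k[X] →ₗ[k] k[X]) (v : Fin 3 → Fin (N + 1))
    (a : Fin 2 → k[X]) : bimodDiff k N (cochainOfLinear N ζ) 2 v a =
      coboundary ζ (v 0) (v 1) (v 2) (a 1) (a 0) :=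
  bimodDiff_two _ v a

lemma cochainOfLinear_of_ne (ζ : ℕ → ℕ → k[X] →ₗ[k] k[X]) {d : ℕ} (hd : d ≠ 1) :
    cochainOfLinear N ζ d = 0 := by
  match d with
  | 0 | _ + 2 => rfl
  | 1 => exact absurd rfl hd

lemma cochainOfLinear_mem {i : Inner N} {ζ : ℕ → ℕ → k[X] →ₗ[k] k[X]}
    (h : ∀ f, (ζ i.val i.val f).coeff 0 = 0) : cochainOfLinear N ζ ∈ BimodCochain k i 1 := by
  refine ⟨fun d => cochainOfLinear_of_ne ζ, fun d v => ?_⟩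
  match d with
  | 1 =>
    refine ⟨isMultilin_iff.2 fun a n => ?_, fun a h0 h1 => ?_⟩
    · fin_cases n
      exact (ζ (v 0) (v 1)).isLinear
    · have h1' : v 1 = i.mid := h1
      simpa only [cochainOfLinear, h0, h1', Inner.mid_val] using h (a 0)
  | 0 | _ + 2 => exact ⟨isMultilin_zero, fun _ => Submodule.zero_mem _⟩

lemma exists_bimodDiff_eq {i : Inner N} {φ : Ops k N k[X]} (h : φ ∈ BimodCocycle k i 2)
    (hclass : relationClass i φ = 0) : ∃ ψ ∈ BimodCochain k i 1, bimodDiff k N ψ = φ := by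
  have hmid (q : ℕ) (g f : k[X]) : (curried φ i.val q i.val g f).coeff 0 = 0 :=
    (h.1.2 2 _).2 _ (ofNat_val i.mid) (ofNat_val i.mid)
  have hrel (r : ℕ) (h0 : 0 < r) (hN : r < N) : relationDefect (curried φ) r = 0 := by
    by_cases hr : r = i.val
    · rw [hr, relationDefect, coeff_sub, hmid, hmid, sub_zero]
    · exact congrFun hclass ⟨r, h0, hN, hr⟩
  have hprim {p q r : ℕ} (hp : p ≤ N) (hq : q ≤ N) (hr : r ≤ N) (g f : k[X]) :
      curried φ p q r g f = coboundary (primitive N (curried φ)) p q r g f :=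
    (curried_isCocycle h).eq_coboundary_primitive (i.pos.trans i.lt) hrel hp hq hr g f
  have hi : i.val ≤ N := i.lt.le
  refine ⟨cochainOfLinear N (primitive N (curried φ)), cochainOfLinear_mem
    (coeff_zero_eq_zero_of_coboundary (s := i.val + 1) (Or.inl rfl) ?_ fun f => ?_),
    funext fun d => ?_⟩
  · rw [← hprim hi hi hi, hmid]
  · rw [← hprim hi i.lt hi, hmid]
  · by_cases hd : d = 2
    · subst hd
      funext v a
      rw [bimodDiff_cochainOfLinear_two, ← hprim (by omega) (by omega) (by omega), curried_val]
    · rw [bimodDiff_eq_zero (fun d => cochainOfLinear_of_ne _) hd, h.1.1 d hd]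

end

/-! ### The natural transformations `η_ϑ` -/

section
variable {k : Type*} [Field k] {N : ℕ}

lemma Inner.toward_mid (i : Inner N) : i.toward i.mid = i.left := if_neg (lt_irrefl _)

lemma Inner.away_mid (i : Inner N) : i.away i.mid = i.right := if_neg (lt_irrefl _)

/-- The right inverse of `proj` on `𝔅_i⁻` which, for `p = l = i`, treats `T_{i-1}` and `T_{i+1}`
alike. -/
def symmSection (k : Type*) [Field k] (i : Inner N) (p l : Fin (N + 1)) : k[X] →ₗ[k] Mat k N where
  toFun f :=
    if l ≠ i.mid then entry (slot 0 l) (slot 0 p) f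
    else if p ≠ i.mid then entry (slot 0 (i.toward p)) (slot 0 p) f
    else (1 / 2 : k) • (entry (slot 0 i.left) (slot 0 p) (divX f)
      + entry (slot 0 i.right) (slot 0 p) (divX f))
  map_add' f g := by
    split_ifs <;> simp only [entry_add, divX_add]
    module
  map_smul' c f := by
    split_ifs <;>
      simp only [smul_eq_C_mul, divX_C_mul, RingHom.id_apply] <;>
      simp only [← smul_eq_C_mul, entry_smul]
    module

lemma symmSection_of_ne {i : Inner N} (p : Fin (N + 1)) {l : Fin (N + 1)} (hl : l ≠ i.mid)
    (f : k[X]) : symmSection k i p l f = entry (slot 0 l) (slot 0 p) f := by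
  simp [symmSection, hl]

lemma symmSection_to_mid {i : Inner N} {p : Fin (N + 1)} (hp : p ≠ i.mid) (f : k[X]) :
    symmSection k i p i.mid f = entry (slot 0 (i.toward p)) (slot 0 p) f := by
  simp [symmSection, hp]

lemma symmSection_mid (i : Inner N) (f : k[X]) : symmSection k i i.mid i.mid f =
    (1 / 2 : k) • (entry (slot 0 i.left) (slot 0 i.mid) (divX f)
      + entry (slot 0 i.right) (slot 0 i.mid) (divX f)) := by
  simp [symmSection]

lemma symmSection_mem (i : Inner N) (p l : Fin (N + 1)) (f : k[X]) :
    symmSection k i p l f ∈ BraidHom k i p l 0 := by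
  by_cases hl : l = i.mid
  · subst hl
    rw [BraidHom, braidF_obj_mid]
    by_cases hp : p = i.mid
    · subst hp
      rw [symmSection_mid, ← i.toward_mid, ← i.away_mid]
      refine Submodule.smul_mem _ _ (Submodule.add_mem _ ?_ ?_) <;>
        exact entry_mem (by simp) (by simp) (by simp) _
    · rw [symmSection_to_mid hp]
      exact entry_mem (by simp) (by simp) (by simp) _
  · rw [symmSection_of_ne p hl, BraidHom, braidF_obj_of_ne i hl]
    exact entry_mem (by simp) (by simp) (by simp) _

lemma proj_symmSection (h2 : (2 : k) ≠ 0) (i : Inner N) (p l : Fin (N + 1)) {f : k[X]}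
    (hf : f ∈ bimod (k := k) i p l) : proj i p l (symmSection k i p l f) = f := by
  by_cases hl : l = i.mid
  · subst hl
    by_cases hp : p = i.mid
    · subst hp
      have hturn := i.turn_toward_mid_add_turn_mid_toward i.mid
      rw [turn_self_left, add_zero] at hturn
      rw [symmSection_mid, ← i.toward_mid, ← i.away_mid, map_smul, map_add, proj_entry_toward,
        proj_entry_away, hturn, Inner.turn_away_mid, pow_one, X_mul_divX (hf rfl rfl), ← two_smul k,
        smul_smul, one_div_mul_cancel h2, one_smul]
    · rw [symmSection_to_mid hp, proj_entry_toward, Inner.turn_toward_mid hp, pow_zero, one_mul]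
  · rw [symmSection_of_ne p hl, proj_entry_of_ne p hl]

/-- The component `η²_ϑ`. -/
def etaTwo (i : Inner N) (ϑ : Param k i) (v : Fin 3 → Fin (N + 1)) (a : Fin 2 → k[X]) : Mat k N :=
  symmSection k i (v 0) (v 2) (gaugeCocycle ϑ.ext (v 0) (v 1) (v 2) (a 1) (a 0))

lemma etaTwo_isMultilin (i : Inner N) (ϑ : Param k i) (v : Fin 3 → Fin (N + 1)) :
    IsMultilin k (etaTwo i ϑ v) := by
  refine IsMultilin.linearMap_comp (isMultilin_iff.2 fun a n => ?_) (symmSection k i (v 0) (v 2))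
  fin_cases n
  · exact gaugeCocycle_isLinearMap_right ϑ.ext (v 0) (v 1) (v 2) (a 1)
  · exact gaugeCocycle_isLinearMap_left ϑ.ext (v 0) (v 1) (v 2) (a 0)

lemma etaTwo_mem (i : Inner N) (ϑ : Param k i) (v : Fin 3 → Fin (N + 1)) (a : Fin 2 → k[X]) :
    etaTwo i ϑ v a ∈ BraidHom k i (v 0) (v 2) 0 :=
  symmSection_mem i _ _ _

lemma Param.ext_apply {i : Inner N} (ϑ : Param k i) (j : {j : ℕ // 0 < j ∧ j < N ∧ j ≠ i.val}) :
    ϑ.ext j = ϑ j := dif_pos j.2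

lemma Param.ext_mid {i : Inner N} (ϑ : Param k i) : ϑ.ext i.val = 0 := dif_neg fun h => h.2.2 rfl

lemma Param.ext_add {i : Inner N} (ϑ ϑ' : Param k i) : (ϑ + ϑ').ext = ϑ.ext + ϑ'.ext := by
  funext j
  simp only [Param.ext, Pi.add_apply]
  split_ifs <;> simp

lemma Param.ext_smul {i : Inner N} (c : k) (ϑ : Param k i) : (c • ϑ).ext = c • ϑ.ext := by
  funext j
  simp only [Param.ext, Pi.smul_apply]
  split_ifs <;> simp

lemma etaTwo_add (i : Inner N) (ϑ ϑ' : Param k i) :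
    etaTwo i (ϑ + ϑ') = etaTwo i ϑ + etaTwo i ϑ' := by
  funext v a
  simp only [etaTwo, Param.ext_add, gaugeCocycle_add, map_add, Pi.add_apply]

lemma etaTwo_smul (i : Inner N) (c : k) (ϑ : Param k i) :
    etaTwo i (c • ϑ) = c • etaTwo i ϑ := by
  funext v a
  simp only [etaTwo, Param.ext_smul, gaugeCocycle_smul, map_smul, Pi.smul_apply]

lemma underlying_etaTwo (h2 : (2 : k) ≠ 0) (i : Inner N) (ϑ : Param k i)
    (v : Fin 3 → Fin (N + 1)) (a : Fin 2 → k[X]) :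
    underlying i 2 (extendOps i (etaTwo i ϑ)) 2 v a =
      gaugeCocycle ϑ.ext (v 0) (v 1) (v 2) (a 1) (a 0) := by
  rw [underlying_apply]
  refine proj_symmSection h2 i (v 0) (v 2) fun hsource htarget => ?_
  rw [hsource, htarget]
  exact coeff_zero_gaugeCocycle (Param.ext_mid ϑ) _ _ _

lemma bimodDiff_etaTwo (h2 : (2 : k) ≠ 0) (i : Inner N) (ϑ : Param k i) :
    bimodDiff k N (underlying i 2 (extendOps i (etaTwo i ϑ))) 3 = 0 := by
  funext v a
  rw [bimodDiff_three]
  simp only [underlying_etaTwo h2, Matrix.cons_val]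
  exact gaugeCocycle_coboundary_eq_zero _ _ _ _ _ _ _ _

lemma extendOps_two (i : Inner N) (E : (Fin 3 → Fin (N + 1)) → (Fin 2 → k[X]) → Mat k N) :
    extendOps i E 2 = E := rfl

lemma extendOps_add (i : Inner N) (E E' : (Fin 3 → Fin (N + 1)) → (Fin 2 → k[X]) → Mat k N) :
    extendOps i (E + E') = extendOps i E + extendOps i E' := by
  funext d
  match d with
  | 2 => rfl
  | 3 =>
    funext v a
    simp only [Pi.add_apply, extendOps_three, ← map_add]
    simp only [homotopyRHS, extendOps_two, Pi.add_apply, dot_add_left, dot_add_right]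
    congr 1
    abel
  | 0 | 1 | _ + 4 => exact (add_zero 0).symm

lemma extendOps_smul (i : Inner N) (c : k)
    (E : (Fin 3 → Fin (N + 1)) → (Fin 2 → k[X]) → Mat k N) :
    extendOps i (c • E) = c • extendOps i E := by
  funext d
  match d with
  | 2 => rfl
  | 3 =>
    funext v a
    simp only [Pi.smul_apply, extendOps_three, ← map_smul]
    simp only [homotopyRHS, extendOps_two, Pi.smul_apply, dot_smul_left, dot_smul_right, smul_add,
      smul_sub]
  | 0 | 1 | _ + 4 => exact (smul_zero c).symm

/-- The natural transformations `η_ϑ`. -/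
def eta (h2 : (2 : k) ≠ 0) (i : Inner N) :
    Param k i →ₗ[k] NatTrans (idF (k := k)) (braidF i) 2 where
  toFun ϑ := ⟨extendOps i (etaTwo i ϑ), extendOps_mem_natTrans i (etaTwo_isMultilin i ϑ)
    (etaTwo_mem i ϑ) (bimodDiff_etaTwo h2 i ϑ)⟩
  map_add' ϑ ϑ' := Subtype.ext (by simp only [etaTwo_add, extendOps_add, Submodule.coe_add])
  map_smul' c ϑ := Subtype.ext (by
    simp only [etaTwo_smul, extendOps_smul, Submodule.coe_smul, RingHom.id_apply])

lemma eta_coe (h2 : (2 : k) ≠ 0) (i : Inner N) (ϑ : Param k i) :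
    (eta h2 i ϑ : Ops k N (Mat k N)) = extendOps i (etaTwo i ϑ) := rfl

lemma etaTwo_X_pow_mid (i : Inner N) (ϑ : Param k i) (q : Fin (N + 1)) (α β : ℕ) :
    symmSection k i i.mid i.mid (gaugeCocycle ϑ.ext i.mid q i.mid (X ^ β) (X ^ α)) =
      eta2 i ϑ i.mid q i.mid β α := by
  have hcoeff := coeff_zero_gaugeCocycle (Param.ext_mid ϑ) (q : ℕ) (X ^ β) (X ^ α)
  rw [gaugeCocycle_X_pow, coeff_smul, coeff_X_pow] at hcoeff
  rw [gaugeCocycle_X_pow, symmSection_mid, smul_eq_C_mul, divX_C_mul, divX_X_pow,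
    ← smul_eq_C_mul, smul_add, ← entry_smul, ← entry_smul, smul_smul, one_div_mul_eq_div]
  simp only [eta2, ne_eq, not_true_eq_false, if_false]
  split_ifs with hexp
  · rw [Inner.mid_val] at hexp ⊢
    rw [if_pos hexp.symm, smul_eq_mul, _root_.mul_one] at hcoeff
    rw [hcoeff, zero_div, zero_smul, zero_smul]
  · rfl

lemma etaTwo_X_pow (i : Inner N) (ϑ : Param k i) (v : Fin 3 → Fin (N + 1)) (α β : ℕ) :
    etaTwo i ϑ v ![X ^ α, X ^ β] = eta2 i ϑ (v 0) (v 1) (v 2) β α := by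
  change symmSection k i (v 0) (v 2) (gaugeCocycle ϑ.ext (v 0) (v 1) (v 2) (X ^ β) (X ^ α)) = _
  by_cases hl : v 2 = i.mid
  · rw [hl]
    by_cases hj : v 0 = i.mid
    · rw [hj, etaTwo_X_pow_mid]
    · simp only [symmSection_to_mid hj, gaugeCocycle_X_pow, eta2, ne_eq, not_true_eq_false,
        if_false, hj, not_false_eq_true, if_true]
  · simp only [symmSection_of_ne _ hl, gaugeCocycle_X_pow, eta2, ne_eq, hl, not_false_eq_true,
      if_true]

lemma eta_hasComponents (h2 : (2 : k) ≠ 0) (i : Inner N) (ϑ : Param k i) :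
    HasComponents i ϑ (eta h2 i ϑ) := by
  rw [eta_coe]
  refine ⟨extendOps_of_ne i _, etaTwo_X_pow i ϑ, fun v a hv => ?_, fun v a hv => ?_⟩
  · rw [extendOps_three, deltaInv_of_ne _ hv]
  · have hδ := diff_dot_extendOps_three i (etaTwo_mem i ϑ) (bimodDiff_etaTwo h2 i ϑ) v a
    rwa [hv, braidF_obj_mid] at hδ

end

/-! ### Nontriviality and cohomology classes -/

section
variable {k : Type*} [Field k]

lemma eval_one_mul (p q r : ℕ) (g f : k[X]) : (mul p q r g f).eval 1 = g.eval 1 * f.eval 1 := by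
  simp [mul]

lemma eval_one_gaugeCocycle (ϑ : ℕ → k) (p q r α β : ℕ) :
    (gaugeCocycle ϑ p q r (X ^ β) (X ^ α)).eval 1 = coeffC ϑ β p q r := by
  rw [gaugeCocycle_X_pow]
  simp

lemma eq_zero_of_dotWeight_eq_zero {ϑ : ℕ → k} {n : ℕ}
    (h : ∀ j ≤ n, ϑ j = 0 ∨ dotWeight ϑ j = 0) {j : ℕ} (hj : j ≤ n) : ϑ j = 0 := by
  induction j using Nat.strong_induction_on with
  | _ j ih =>
    refine (h j hj).elim id fun hdot => ?_
    rwa [dotWeight, Finset.sum_eq_zero fun v hv => ih v (Finset.mem_range.1 hv)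
      ((Finset.mem_range.1 hv).le.trans hj), mul_zero, zero_add] at hdot

end

section
variable {k : Type*} [Field k] {N : ℕ}

lemma Inner.exists_opposite (i : Inner N) (p : Fin (N + 1)) :
    ∃ q ≠ i.mid, i.toward p ≠ i.toward q := by
  have hp := i.toward_away_val p
  have haway := i.toward_away_val (i.away p)
  refine ⟨i.away p, ?_, ?_⟩ <;> rw [ne_eq, Fin.ext_iff] <;> omega

lemma symmSection_to_mid_apply {i : Inner N} {p : Fin (N + 1)} (hp : p ≠ i.mid)
    {r : Fin (N + 1)} (hr : i.toward p ≠ r) (f : k[X]) :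
    symmSection k i p i.mid f (slot 0 r) (slot 0 p) = 0 := by
  rw [symmSection_to_mid hp, entry_apply, if_neg]
  rintro ⟨h, -⟩
  exact hr (slot_inj.1 h).2

lemma homotopyRHS_etaTwo_apply {i : Inner N} (ϑ : Param k i) {p q : Fin (N + 1)}
    (hp : p ≠ i.mid) (hq : q ≠ i.mid) (hpq : i.toward p ≠ i.toward q) (l : Fin (N + 1))
    (b c : ℕ) :
    (homotopyRHS i (extendOps i (etaTwo i ϑ)) ![p, q, l, i.mid] ![X ^ 0, X ^ b, X ^ c]
        (slot 0 (i.toward q)) (slot 0 p)).eval 1 =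
      (((braidF i).obj l).dot (braid1 i l i.mid (X ^ c))
        (symmSection k i p l (gaugeCocycle ϑ.ext p q l (X ^ b) (X ^ 0)))
          (slot 0 (i.toward q)) (slot 0 p)).eval 1 - coeffC ϑ.ext c q l i.val := by
  change ((_ - (gen q).dot (symmSection k i q i.mid (gaugeCocycle ϑ.ext q l i.mid (X ^ c) (X ^ b)))
      (entry (slot 0 q) (slot 0 p) (X ^ 0)) + symmSection k i p i.mid _
      - symmSection k i p i.mid _ : Mat k N) (slot 0 (i.toward q)) (slot 0 p)).eval 1 = _
  rw [Matrix.sub_apply, Matrix.add_apply, Matrix.sub_apply, symmSection_to_mid_apply hp hpq,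
    symmSection_to_mid_apply hp hpq, add_zero, sub_zero, eval_sub, symmSection_to_mid hq,
    dot_entry_entry, if_pos ⟨rfl, by simp⟩, entry_apply_self, eval_one_mul, eval_one_gaugeCocycle,
    eval_pow, eval_X, one_pow, _root_.mul_one]
  rfl

lemma braid1_mid_dot_symmSection_apply {i : Inner N} {p q : Fin (N + 1)} (hp : p ≠ i.mid)
    (hpq : i.toward p ≠ i.toward q) (g f : k[X]) :
    ((braidF i).obj i.mid).dot (braid1 i i.mid i.mid g) (symmSection k i p i.mid f)
      (slot 0 (i.toward q)) (slot 0 p) = 0 := by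
  rw [symmSection_to_mid hp, braid1_mid i p, braidF_obj_mid]
  simp [dot_add_left, dot_entry_entry, entry_apply, hpq]

lemma eval_one_braid1_dot_symmSection_apply {i : Inner N} {l : Fin (N + 1)} (hl : l ≠ i.mid)
    (p : Fin (N + 1)) (g f : k[X]) :
    (((braidF i).obj l).dot (braid1 i l i.mid g) (symmSection k i p l f)
      (slot 0 (i.toward l)) (slot 0 p)).eval 1 = g.eval 1 * f.eval 1 := by
  rw [symmSection_of_ne p hl, braid1_to_mid i hl, braidF_obj_of_ne i hl, dot_entry_entry,
    if_pos ⟨rfl, by simp⟩, entry_apply_self, eval_one_mul]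

lemma dotWeight_eq_of_homotopyRHS_to_mid {i : Inner N} {ϑ : Param k i}
    (h : ∀ v a, v 2 = i.mid → v 3 = i.mid → homotopyRHS i (extendOps i (etaTwo i ϑ)) v a = 0)
    {q : Fin (N + 1)} (hq : q ≠ i.mid) : dotWeight ϑ.ext q = dotWeight ϑ.ext i.val := by
  obtain ⟨p, hp, hqp⟩ := i.exists_opposite q
  have hcoeff (c : ℕ) : coeffC ϑ.ext c q i.mid i.val = 0 := by
    have happly := homotopyRHS_etaTwo_apply ϑ hp hq hqp.symm i.mid 0 c
    rw [h _ _ rfl rfl, braid1_mid_dot_symmSection_apply hp hqp.symm] at happly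
    simpa using happly.symm
  have h₀ := hcoeff 0
  have h₁ := hcoeff 1
  rw [coeffC_eq, Inner.mid_val] at h₀ h₁
  push_cast at h₀ h₁
  linear_combination h₁ - h₀

lemma dotWeight_eq_of_homotopyRHS_of_ne {i : Inner N} {ϑ : Param k i} {l : Fin (N + 1)}
    (hl : l ≠ i.mid)
    (h : ∀ v a, v 2 = l → v 3 = i.mid → homotopyRHS i (extendOps i (etaTwo i ϑ)) v a = 0)
    {p q : Fin (N + 1)} (hp : p ≠ i.mid) (hq : q ≠ i.mid) (hlq : i.toward l = i.toward q)
    (hpq : i.toward p ≠ i.toward q) : dotWeight ϑ.ext p = dotWeight ϑ.ext q := by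
  have hcoeff (b : ℕ) : coeffC ϑ.ext b p q l = coeffC ϑ.ext 0 q l i.val := by
    have happly := homotopyRHS_etaTwo_apply ϑ hp hq hpq l b 0
    rw [h _ _ rfl rfl, ← hlq, eval_one_braid1_dot_symmSection_apply hl,
      eval_one_gaugeCocycle] at happly
    rw [← sub_eq_zero]
    simpa using happly.symm
  have h₀₁ := (hcoeff 1).trans (hcoeff 0).symm
  rw [coeffC_eq, coeffC_eq] at h₀₁
  push_cast at h₀₁
  linear_combination h₀₁

lemma exists_dotWeight_eq_of_homotopyRHS {i : Inner N} {ϑ : Param k i} {l : Fin (N + 1)}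
    (h : ∀ v a, v 2 = l → v 3 = i.mid → homotopyRHS i (extendOps i (etaTwo i ϑ)) v a = 0) :
    ∃ c, ∀ v : Fin (N + 1), v ≠ i.mid → dotWeight ϑ.ext v = c := by
  by_cases hl : l = i.mid
  · subst hl
    exact ⟨_, fun v hv => dotWeight_eq_of_homotopyRHS_to_mid h hv⟩
  · obtain ⟨p, hp, hlp⟩ := i.exists_opposite l
    refine ⟨dotWeight ϑ.ext p, fun v hv => ?_⟩
    by_cases hlv : i.toward l = i.toward v
    · exact (dotWeight_eq_of_homotopyRHS_of_ne hl h hp hv hlv (hlv ▸ hlp.symm)).symm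
    · rw [dotWeight_eq_of_homotopyRHS_of_ne hl h hv hl rfl (Ne.symm hlv),
        dotWeight_eq_of_homotopyRHS_of_ne hl h hp hl rfl hlp.symm]

lemma eq_zero_of_homotopyRHS {i : Inner N} {ϑ : Param k i} {l : Fin (N + 1)}
    (h : ∀ v a, v 2 = l → v 3 = i.mid → homotopyRHS i (extendOps i (etaTwo i ϑ)) v a = 0) :
    ϑ = 0 := by
  obtain ⟨c, hc⟩ := exists_dotWeight_eq_of_homotopyRHS h
  have hc0 : c = 0 := by
    rw [← hc 0 fun e => i.pos.ne (congrArg Fin.val e)]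
    simp [dotWeight, Param.ext]
  have hext {j : ℕ} (hj : j ≤ N) : ϑ.ext j = 0 := by
    refine eq_zero_of_dotWeight_eq_zero (fun j hj => ?_) hj
    by_cases hji : j = i.val
    · exact Or.inl (hji ▸ ϑ.ext_mid)
    · exact Or.inr ((hc ⟨j, by omega⟩ fun e => hji (congrArg Fin.val e)).trans hc0)
  funext j
  rw [← ϑ.ext_apply]
  exact hext j.2.2.1.le

lemma eta_three_unique (h2 : (2 : k) ≠ 0) (i : Inner N) (ϑ : Param k i)
    (v : Fin 4 → Fin (N + 1)) (a : Fin 3 → k[X]) (hv : v 3 = i.mid) {m : Mat k N}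
    (hm : m ∈ (gen (v 0)).hom (braidObj i) (-1))
    (h : (braidObj i).dot (braidDelta i) m = homotopyRHS i (eta h2 i ϑ) v a) :
    m = (eta h2 i ϑ : Ops k N (Mat k N)) 3 v a := by
  have hη : (eta h2 i ϑ : Ops k N (Mat k N)) 3 v a ∈ BraidHom k i (v 0) (v 3) (-1) :=
    preNat_mem_hom (eta h2 i ϑ).2.1 3 v a
  have hδ := (eta_hasComponents h2 i ϑ).eta_three v a hv
  rw [hv] at hη
  rw [← braidF_obj_mid] at hm
  refine sub_eq_zero.1 (eq_zero_of_diff_dot_eq_zero (Submodule.sub_mem _ hm hη) ?_)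
  rw [braidF_obj_mid, braidObj_diff, dot_sub_right, h, hδ, sub_self]

lemma exists_eta_three_ne_zero (h2 : (2 : k) ≠ 0) {i : Inner N} {ϑ : Param k i} (hϑ : ϑ ≠ 0)
    (l : Fin (N + 1)) :
    ∃ v a, v 2 = l ∧ v 3 = i.mid ∧ (eta h2 i ϑ : Ops k N (Mat k N)) 3 v a ≠ 0 := by
  by_contra! hzero
  refine hϑ (eq_zero_of_homotopyRHS (l := l) fun v a hl hv => ?_)
  rw [← eta_coe h2, ← (eta_hasComponents h2 i ϑ).eta_three v a hv, hzero v a hl hv, dot_zero_right]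

lemma underlying_mem_bimodCocycle {i : Inner N} {η : Ops k N (Mat k N)}
    (h : η ∈ NatTrans idF (braidF i) 2) : underlying i 2 η ∈ BimodCocycle k i 2 := by
  refine ⟨underlying_mem i 2 h.1, LinearMap.mem_ker.2 (funext fun d => ?_)⟩
  by_cases hd : d = 3
  · subst hd
    funext v a
    have hproj := proj_homotopyRHS (fun v a => preNat_mem_hom h.1 2 v a) v a
    rw [← diff_dot_natTrans_three h, proj_diff_dot] at hproj
    exact neg_eq_zero.1 hproj.symm
  · exact bimodDiff_eq_zero (fun d hd => underlying_of_ne i hd η) hd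

lemma relationDefect_gaugeCocycle (ϑ : ℕ → k) (j : ℕ) :
    (gaugeCocycle ϑ (j + 1) (j + 2) (j + 1) 1 1).coeff 0
      - (gaugeCocycle ϑ (j + 1) j (j + 1) 1 1).coeff 0 = -2 * ϑ (j + 1) := by
  have hup : turn (j + 1) (j + 2) (j + 1) = 1 := Adjacent.turn_self (Or.inl rfl)
  have hdown : turn (j + 1) j (j + 1) = 1 := Adjacent.turn_self (Or.inr rfl)
  have h₁ := gaugeCocycle_X_pow ϑ (j + 1) (j + 2) (j + 1) 0 0
  have h₂ := gaugeCocycle_X_pow ϑ (j + 1) j (j + 1) 0 0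
  rw [pow_zero] at h₁ h₂
  rw [h₁, h₂, coeffC_eq, coeffC_eq, hup, hdown]
  simp [descentWeight, stepWeight, dotWeight, Finset.sum_range_succ _ (j + 1)]
  ring

lemma relationClass_eta (h2 : (2 : k) ≠ 0) (i : Inner N) (ϑ : Param k i) :
    relationClass i (underlying i 2 (eta h2 i ϑ)) = (-2 : k) • ϑ := by
  funext ⟨j, h0, hN, hi⟩
  obtain ⟨m, rfl⟩ : ∃ m, j = m + 1 := ⟨j - 1, by omega⟩
  rw [relationClass_apply, relationDefect, coeff_sub, curried, curried, eta_coe,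
    underlying_etaTwo h2, underlying_etaTwo h2]
  simp only [Matrix.cons_val, val_ofNat_of_le hN.le, val_ofNat_of_le (Nat.succ_le_of_lt hN),
    val_ofNat_of_le (show m ≤ N by omega), Nat.add_sub_cancel]
  rw [relationDefect_gaugeCocycle, Pi.smul_apply, smul_eq_mul,
    ← Param.ext_apply ϑ]

lemma mem_natBoundary_iff {i : Inner N} (η : NatTrans (idF (k := k)) (braidF i) 2) :
    η ∈ NatBoundary idF (braidF i) 2 ↔
      relationClass i (underlying i 2 (η : Ops k N (Mat k N))) = 0 := by
  constructor
  · rintro ⟨ζ, hζ, hη⟩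
    change natDiff idF (braidF i) 1 ζ = η at hη
    rw [← hη, underlying_natDiff (show ζ ∈ PreNat idF (braidF i) 1 from hζ),
      relationClass_bimodDiff]
  · intro h
    obtain ⟨ψ, hψ, hcoboundary⟩ := exists_bimodDiff_eq (underlying_mem_bimodCocycle η.2) h
    exact exists_natDiff_eq η.2 hψ hcoboundary.symm

lemma bijective_mk_eta (h2 : (2 : k) ≠ 0) (i : Inner N) :
    Function.Bijective (fun ϑ => HNat.mk idF (braidF i) 2 (eta h2 i ϑ)) := by
  have h2' : (-2 : k) ≠ 0 := neg_ne_zero.2 h2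
  constructor
  · intro ϑ ϑ' h
    have hmem : eta h2 i ϑ - eta h2 i ϑ' ∈ NatBoundary idF (braidF i) 2 :=
      (Submodule.Quotient.eq _).1 h
    rw [← map_sub, mem_natBoundary_iff, relationClass_eta, smul_eq_zero] at hmem
    exact sub_eq_zero.1 (hmem.resolve_left h2')
  · intro c
    obtain ⟨η, rfl⟩ := Submodule.Quotient.mk_surjective _ c
    refine ⟨(-2 : k)⁻¹ • relationClass i (underlying i 2 η), (Submodule.Quotient.eq _).2 ?_⟩
    rw [mem_natBoundary_iff, Submodule.coe_sub, map_sub, map_sub, relationClass_eta,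
      smul_inv_smul₀ h2', sub_self]

lemma mem_bimodBoundary_iff {i : Inner N} {φ : Ops k N k[X]} (h : φ ∈ BimodCocycle k i 2) :
    φ ∈ (BimodCochain k i 1).map (bimodDiff k N) ↔ relationClass i φ = 0 := by
  refine ⟨?_, exists_bimodDiff_eq h⟩
  rintro ⟨ψ, -, rfl⟩
  exact relationClass_bimodDiff i ψ

lemma relationClass_surjOn (h2 : (2 : k) ≠ 0) (i : Inner N) :
    Set.SurjOn (relationClass (k := k) i) (BimodCocycle k i 2) Set.univ := fun ϑ _ =>
  ⟨underlying i 2 (eta h2 i ((-2 : k)⁻¹ • ϑ)), underlying_mem_bimodCocycle (Subtype.prop _), by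
    rw [relationClass_eta, smul_inv_smul₀ (neg_ne_zero.2 h2)]⟩

lemma card_param (i : Inner N) : Nat.card {j : ℕ // 0 < j ∧ j < N ∧ j ≠ i.val} = N - 2 := by
  have hmem (j : ℕ) : j ∈ (Finset.Ioo 0 N).erase i.val ↔ 0 < j ∧ j < N ∧ j ≠ i.val := by
    simp only [Finset.mem_erase, Finset.mem_Ioo]
    tauto
  rw [Nat.subtype_card _ hmem, Finset.card_erase_of_mem (Finset.mem_Ioo.2 ⟨i.pos, i.lt⟩),
    Nat.card_Ioo]
  omega

lemma nonempty_linearEquiv_hhBimod (h2 : (2 : k) ≠ 0) (i : Inner N) :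
    Nonempty ((Fin (N - 2) → k) ≃ₗ[k] HHBimod k i 1) := by
  let L : BimodCocycle k i 2 →ₗ[k] Param k i :=
    relationClass i ∘ₗ (BimodCocycle k i 2).subtype
  have hker : ((BimodCochain k i 1).map (bimodDiff k N)).comap (BimodCocycle k i 2).subtype =
      LinearMap.ker L :=
    Submodule.ext fun φ => mem_bimodBoundary_iff φ.2
  have hsurj : Function.Surjective L := fun ϑ =>
    let ⟨φ, hφ, hϑ⟩ := relationClass_surjOn h2 i (Set.mem_univ ϑ)
    ⟨⟨φ, hφ⟩, hϑ⟩
  have : Finite {j : ℕ // 0 < j ∧ j < N ∧ j ≠ i.val} :=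
    (Set.finite_Ioo 0 N).subset fun j hj => ⟨hj.1, hj.2.1⟩
  exact ⟨LinearEquiv.funCongrLeft k k (Finite.equivFinOfCardEq (card_param i)) ≪≫ₗ
    (L.quotKerEquivOfSurjective hsurj).symm ≪≫ₗ (Submodule.quotEquivOfEq _ _ hker).symm⟩

end

end KLRW

end

theorem mainTheorem9 {k : Type*} [Field k] (h2 : (2 : k) ≠ 0) (N : ℕ) (i : KLRW.Inner N) :
    ∃ η : KLRW.Param k i →ₗ[k] KLRW.NatTrans (KLRW.idF (k := k)) (KLRW.braidF i) 2,
      -- the components of the natural transformations `η_ϑ`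
      (∀ ϑ, KLRW.HasComponents i ϑ (η ϑ)) ∧
      -- the homotopy equation has no other solution of degree `-1`, so it determines `η³`
      (∀ ϑ v a, v 3 = i.mid → ∀ m ∈ (KLRW.gen (k := k) (v 0)).hom (KLRW.braidObj i) (-1),
        (KLRW.braidObj i).dot (KLRW.braidDelta i) m = KLRW.homotopyRHS i (η ϑ) v a →
          m = (η ϑ : KLRW.Ops k N (KLRW.Mat k N)) 3 v a) ∧
      -- if `ϑ ≠ 0`, then `η³` is nontrivial on triples with `a₃ ∈ Hom(T_l, T_i)`, for every `l`
      (∀ ϑ, ϑ ≠ 0 → ∀ l, ∃ v a, v 2 = l ∧ v 3 = i.mid ∧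
        (η ϑ : KLRW.Ops k N (KLRW.Mat k N)) 3 v a ≠ 0) ∧
      -- the classes of the `η_ϑ` parametrize `H² Hom(id, β_i⁻)`
      Function.Bijective (fun ϑ => KLRW.HNat.mk KLRW.idF (KLRW.braidF i) 2 (η ϑ)) ∧
      -- `HH²(𝔅_i⁻) ≅ k^{N-2}`
      Nonempty ((Fin (N - 2) → k) ≃ₗ[k] KLRW.HHBimod k i 1) := by
  exact ⟨KLRW.eta h2 i, KLRW.eta_hasComponents h2 i,
    fun ϑ v a hv _ hm h => KLRW.eta_three_unique h2 i ϑ v a hv hm h,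
    fun _ hϑ l => KLRW.exists_eta_three_ne_zero h2 hϑ l,
    KLRW.bijective_mk_eta h2 i, KLRW.nonempty_linearEquiv_hhBimod h2 i⟩
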